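/- **Second-order PAC bound for low-rank MDPs.** Consider a horizon-$H$ MDP ($H\ge1$) with a measurable observation space $\mathcal X$, a finite action set $\mathcal A$ with $A=|\mathcal A|$, a fixed initial state $x_1$, and costs on the uniform grid $G=\{j/(M-1):0\le j<M\}\subset[0,1]$ ($G=\{0\}$ if $M=1$). At step $h$, given $(x_h,a_h)$, the pair (cost $c_h$, next state $x_{h+1}$) is drawn from a law $P_h(\cdot\mid x_h,a_h)$ on $G\times\mathcal X$ (for instance $C_h(x_h,a_h)\otimes P^{\mathcal X}_h(x_h,a_h)$ with conditionally independent cost and next state). For a policy $\pi$ let $Z^\pi=\sum_{h=1}^Hc_h$, $V^\pi=\mathbb E[Z^\pi]$, and $V^\star=\inf_\pi V^\pi$ over all measurable randomized nonstationary policies; assume $Z^\pi\le1$ almost surely for every $\pi$. Assume that the MDP has rank $d$: $P_h(S\mid x,a)=\phi^\star_h(x,a)^\top\mu^\star_h(S)$ for all measurable $S\subset G\times\mathcal X$, with $\phi_h^\star(x,a)\in\mathbb R^d$, $\|\phi^\star_h(x,a)\|_2\le1$, and $\mathbb R^d$-valued measures $\mu_h^\star$ satisfying $\|\int g\,d\mu_h^\star\|_2\le\|g\|_\infty\sqrt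 d$ for all bounded measurable $g:G\times\mathcal X\to\mathbb R$. Let $\Phi$ be a finite set of measurable maps $\mathcal X\times\mathcal A\to\mathbb R^d$ with $\phi^\star_h\in\Phi$ for all $h$. Let $\mathcal F^{\rm lin}$ be the set of conditional distributions on $G$ (so $f(\cdot\mid x,a)\ge0$ and $\sum_{z\in G}f(z\mid x,a)=1$) of the form $f(z\mid x,a)=\phi(x,a)^\top w(z)$ with $\phi\in\Phi$, $w:G\to\mathbb R^d$, $\max_z\|w(z)\|_2\le\sqrt d$. Write $\bar f(x,a)$ for the mean of $f(\cdot\mid x,a)$. Ties in $\arg\min_a$ are broken by a fixed order on $\mathcal A$. *O-DISCO with uniform action exploration (UAE) and threshold $\tau$.* In episode $k=1,\dots,K$ ($K\ge1$), let $\mathcal F_{k-1}$ be the set of $f=(f_1,\dots,f_H)\in(\mathcal F^{\rm lin})^H$ such that for all $h$ $$\sum_{i<k}\log f_h(z^f_{h,i}\mid x_{h,i},a_{h,i})\ \ge\ \max_{g\in\mathcal F^{\rm lin}}\sum_{i<k}\log g(z^f_{h,i}\mid x_{h,i},a_{h,i})-\tau ,$$ where $z^f_{h,i}=\min(c_{h,i}+y,1)$,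 $y$ is the $u_{h,i}$-quantile of $f_{h+1}(\cdot\mid x'_{h,i},a')$ with $a'=\arg\min_a\bar f_{h+1}(x'_{h,i},a)$, $u_{h,i}$ is an independent uniform seed on $[0,1]$ stored with the tuple, and $f_{H+1}$ is the point mass at $0$ (thus $z^f_{h,i}$ is a sample of the distributional Bellman optimality operator applied to $f_{h+1}$, at $(x_{h,i},a_{h,i})$). Choose $f^{(k)}\in\mathcal F_{k-1}$ minimizing $\min_a\bar f_1(x_1,a)$ over $\mathcal F_{k-1}$ (up to an optimization error of at most $1/K$), let $\pi^k_h(x)=\arg\min_a\bar f^{(k)}_h(x,a)$, and for each $h$ collect a tuple $(x_{h,k},a_{h,k},c_{h,k},x'_{h,k})$, where $x_{h,k}$ is the step-$h$ state when rolling in $\pi^k$ from $x_1$, $a_{h,k}\sim\mathrm{Unif}(\mathcal A)$ and $(c_{h,k},x'_{h,k})\sim P_h(\cdot\mid x_{h,k},a_{h,k})$. The output is $\bar\pi=\mathrm{unif}(\pi^1,\dots,\pi^K)$, so that $V^{\bar\pi}=\frac1K\sum_kV^{\pi^k}$. *Claim.* There are universal constants $c,C>0$ and $p\in\mathbb N$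 such that, in every such setting and for every $\delta\in(0,1)$, with $\beta=dM+\log(|\Phi|/\delta)$ and $L=1+\log(dMHKA)$, with probability at least $1-\delta$ the output of O-DISCO with UAE and threshold $\tau=cL\beta$ satisfies $$V^{\bar\pi}-V^\star\ \le\ C\,L^p\left(H\sqrt{\frac{\overline{\mathrm{Var}}_{1:K}\cdot A\,d\,\beta}{K}}+\frac{A\,d\,H^{2.5}\,\beta}{K}\right),\qquad \overline{\mathrm{Var}}_{1:K}=\frac1K\sum_{k=1}^K\mathrm{Var}(Z^{\pi^k}).$$ -/

import Mathlib

open MeasureTheory ProbabilityTheory Finset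
open scoped ENNReal

namespace DistRL

noncomputable section

/-- The `j`-th point `j / (M - 1)` of the uniform grid of `M` points in `[0, 1]`
(the single point `0` if `M = 1`). Costs and returns are handled through their grid index. -/
def gridVal {M : ℕ} (j : Fin M) : ℝ := (j : ℝ) / ((M : ℝ) - 1)

/-- A horizon-`H` MDP with observations `𝒳`, actions `𝒜` and costs on the uniform grid of `M` points,
started at the fixed state `x₁`. `step h (x, a)` is the joint law of the pair (cost `c_h`, next state
`x_{h+1}`); its first marginal is the cost distribution `C_h(x, a)` and its second marginal is the
transition kernel `P_h(x, a)`. Conditionally independent cost and next state are the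
special case `step h = C h ×ₖ P h`. Steps are numbered `0, …, H - 1`. -/
structure MDP (𝒳 𝒜 : Type*) [MeasurableSpace 𝒳] [MeasurableSpace 𝒜] (H M : ℕ) where
  step : Fin H → Kernel (𝒳 × 𝒜) (Fin M × 𝒳)
  markov : ∀ h, IsMarkovKernel (step h)
  x₁ : 𝒳

/-- A (randomised, nonstationary) policy `π_h : 𝒳 → Δ(𝒜)`. -/
abbrev Policy (𝒳 𝒜 : Type*) (H : ℕ) := Fin H → 𝒳 → PMF 𝒜

/-- Measurability of a policy. -/
def Policy.IsMeasurable {𝒳 𝒜 : Type*} [MeasurableSpace 𝒳] {H : ℕ} (π : Policy 𝒳 𝒜 H) : Prop :=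
  ∀ h a, Measurable fun x => π h x a

section RollIn

variable {𝒳 𝒜 : Type*} [MeasurableSpace 𝒳] [MeasurableSpace 𝒜] {H M : ℕ}

/-- Joint law of (the current state, the cost accumulated so far) after `n` steps of
rolling in `π` from `x₁`. -/
def MDP.rollIn (mdp : MDP 𝒳 𝒜 H M) (π : Policy 𝒳 𝒜 H) : ℕ → Measure (𝒳 × ℝ)
  | 0 => Measure.dirac (mdp.x₁, 0)
  | n + 1 =>
    if hn : n < H then
      (mdp.rollIn π n).bind fun xs =>
        (π ⟨n, hn⟩ xs.1).toMeasure.bind fun a =>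
          (mdp.step ⟨n, hn⟩ (xs.1, a)).map fun cx => (cx.2, xs.2 + gridVal cx.1)
    else mdp.rollIn π n

/-- The law of the state `x_h` under `π`. -/
def MDP.stateLaw (mdp : MDP 𝒳 𝒜 H M) (π : Policy 𝒳 𝒜 H) (h : Fin H) : Measure 𝒳 :=
  (mdp.rollIn π h).map Prod.fst

/-- The law of the return `Z^π = c_1 + ⋯ + c_H` from `x₁`. -/
def MDP.returnLaw (mdp : MDP 𝒳 𝒜 H M) (π : Policy 𝒳 𝒜 H) : Measure ℝ :=
  (mdp.rollIn π H).map Prod.snd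

/-- The value `V^π`, the expected return. -/
def MDP.value (mdp : MDP 𝒳 𝒜 H M) (π : Policy 𝒳 𝒜 H) : ℝ := ∫ z, z ∂(mdp.returnLaw π)

/-- The return variance `Var(Z^π)`. -/
def MDP.returnVar (mdp : MDP 𝒳 𝒜 H M) (π : Policy 𝒳 𝒜 H) : ℝ := variance id (mdp.returnLaw π)

/-- The optimal (minimal) value `V*`. -/
def MDP.optValue (mdp : MDP 𝒳 𝒜 H M) : ℝ :=
  ⨅ π : {π : Policy 𝒳 𝒜 H // π.IsMeasurable}, mdp.value π.1

/-- Cumulative costs lie in `[0, 1]` almost surely, under every policy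
(they are nonnegative by construction). -/
def MDP.Normalized (mdp : MDP 𝒳 𝒜 H M) : Prop :=
  ∀ π : Policy 𝒳 𝒜 H, π.IsMeasurable → ∀ᵐ z ∂(mdp.returnLaw π), z ≤ 1

/-- The MDP has rank `d` with features `φs h = φ*_h`: each one-step law factors as
`φ*_h(x, a)ᵀ μ*_h` for an `ℝ^d`-valued measure `μ*_h` on (cost, next state), with `‖φ*_h‖₂ ≤ 1` and
`‖∫ g dμ*_h‖₂ ≤ ‖g‖_∞ √d`. -/
def MDP.IsLowRank (mdp : MDP 𝒳 𝒜 H M) {d : ℕ}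
    (φs : Fin H → 𝒳 → 𝒜 → EuclideanSpace ℝ (Fin d)) : Prop :=
  (∀ h x a, ‖φs h x a‖ ≤ 1) ∧
  ∃ μs : Fin H → VectorMeasure (Fin M × 𝒳) (EuclideanSpace ℝ (Fin d)),
    (∀ h x a (S : Set (Fin M × 𝒳)), MeasurableSet S →
      (mdp.step h (x, a)).real S = inner ℝ (φs h x a) (μs h S)) ∧
    (∀ h (g : Fin M × 𝒳 → ℝ) (B : ℝ), Measurable g → (∀ y, |g y| ≤ B) →
      ‖∫ᵛ y, g y ∂•(μs h)‖ ≤ B * √d)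

end RollIn

section Classes

variable {𝒳 𝒜 : Type*}

/-- The linear class `F^lin` of conditional distributions
`f(z | x, a) = φ(x, a)ᵀ w(z)` on the grid, with `φ ∈ Φ` and `max_z ‖w(z)‖₂ ≤ √d`. -/
def linClass {d : ℕ} (Φ : Finset (𝒳 → 𝒜 → EuclideanSpace ℝ (Fin d))) (M : ℕ) :
    Set (𝒳 → 𝒜 → Fin M → ℝ) :=
  {f | (∀ x a, f x a ∈ stdSimplex ℝ (Fin M)) ∧
    ∃ φ ∈ Φ, ∃ w : Fin M → EuclideanSpace ℝ (Fin d),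
      (∀ z, ‖w z‖ ≤ √d) ∧ ∀ x a z, f x a z = inner ℝ (φ x a) (w z)}

/-- The mean of a distribution on the grid. -/
def mean {M : ℕ} (p : Fin M → ℝ) : ℝ := ∑ z, p z * gridVal z

theorem minimizers_nonempty [Fintype 𝒜] [Nonempty 𝒜] (q : 𝒜 → ℝ) :
    ({a | ∀ b, q a ≤ q b} : Set 𝒜).toFinite.toFinset.Nonempty := by
  obtain ⟨a, ha⟩ := Finite.exists_min q
  exact ⟨a, by simpa using ha⟩

/-- `argmin_a q(a)`, ties broken by the order of `𝒜`. -/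
def argmin [Fintype 𝒜] [LinearOrder 𝒜] [Nonempty 𝒜] (q : 𝒜 → ℝ) : 𝒜 :=
  ({a | ∀ b, q a ≤ q b} : Set 𝒜).toFinite.toFinset.min' (minimizers_nonempty q)

/-- The greedy action `argmin_a f̄(x, a)`. -/
def greedyAction [Fintype 𝒜] [LinearOrder 𝒜] [Nonempty 𝒜] {M : ℕ}
    (f : 𝒳 → 𝒜 → Fin M → ℝ) (x : 𝒳) : 𝒜 := argmin fun a => mean (f x a)

/-- The greedy policy `π_h(x) = argmin_a f̄_h(x, a)`. -/
def greedyPolicy [Fintype 𝒜] [LinearOrder 𝒜] [Nonempty 𝒜] {H M : ℕ}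
    (f : Fin H → 𝒳 → 𝒜 → Fin M → ℝ) : Policy 𝒳 𝒜 H :=
  fun h x => PMF.pure (greedyAction (f h) x)

/-- The law `f_{h+1}(x', a')` with `a' = argmin_a f̄_{h+1}(x', a)`; after the last step it is
the point mass at `0`. -/
def nextDist [Fintype 𝒜] [LinearOrder 𝒜] [Nonempty 𝒜] {H M : ℕ}
    (f : Fin H → 𝒳 → 𝒜 → Fin M → ℝ) (h : Fin H) (x' : 𝒳) : Fin M → ℝ :=
  if hh : (h : ℕ) + 1 < H then f ⟨h + 1, hh⟩ x' (greedyAction (f ⟨h + 1, hh⟩) x')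
  else fun z => if (z : ℕ) = 0 then 1 else 0

/-- Inverse-CDF sampling: the index of the `u`-quantile of a distribution `p` on the grid. If `u` is
uniform on `[0, 1]`, this is a sample from `p`. -/
def quantile {M : ℕ} (p : Fin M → ℝ) (u : ℝ) : ℕ := #{j : Fin M | ∑ i ∈ Iic j, p i < u}

/-- Addition of grid points, capped at the right end point `1` of `[0, 1]`. -/
def cappedAdd {M : ℕ} (c : Fin M) (y : ℕ) : Fin M :=
  ⟨min (c + y) (M - 1), by have := c.isLt; omega⟩

/-- A transition tuple `((x, a), (c, x'))` together with the seed `u` used for sampling from the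
candidate distributions at `x'`. -/
abbrev Sample (𝒳 𝒜 : Type*) (M : ℕ) := ((𝒳 × 𝒜) × (Fin M × 𝒳)) × ℝ

/-- The sample `z^f_h = c + y` of `T^{⋆,D}_h f_{h+1}(x, a)`: here `y ∼ f_{h+1}(x', a')` and
`a' = argmin_a f̄_{h+1}(x', a)`. -/
def target [Fintype 𝒜] [LinearOrder 𝒜] [Nonempty 𝒜] {H M : ℕ}
    (f : Fin H → 𝒳 → 𝒜 → Fin M → ℝ) (h : Fin H) (s : Sample 𝒳 𝒜 M) : Fin M :=
  cappedAdd s.1.2.1 (quantile (nextDist f h s.1.2.2) s.2)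

/-- The log-likelihood `∑_i log g(z^f_{h,i} | x_{h,i}, a_{h,i})` (with `log 0 = -∞`) of the candidate
`g` for step `h`, where the targets are sampled from `T^{⋆,D}_h f_{h+1}`. -/
def logLik [Fintype 𝒜] [LinearOrder 𝒜] [Nonempty 𝒜] {H M : ℕ} {ι : Type*}
    (f : Fin H → 𝒳 → 𝒜 → Fin M → ℝ) (g : 𝒳 → 𝒜 → Fin M → ℝ) (h : Fin H)
    (I : Finset ι) (D : ι → Fin H → Sample 𝒳 𝒜 M) : EReal :=
  ∑ i ∈ I, ENNReal.log (ENNReal.ofReal (g (D i h).1.1.1 (D i h).1.1.2 (target f h (D i h))))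

/-- The MLE confidence set with threshold `τ`, within the product class `∏_h F`: all `f` such
that for all `h`, `f_h` is `τ`-near-optimal for the log-likelihood with targets from
`T^{⋆,D}_h f_{h+1}`. -/
def confSet [Fintype 𝒜] [LinearOrder 𝒜] [Nonempty 𝒜] {M : ℕ} (H : ℕ) {ι : Type*}
    (F : Set (𝒳 → 𝒜 → Fin M → ℝ)) (τ : ℝ)
    (I : Finset ι) (D : ι → Fin H → Sample 𝒳 𝒜 M) : Set (Fin H → 𝒳 → 𝒜 → Fin M → ℝ) :=
  {f | (∀ h, f h ∈ F) ∧ ∀ h, ∀ g ∈ F, logLik f g h I D - (τ : EReal) ≤ logLik f (f h) h I D}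

/-- The optimistic objective `min_a f̄_1(x₁, a)`. -/
def optimisticValue [Fintype 𝒜] {H M : ℕ} [NeZero H]
    (f : Fin H → 𝒳 → 𝒜 → Fin M → ℝ) (x₁ : 𝒳) : ℝ := ⨅ a, mean (f 0 x₁ a)

end Classes

section Algorithm

variable {𝒳 𝒜 : Type*} [MeasurableSpace 𝒳] [MeasurableSpace 𝒜]
  [Fintype 𝒜] [LinearOrder 𝒜] [Nonempty 𝒜] {H M : ℕ}

/-- The law of a tuple collected at step `h` with uniform action exploration: `x_h ∼ d^π_h`,
`a_h ∼ Unif(𝒜)`, `(c_h, x'_h)` from the MDP, and an independent uniform seed. -/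
def MDP.uaeLaw (mdp : MDP 𝒳 𝒜 H M) (π : Policy 𝒳 𝒜 H) (h : Fin H) :
    Measure (Sample 𝒳 𝒜 M) :=
  (((mdp.stateLaw π h).prod (PMF.uniformOfFintype 𝒜).toMeasure) ⊗ₘ (mdp.step h)).prod
    (volume.restrict (Set.Icc 0 1))

/-- `K` episodes of O-DISCO with uniform action exploration, for the class `∏_h F` and the threshold
`τ`, on a probability space `(Ω, P)`. In episode `k`, `f k` is the optimistic element
of the confidence set built from the data of the episodes before `k` (a minimizer up to an
optimization error `1 / K`), and `D k h` is the tuple collected at step `h` by a rollout of the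
greedy policy of `f k`. `ℱ k` is the information available when episode `k` starts. Only the conditional
law of each of the `H` rollouts of an episode is prescribed. -/
structure IsODiscoRun (mdp : MDP 𝒳 𝒜 H M) [NeZero H] (F : Set (𝒳 → 𝒜 → Fin M → ℝ)) (τ : ℝ)
    {K : ℕ} {Ω : Type*} {mΩ : MeasurableSpace Ω} (P : Measure Ω) (ℱ : Filtration (Fin K) mΩ)
    (f : Fin K → Ω → Fin H → 𝒳 → 𝒜 → Fin M → ℝ)
    (D : Fin K → Fin H → Ω → Sample 𝒳 𝒜 M) : Prop where
  measurable_data : ∀ k h, Measurable (D k h)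
  adapted_data : ∀ i k, i < k → ∀ h, Measurable[ℱ k] (D i h)
  adapted_f : ∀ k h x a z, Measurable[ℱ k] fun ω => f k ω h x a z
  mem_confSet : ∀ k, ∀ᵐ ω ∂P, f k ω ∈ confSet H F τ (Iio k) (fun i h => D i h ω)
  optimistic : ∀ k, ∀ᵐ ω ∂P, ∀ g ∈ confSet H F τ (Iio k) (fun i h => D i h ω),
    optimisticValue (f k ω) mdp.x₁ ≤ optimisticValue g mdp.x₁ + 1 / K
  law_data : ∀ k h (S : Set (Sample 𝒳 𝒜 M)), MeasurableSet S →
    P⟦D k h ⁻¹' S | ℱ k⟧ =ᵐ[P] fun ω => (mdp.uaeLaw (greedyPolicy (f k ω)) h).real S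

/-- The value `V^{π̄}` of the mixture policy `π̄ = unif(π^{1:K})`, which draws `k` uniformly
and then plays `π k`. -/
def MDP.mixtureValue (mdp : MDP 𝒳 𝒜 H M) {K : ℕ} (π : Fin K → Policy 𝒳 𝒜 H) : ℝ :=
  (1 / K : ℝ) * ∑ k, mdp.value (π k)

/-- The average return variance `(1/K) ∑_k Var(Z^{π^k})` of the played policies. -/
def MDP.avgVar (mdp : MDP 𝒳 𝒜 H M) {K : ℕ} (π : Fin K → Policy 𝒳 𝒜 H) : ℝ :=
  (1 / K : ℝ) * ∑ k, mdp.returnVar (π k)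

end Algorithm

end

end DistRL

/-! The regret of one episode is the distance between the two ends of a chain of hybrid laws. The
`n`-th law, `MDP.hybrid`, adds the costs of `n` real steps of the greedy policy of `f` to a draw
from what `f` predicts for the rest. At `n = 0` its mean is the optimistic value; at `n = H` it is
the law of the return. Neighbours differ by one distributional Bellman error, so by data processing
and joint convexity their squared Hellinger distance is at most `MDP.bellmanErr`, and the ends are
at squared distance at most `H` times the sum of these. Two laws on `[0, 1]` at squared Hellinger
distance `h` have means within `4√(h·Var) + 4h` (`abs_mean_sub_le`); this is where the variance
enters. Optimism holds because the fixed point of the optimality backups has value at most `V*`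
(`MDP.optimisticValue_le_optValue`) and lies in all confidence sets with high probability.

To sum over episodes, the on-policy error of episode `k` is compared with its errors on earlier
data. State occupancies are linear in `d`-dimensional features, so the error of `f k` under the
states of `f i` is an inner product `X i ⬝ᵥ θ k`. Uniform actions cost a factor `|𝒜|`, and the `ℓ₁`
eluder bound `sum_diag_le` turns a bound `B` on the past errors into a bound of order `|𝒜| B d log²`
on the diagonal. Cauchy–Schwarz over episodes gives the rate.

The statistical part shows that `B` is of order `L * β`. For fixed labels, compensated products of
square-root likelihood ratios are supermartingales. The difficulty is that the labels depend on the
candidate through an argmin and a quantile, which are discontinuous in its weights, so a uniform net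
does not control them. The label at `(x', u)` is, however, determined by the signs of linear forms
in the weights, and Sauer's lemma counts sign patterns on a finite sample. The data are adaptive,
but low rank makes all one-step laws at a given `h` dominated by `2d` times a single probability
measure `ν` (`MDP.IsLowRank.exists_dominating`), so the joint law of any `m` next states and seeds
is at most `(2d) ^ m` times a product measure (`IsCondLaw.measure_le_pi`). A fixed ghost sample
(`exists_ghost`) then yields a deterministic finite cover (`IsODiscoRun.exists_cover`): with high
probability every candidate has a representative with nearly the same backup and the same labels at
all but `m` tuples, `m` of order `β`. Each wrong label costs only a factor polynomial in the problem
size, because the competing density is mixed with the uniform law and the upper brackets are bounded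
below. -/

namespace DistRL

noncomputable section

/-! ### Squared Hellinger distance and the second-order comparison of means. -/

section Hellinger

variable {ι : Type*} [Fintype ι]

/-- The Bhattacharyya coefficient of two distributions on a finite type. -/
def bhatt (p q : ι → ℝ) : ℝ := ∑ i, √(p i) * √(q i)

/-- The squared Hellinger distance of two distributions on a finite type. -/
def hellSq (p q : ι → ℝ) : ℝ := 1 - bhatt p q

theorem bhatt_nonneg (p q : ι → ℝ) : 0 ≤ bhatt p q :=
  Finset.sum_nonneg fun _ _ => by positivity

theorem hellSq_le_one (p q : ι → ℝ) : hellSq p q ≤ 1 := by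
  have := bhatt_nonneg p q
  unfold hellSq; linarith

theorem hellSq_eq {p q : ι → ℝ} (hp : p ∈ stdSimplex ℝ ι) (hq : q ∈ stdSimplex ℝ ι) :
    hellSq p q = (∑ i, (√(p i) - √(q i)) ^ 2) / 2 := by
  have h : ∀ i, (√(p i) - √(q i)) ^ 2 = p i + q i - 2 * (√(p i) * √(q i)) := fun i => by
    rw [sub_sq, Real.sq_sqrt (hp.1 i), Real.sq_sqrt (hq.1 i)]; ring
  simp only [h, Finset.sum_sub_distrib, Finset.sum_add_distrib, hp.2, hq.2, ← Finset.mul_sum]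
  unfold hellSq bhatt; ring

theorem hellSq_nonneg {p q : ι → ℝ} (hp : p ∈ stdSimplex ℝ ι) (hq : q ∈ stdSimplex ℝ ι) :
    0 ≤ hellSq p q := by
  rw [hellSq_eq hp hq]; positivity

theorem bhatt_le_one {p q : ι → ℝ} (hp : p ∈ stdSimplex ℝ ι) (hq : q ∈ stdSimplex ℝ ι) :
    bhatt p q ≤ 1 := by
  have := hellSq_nonneg hp hq
  unfold hellSq at this; linarith

/-- The differences `√(p 0 i) - √(p n i)` telescope in each coordinate, and Cauchy–Schwarz over the
`n` increments gives the factor `n`. -/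
theorem hellSq_chain {p : ℕ → ι → ℝ} (hp : ∀ n, p n ∈ stdSimplex ℝ ι) (n : ℕ) :
    hellSq (p 0) (p n) ≤ n * ∑ h ∈ range n, hellSq (p h) (p (h + 1)) := by
  have key : ∀ i, (√(p 0 i) - √(p n i)) ^ 2 ≤
      n * ∑ h ∈ range n, (√(p h i) - √(p (h + 1) i)) ^ 2 := fun i => by
    have h1 := Finset.sum_range_sub' (fun h => √(p h i)) n
    rw [← h1]
    simpa using sq_sum_le_card_mul_sum_sq (s := range n) (f := fun h => √(p h i) - √(p (h + 1) i))
  have h2 : ∀ h, hellSq (p h) (p (h + 1)) = (∑ i, (√(p h i) - √(p (h + 1) i)) ^ 2) / 2 :=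
    fun h => hellSq_eq (hp h) (hp (h + 1))
  simp only [h2, hellSq_eq (hp 0) (hp n)]
  rw [← Finset.sum_div, Finset.sum_comm, ← mul_div_assoc, Finset.mul_sum]
  gcongr with i
  exact key i

/-- Change of measure for a bounded nonnegative weight. -/
theorem sum_sub_sq_le {p q : ι → ℝ} (hp : p ∈ stdSimplex ℝ ι) (hq : q ∈ stdSimplex ℝ ι)
    (φ : ι → ℝ) :
    (∑ i, p i * φ i - ∑ i, q i * φ i) ^ 2 ≤
      4 * hellSq p q * (∑ i, p i * φ i ^ 2 + ∑ i, q i * φ i ^ 2) := by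
  have h1 : ∑ i, p i * φ i - ∑ i, q i * φ i =
      ∑ i, (√(p i) - √(q i)) * ((√(p i) + √(q i)) * φ i) := by
    rw [← Finset.sum_sub_distrib]
    refine Finset.sum_congr rfl fun i _ => ?_
    have e1 := Real.sq_sqrt (hp.1 i)
    have e2 := Real.sq_sqrt (hq.1 i)
    linear_combination (- φ i) * e1 + φ i * e2
  rw [h1]
  refine (Finset.sum_mul_sq_le_sq_mul_sq _ _ _).trans ?_
  have h2 : ∑ i, ((√(p i) + √(q i)) * φ i) ^ 2 ≤
      2 * (∑ i, p i * φ i ^ 2 + ∑ i, q i * φ i ^ 2) := by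
    rw [← Finset.sum_add_distrib, Finset.mul_sum]
    refine Finset.sum_le_sum fun i _ => ?_
    have e1 := Real.sq_sqrt (hp.1 i)
    have e2 := Real.sq_sqrt (hq.1 i)
    have e3 : (√(p i) + √(q i)) ^ 2 ≤ 2 * (p i + q i) := by
      nlinarith [sq_nonneg (√(p i) - √(q i))]
    calc ((√(p i) + √(q i)) * φ i) ^ 2 = (√(p i) + √(q i)) ^ 2 * φ i ^ 2 := by ring
      _ ≤ 2 * (p i + q i) * φ i ^ 2 := by gcongr
      _ = _ := by ring
  have h3 : ∑ i, (√(p i) - √(q i)) ^ 2 = 2 * hellSq p q := by rw [hellSq_eq hp hq]; ring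
  rw [h3]
  have := hellSq_nonneg hp hq
  nlinarith

/-- The second-order comparison of means of a `[0, 1]`-valued function. -/
theorem abs_mean_sub_le {p q : ι → ℝ} (hp : p ∈ stdSimplex ℝ ι) (hq : q ∈ stdSimplex ℝ ι)
    {ψ : ι → ℝ} (hψ : ∀ i, ψ i ∈ Set.Icc (0 : ℝ) 1) {V : ℝ}
    (hV : V = ∑ i, q i * (ψ i - ∑ j, q j * ψ j) ^ 2) :
    |∑ i, p i * ψ i - ∑ i, q i * ψ i| ≤ 4 * √(hellSq p q * V) + 4 * hellSq p q := by
  set m := ∑ j, q j * ψ j with hm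
  set h := hellSq p q with hh
  have h0 : 0 ≤ h := hellSq_nonneg hp hq
  have hm0 : 0 ≤ m := Finset.sum_nonneg fun i _ => mul_nonneg (hq.1 i) (hψ i).1
  have hm1 : m ≤ 1 := by
    rw [hm, ← hq.2]
    exact Finset.sum_le_sum fun i _ => mul_le_of_le_one_right (hq.1 i) (hψ i).2
  have hV0 : 0 ≤ V := hV ▸ Finset.sum_nonneg fun i _ => mul_nonneg (hq.1 i) (sq_nonneg _)
  set a := ∑ i, p i * (ψ i - m) ^ 2 with ha
  have ha0 : 0 ≤ a := Finset.sum_nonneg fun i _ => mul_nonneg (hp.1 i) (sq_nonneg _)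
  have hsq : ∀ i, ((ψ i - m) ^ 2) ^ 2 ≤ (ψ i - m) ^ 2 := fun i => by
    have : (ψ i - m) ^ 2 ≤ 1 := by
      have := (hψ i).1; have := (hψ i).2
      rw [sq_le_one_iff_abs_le_one, abs_le]; constructor <;> linarith
    nlinarith [sq_nonneg (ψ i - m)]
  have h1 := sum_sub_sq_le hp hq (fun i => (ψ i - m) ^ 2)
  -- Change of measure for the weight `(ψ - m) ^ 2`, whose square is at most itself: the inequality
  -- is self-bounding in the second moment `a` under `p`, so the variance under `q` alone controls
  -- `a`.
  have h2 : (a - V) ^ 2 ≤ 4 * h * (a + V) := by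
    rw [hV]
    refine h1.trans ?_
    refine mul_le_mul_of_nonneg_left (add_le_add ?_ ?_) (by positivity)
    · exact Finset.sum_le_sum fun i _ => mul_le_mul_of_nonneg_left (hsq i) (hp.1 i)
    · exact Finset.sum_le_sum fun i _ => mul_le_mul_of_nonneg_left (hsq i) (hq.1 i)
  have h3 : a ≤ 3 * V + 4 * h := by
    by_contra hcon
    push Not at hcon
    nlinarith
  have h4 := sum_sub_sq_le hp hq (fun i => ψ i - m)
  have h5 : ∑ i, p i * (ψ i - m) - ∑ i, q i * (ψ i - m) = ∑ i, p i * ψ i - ∑ i, q i * ψ i := by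
    simp only [mul_sub, Finset.sum_sub_distrib, ← Finset.sum_mul, hp.2, hq.2]; ring
  rw [h5, ← hV] at h4
  have h6 : 4 * h * (a + V) ≤ (4 * √(h * V) + 4 * h) ^ 2 := by
    have e := Real.sq_sqrt (mul_nonneg h0 hV0)
    have e' := Real.sqrt_nonneg (h * V)
    nlinarith [mul_nonneg e' h0]
  exact abs_le_of_sq_le_sq (h4.trans h6) (by positivity)

/-- Cauchy–Schwarz for square roots of sums. -/
theorem sum_sqrt_mul_le {ι : Type*} (s : Finset ι) {p q : ι → ℝ} (hp : ∀ i, 0 ≤ p i) (hq : ∀ i, 0 ≤ q i) :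
    ∑ i ∈ s, √(p i) * √(q i) ≤ √(∑ i ∈ s, p i) * √(∑ i ∈ s, q i) := by
  have := Real.sum_sqrt_mul_sqrt_le s hp hq
  simpa using this

theorem sqrt_sub_le_sqrt_abs (a b : ℝ) : √a - √b ≤ √|a - b| := by
  have h : √a ≤ √b + √|a - b| := by
    refine (Real.sqrt_le_sqrt (show a ≤ b + |a - b| by linarith [le_abs_self (a - b)])).trans ?_
    by_cases hb : 0 ≤ b
    · rw [Real.sqrt_le_left (by positivity), add_sq, Real.sq_sqrt hb, Real.sq_sqrt (abs_nonneg _)]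
      nlinarith [mul_nonneg (Real.sqrt_nonneg b) (Real.sqrt_nonneg |a - b|)]
    · rw [Real.sqrt_eq_zero_of_nonpos (le_of_not_ge hb), zero_add]
      exact Real.sqrt_le_sqrt (by linarith)
  linarith

/-- From `√a - √b ≤ √|a - b|` and Cauchy–Schwarz against the total mass 1 of `f`. It allows a backup
to be replaced by an `ℓ₁`-close one at the price of a square root. -/
theorem bhatt_le_add {f p q : ι → ℝ} (hf : f ∈ stdSimplex ℝ ι) :
    bhatt f p ≤ bhatt f q + √(∑ i, |p i - q i|) := by
  have h1 : bhatt f p - bhatt f q ≤ ∑ i, √(f i) * √|p i - q i| := by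
    unfold bhatt
    rw [← Finset.sum_sub_distrib]
    refine Finset.sum_le_sum fun i _ => ?_
    rw [← mul_sub]
    exact mul_le_mul_of_nonneg_left (sqrt_sub_le_sqrt_abs _ _) (Real.sqrt_nonneg _)
  have h2 := sum_sqrt_mul_le univ hf.1 (fun i => abs_nonneg (p i - q i))
  rw [hf.2, Real.sqrt_one, one_mul] at h2
  linarith

end Hellinger

end

end DistRL

namespace DistRL

noncomputable section

/-! ### Roll-in laws with costs counted in grid steps. -/

section OneStep

variable {𝒳 𝒜 S S' : Type*} [MeasurableSpace 𝒳] [MeasurableSpace 𝒜] [MeasurableSpace S]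
  [MeasurableSpace S'] {M : ℕ}

/-- One step of rolling in the decision rule `p` with step law `κ`, where the running summary of
the costs is updated by `u`. -/
def rollStep (p : 𝒳 → PMF 𝒜) (κ : Kernel (𝒳 × 𝒜) (Fin M × 𝒳)) (u : S → Fin M → S)
    (xs : 𝒳 × S) : Measure (𝒳 × S) :=
  (p xs.1).toMeasure.bind fun a => (κ (xs.1, a)).map fun cx => (cx.2, u xs.2 cx.1)

theorem measurable_rollUpdate {u : S → Fin M → S} (hu : ∀ c, Measurable fun s => u s c) :
    Measurable fun y : (𝒳 × S) × (Fin M × 𝒳) => ((y.2.2, u y.1.2 y.2.1) : 𝒳 × S) := by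
  refine Measurable.prodMk (by fun_prop) ?_
  have : Measurable fun y : S × Fin M => u y.1 y.2 :=
    measurable_from_prod_countable_left fun c => hu c
  exact this.comp (f := fun y : (𝒳 × S) × (Fin M × 𝒳) => (y.1.2, y.2.1)) (by fun_prop)

theorem measurable_rollUpdate_right (u : S → Fin M → S) (s : S) :
    Measurable fun cx : Fin M × 𝒳 => ((cx.2, u s cx.1) : 𝒳 × S) :=
  Measurable.prodMk (by fun_prop) ((measurable_of_finite (u s)).comp measurable_fst)

variable [MeasurableSingletonClass 𝒜] [Fintype 𝒜]

theorem lintegral_rollStep (p : 𝒳 → PMF 𝒜) (κ : Kernel (𝒳 × 𝒜) (Fin M × 𝒳))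
    (u : S → Fin M → S) (xs : 𝒳 × S) {F : 𝒳 × S → ℝ≥0∞} (hF : Measurable F) :
    ∫⁻ y, F y ∂(rollStep p κ u xs) =
      ∑ a, p xs.1 a * ∫⁻ cx, F (cx.2, u xs.2 cx.1) ∂(κ (xs.1, a)) := by
  unfold rollStep
  rw [Measure.lintegral_bind (measurable_of_finite _).aemeasurable hF.aemeasurable,
    lintegral_fintype]
  refine Finset.sum_congr rfl fun a _ => ?_
  rw [lintegral_map hF (measurable_rollUpdate_right u xs.2),
    PMF.toMeasure_apply_singleton _ _ (measurableSet_singleton a), mul_comm]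

theorem measurable_rollStep {p : 𝒳 → PMF 𝒜} (hp : ∀ a, Measurable fun x => p x a)
    (κ : Kernel (𝒳 × 𝒜) (Fin M × 𝒳)) [IsSFiniteKernel κ] {u : S → Fin M → S}
    (hu : ∀ c, Measurable fun s => u s c) : Measurable (rollStep p κ u) := by
  refine Measure.measurable_of_measurable_coe _ fun E hE => ?_
  have h1 : ∀ xs, rollStep p κ u xs E =
      ∑ a, p xs.1 a * κ (xs.1, a) (Prod.mk xs ⁻¹'
        {y : (𝒳 × S) × (Fin M × 𝒳) | ((y.2.2, u y.1.2 y.2.1) : 𝒳 × S) ∈ E}) := fun xs => by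
    rw [← lintegral_indicator_one hE, lintegral_rollStep p κ u xs (measurable_one.indicator hE)]
    refine Finset.sum_congr rfl fun a _ => ?_
    congr 1
    have hm := (measurable_rollUpdate_right (𝒳 := 𝒳) u xs.2) hE
    rw [← lintegral_indicator_one]
    · rfl
    · exact hm
  simp_rw [h1]
  refine Finset.measurable_sum _ fun a _ => ((hp a).comp measurable_fst).mul ?_
  exact Kernel.measurable_kernel_prodMk_left (κ := κ.comap (fun xs : 𝒳 × S => (xs.1, a))
    (by fun_prop)) (measurable_rollUpdate hu hE)

theorem isProbabilityMeasure_rollStep (p : 𝒳 → PMF 𝒜) (κ : Kernel (𝒳 × 𝒜) (Fin M × 𝒳))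
    [IsMarkovKernel κ] (u : S → Fin M → S) (xs : 𝒳 × S) :
    IsProbabilityMeasure (rollStep p κ u xs) := by
  constructor
  rw [← lintegral_one, lintegral_rollStep p κ u xs measurable_const]
  simp only [lintegral_const, measure_univ, mul_one]
  rw [← tsum_fintype (L := .unconditional _), PMF.tsum_coe]

theorem integral_bind_of_bound {α β : Type*} [MeasurableSpace α] [MeasurableSpace β]
    (μ : Measure α) [IsProbabilityMeasure μ] {κ : Kernel α β}
    (hκ : ∀ x, IsProbabilityMeasure (κ x)) {F : β → ℝ} (hF : Measurable F) {B : ℝ}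
    (hB : ∀ y, |F y| ≤ B) : ∫ y, F y ∂(μ.bind κ) = ∫ x, ∫ y, F y ∂(κ x) ∂μ := by
  have hκ' : IsMarkovKernel κ := ⟨hκ⟩
  have h1 : Integrable (fun xy : α × β => F xy.2) (μ ⊗ₘ κ) :=
    Integrable.of_bound (hF.comp measurable_snd).aestronglyMeasurable B
      (Filter.Eventually.of_forall fun y => hB y.2)
  have h2 := Measure.integral_compProd h1
  rw [← h2, ← Measure.snd_compProd, Measure.snd,
    integral_map (by fun_prop) hF.aestronglyMeasurable]

theorem integral_rollStep (p : 𝒳 → PMF 𝒜) (κ : Kernel (𝒳 × 𝒜) (Fin M × 𝒳)) [IsMarkovKernel κ]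
    (u : S → Fin M → S) (xs : 𝒳 × S) {F : 𝒳 × S → ℝ} (hF : Measurable F) {B : ℝ}
    (hB : ∀ y, |F y| ≤ B) :
    ∫ y, F y ∂(rollStep p κ u xs) =
      ∑ a, (p xs.1 a).toReal * ∫ cx, F (cx.2, u xs.2 cx.1) ∂(κ (xs.1, a)) := by
  have h1 := integral_bind_of_bound (p xs.1).toMeasure
    (κ := ⟨fun a => (κ (xs.1, a)).map fun cx => (cx.2, u xs.2 cx.1), measurable_of_finite _⟩)
    (fun a => Measure.isProbabilityMeasure_map (measurable_rollUpdate_right u xs.2).aemeasurable)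
    hF hB
  refine h1.trans ?_
  rw [integral_fintype .of_finite]
  refine Finset.sum_congr rfl fun a _ => ?_
  rw [measureReal_def, PMF.toMeasure_apply_singleton _ _ (measurableSet_singleton a), smul_eq_mul]
  congr 1
  exact integral_map (measurable_rollUpdate_right u xs.2).aemeasurable hF.aestronglyMeasurable

theorem rollStep_map (p : 𝒳 → PMF 𝒜) (κ : Kernel (𝒳 × 𝒜) (Fin M × 𝒳))
    (u : S → Fin M → S) (u' : S' → Fin M → S') {g : S → S'} (hg : Measurable g)
    (hgu : ∀ s c, g (u s c) = u' (g s) c) (xs : 𝒳 × S) :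
    rollStep p κ u' (xs.1, g xs.2) = (rollStep p κ u xs).map (Prod.map id g) := by
  refine Measure.ext_of_lintegral _ fun F hF => ?_
  rw [lintegral_rollStep _ _ _ _ hF, lintegral_map hF (by fun_prop),
    lintegral_rollStep _ _ _ _ (F := fun y => F (Prod.map id g y)) (hF.comp (by fun_prop))]
  simp [hgu]

end OneStep

section Roll

variable {𝒳 𝒜 : Type*} [MeasurableSpace 𝒳] [MeasurableSpace 𝒜] {H M : ℕ}

/-- Joint law of the current state and of the number of grid steps accumulated so far. -/
def MDP.rollInN (mdp : MDP 𝒳 𝒜 H M) (π : Policy 𝒳 𝒜 H) : ℕ → Measure (𝒳 × ℕ)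
  | 0 => Measure.dirac (mdp.x₁, 0)
  | n + 1 =>
    if hn : n < H then
      (mdp.rollInN π n).bind (rollStep (π ⟨n, hn⟩) (mdp.step ⟨n, hn⟩) fun s c => s + c)
    else mdp.rollInN π n

theorem MDP.rollIn_succ (mdp : MDP 𝒳 𝒜 H M) (π : Policy 𝒳 𝒜 H) {n : ℕ} (hn : n < H) :
    mdp.rollIn π (n + 1) = (mdp.rollIn π n).bind
      (rollStep (π ⟨n, hn⟩) (mdp.step ⟨n, hn⟩) fun s c => s + gridVal c) := by
  simp only [MDP.rollIn, hn, ↓reduceDIte]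
  rfl

theorem MDP.rollInN_succ (mdp : MDP 𝒳 𝒜 H M) (π : Policy 𝒳 𝒜 H) {n : ℕ} (hn : n < H) :
    mdp.rollInN π (n + 1) = (mdp.rollInN π n).bind
      (rollStep (π ⟨n, hn⟩) (mdp.step ⟨n, hn⟩) fun s c => s + c) := by
  simp only [MDP.rollInN, hn, ↓reduceDIte]

variable [MeasurableSingletonClass 𝒜] [Fintype 𝒜]

theorem MDP.isProbabilityMeasure_rollInN (mdp : MDP 𝒳 𝒜 H M) {π : Policy 𝒳 𝒜 H}
    (hπ : π.IsMeasurable) (n : ℕ) : IsProbabilityMeasure (mdp.rollInN π n) := by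
  induction n with
  | zero => unfold MDP.rollInN; infer_instance
  | succ n ih =>
    by_cases hn : n < H
    · rw [mdp.rollInN_succ π hn]
      have := mdp.markov ⟨n, hn⟩
      exact isProbabilityMeasure_bind
        (measurable_rollStep (hπ _) _ (fun c => measurable_of_countable _)).aemeasurable
        (Filter.Eventually.of_forall fun xs => isProbabilityMeasure_rollStep _ _ _ xs)
    · simpa [MDP.rollInN, hn] using ih

/-- Integer counts make every function of the accumulated cost measurable and let capped addition
act on it exactly. For `M = 1` the division by zero returns 0, in agreement with the grid `{0}`. -/
theorem MDP.rollIn_eq_map (mdp : MDP 𝒳 𝒜 H M) {π : Policy 𝒳 𝒜 H} (hπ : π.IsMeasurable) (n : ℕ) :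
    mdp.rollIn π n =
      (mdp.rollInN π n).map (Prod.map id fun k : ℕ => (k : ℝ) / ((M : ℝ) - 1)) := by
  have hg : Measurable (fun k : ℕ => (k : ℝ) / ((M : ℝ) - 1)) := measurable_of_countable _
  have hG : Measurable (Prod.map (id : 𝒳 → 𝒳) fun k : ℕ => (k : ℝ) / ((M : ℝ) - 1)) := by
    fun_prop
  induction n with
  | zero => simp [MDP.rollIn, MDP.rollInN, Measure.map_dirac' hG]
  | succ n ih =>
    by_cases hn : n < H
    · have := mdp.markov ⟨n, hn⟩
      have hm1 := measurable_rollStep (hπ ⟨n, hn⟩) (mdp.step ⟨n, hn⟩) (S := ℕ) (M := M)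
        (u := fun s c => s + c) (fun c => measurable_of_countable _)
      have hm2 := measurable_rollStep (hπ ⟨n, hn⟩) (mdp.step ⟨n, hn⟩) (S := ℝ) (M := M)
        (u := fun s c => s + gridVal c) (fun c => by fun_prop)
      rw [mdp.rollInN_succ π hn, mdp.rollIn_succ π hn, ih]
      refine Measure.ext_of_lintegral _ fun F hF => ?_
      rw [Measure.lintegral_bind hm2.aemeasurable hF.aemeasurable,
        lintegral_map (f := fun xs => ∫⁻ y, F y ∂(rollStep _ _ _ xs))
          (Measure.measurable_lintegral hF |>.comp hm2) hG, lintegral_map hF hG,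
        Measure.lintegral_bind (f := fun y => F (Prod.map id _ y)) hm1.aemeasurable
          (hF.comp hG).aemeasurable]
      refine lintegral_congr fun xs => ?_
      have h := rollStep_map (π ⟨n, hn⟩) (mdp.step ⟨n, hn⟩) (S := ℕ) (M := M)
        (fun s c => s + c) (fun s c => s + gridVal c) hg
        (fun s c => by simp [gridVal, add_div]) xs
      simp only [Prod.map, id]
      rw [h, lintegral_map hF hG]
      rfl
    · simpa [MDP.rollInN, MDP.rollIn, hn] using ih

theorem MDP.stateLaw_eq (mdp : MDP 𝒳 𝒜 H M) {π : Policy 𝒳 𝒜 H} (hπ : π.IsMeasurable)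
    (h : Fin H) : mdp.stateLaw π h = (mdp.rollInN π h).map Prod.fst := by
  unfold MDP.stateLaw
  rw [mdp.rollIn_eq_map hπ, Measure.map_map (by fun_prop) (by
    have hg : Measurable (fun k : ℕ => (k : ℝ) / ((M : ℝ) - 1)) := measurable_of_countable _
    fun_prop)]
  rfl

theorem MDP.isProbabilityMeasure_stateLaw (mdp : MDP 𝒳 𝒜 H M) {π : Policy 𝒳 𝒜 H}
    (hπ : π.IsMeasurable) (h : Fin H) : IsProbabilityMeasure (mdp.stateLaw π h) := by
  rw [mdp.stateLaw_eq hπ]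
  have := mdp.isProbabilityMeasure_rollInN hπ h
  exact Measure.isProbabilityMeasure_map (by fun_prop)

theorem MDP.returnLaw_eq (mdp : MDP 𝒳 𝒜 H M) {π : Policy 𝒳 𝒜 H} (hπ : π.IsMeasurable) :
    mdp.returnLaw π =
      (mdp.rollInN π H).map fun xs => (xs.2 : ℝ) / ((M : ℝ) - 1) := by
  unfold MDP.returnLaw
  rw [mdp.rollIn_eq_map hπ, Measure.map_map (by fun_prop) (by
    have hg : Measurable (fun k : ℕ => (k : ℝ) / ((M : ℝ) - 1)) := measurable_of_countable _
    fun_prop)]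
  rfl

/-- The one-step formula for expectations of bounded functions under the roll-in law. -/
theorem MDP.integral_rollInN_succ (mdp : MDP 𝒳 𝒜 H M) {π : Policy 𝒳 𝒜 H} (hπ : π.IsMeasurable)
    {n : ℕ} (hn : n < H) {F : 𝒳 × ℕ → ℝ} (hF : Measurable F) {B : ℝ} (hB : ∀ y, |F y| ≤ B) :
    ∫ y, F y ∂(mdp.rollInN π (n + 1)) =
      ∫ xs, ∑ a, (π ⟨n, hn⟩ xs.1 a).toReal *
        ∫ cx, F (cx.2, xs.2 + cx.1) ∂(mdp.step ⟨n, hn⟩ (xs.1, a)) ∂(mdp.rollInN π n) := by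
  have hst := mdp.markov ⟨n, hn⟩
  have hP := mdp.isProbabilityMeasure_rollInN hπ n
  have hm1 := measurable_rollStep (hπ ⟨n, hn⟩) (mdp.step ⟨n, hn⟩) (S := ℕ) (M := M)
    (u := fun s c => s + c) (fun c => measurable_of_countable _)
  have hk : ∀ xs, IsProbabilityMeasure
      (rollStep (π ⟨n, hn⟩) (mdp.step ⟨n, hn⟩) (fun (s : ℕ) c => s + c) xs) :=
    fun xs => isProbabilityMeasure_rollStep _ _ _ xs
  have hi : ∀ xs, ∫ y, F y ∂(rollStep (π ⟨n, hn⟩) (mdp.step ⟨n, hn⟩) (fun (s : ℕ) c => s + c) xs) =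
      ∑ a, (π ⟨n, hn⟩ xs.1 a).toReal *
        ∫ cx, F (cx.2, xs.2 + cx.1) ∂(mdp.step ⟨n, hn⟩ (xs.1, a)) := fun xs =>
    integral_rollStep _ _ _ _ hF hB
  rw [mdp.rollInN_succ π hn]
  simp only [← hi]
  generalize rollStep (π ⟨n, hn⟩) (mdp.step ⟨n, hn⟩) (fun (s : ℕ) c => s + c) = κ at *
  exact integral_bind_of_bound (mdp.rollInN π n) (κ := ⟨κ, hm1⟩) hk hF hB

end Roll

end

end DistRL

namespace DistRL

noncomputable section

set_option linter.unusedSectionVars false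

/-! ### Capped addition of costs, greedy actions, backups and mixtures. -/

section Shift

variable {M : ℕ}

/-- The law of the capped sum `min (z + n) (M - 1)` for `z ∼ p`. -/
def shift (n : ℕ) (p : Fin M → ℝ) (j : Fin M) : ℝ := ∑ z, if cappedAdd z n = j then p z else 0

theorem cappedAdd_comm (c y : Fin M) : cappedAdd c y = cappedAdd y c := by
  simp [cappedAdd, add_comm]

theorem cappedAdd_cappedAdd (z : Fin M) (m n : ℕ) :
    cappedAdd (cappedAdd z m) n = cappedAdd z (n + m) := by
  simp only [cappedAdd, Fin.mk.injEq]; omega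

theorem sum_shift_mul (n : ℕ) (p g : Fin M → ℝ) :
    ∑ j, shift n p j * g j = ∑ z, p z * g (cappedAdd z n) := by
  simp only [shift, Finset.sum_mul, ite_mul, zero_mul]
  rw [Finset.sum_comm]
  simp

theorem shift_mem {n : ℕ} {p : Fin M → ℝ} (hp : p ∈ stdSimplex ℝ (Fin M)) :
    shift n p ∈ stdSimplex ℝ (Fin M) := by
  refine ⟨fun j => Finset.sum_nonneg fun z _ => ?_, ?_⟩
  · split_ifs <;> simp [hp.1 z]
  · simpa [hp.2] using sum_shift_mul n p (fun _ => 1)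

theorem shift_shift (m n : ℕ) (p : Fin M → ℝ) : shift n (shift m p) = shift (n + m) p := by
  funext j
  have := sum_shift_mul m p (fun z => if cappedAdd z n = j then 1 else 0)
  simpa [shift, cappedAdd_cappedAdd, mul_ite, mul_one, mul_zero] using this

theorem shift_zero (p : Fin M → ℝ) : shift 0 p = p := by
  funext j
  have : ∀ z : Fin M, cappedAdd z 0 = z := fun z => by
    ext; simp only [cappedAdd]; have := z.isLt; omega
  simp [shift, this]

/-- Data processing for a deterministic map: Cauchy–Schwarz on each fibre of the capped addition. -/
theorem bhatt_shift_le {n : ℕ} {p q : Fin M → ℝ} (hp : p ∈ stdSimplex ℝ (Fin M))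
    (hq : q ∈ stdSimplex ℝ (Fin M)) : bhatt p q ≤ bhatt (shift n p) (shift n q) := by
  have h1 : bhatt p q = ∑ j, ∑ z ∈ univ.filter (fun z => cappedAdd z n = j), √(p z) * √(q z) := by
    unfold bhatt
    rw [Finset.sum_fiberwise]
  rw [h1]
  refine Finset.sum_le_sum fun j _ => ?_
  refine (sum_sqrt_mul_le _ hp.1 hq.1).trans_eq ?_
  simp only [shift, Finset.sum_filter]

theorem gridVal_mem (j : Fin M) : gridVal j ∈ Set.Icc (0 : ℝ) 1 := by
  unfold gridVal
  have hj := j.isLt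
  have h1 : (1 : ℝ) ≤ M := by exact_mod_cast (by omega : 1 ≤ M)
  refine ⟨div_nonneg (by positivity) (by linarith), div_le_one_of_le₀ ?_ (by linarith)⟩
  have : ((j : ℕ) : ℝ) + 1 ≤ M := by exact_mod_cast hj
  linarith

theorem gridVal_cappedAdd_of_le {z : Fin M} (hz : (z : ℕ) = 0) {n : ℕ}
    (hn : (n : ℝ) / ((M : ℝ) - 1) ≤ 1) : gridVal (cappedAdd z n) = (n : ℝ) / ((M : ℝ) - 1) := by
  have hM := z.isLt
  unfold gridVal cappedAdd
  by_cases h : M = 1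
  · subst h; simp
  · have h1 : (0 : ℝ) < (M : ℝ) - 1 := by
      have : (2 : ℝ) ≤ M := by exact_mod_cast (by omega : 2 ≤ M)
      linarith
    rw [div_le_one h1] at hn
    have h2 : n ≤ M - 1 := by
      have : ((n : ℕ) : ℝ) + 1 ≤ M := by linarith
      have : n + 1 ≤ M := by exact_mod_cast this
      omega
    simp [hz, min_eq_left h2]

theorem gridVal_cappedAdd_le (c y : Fin M) : gridVal (cappedAdd c y) ≤ gridVal c + gridVal y := by
  have hM := c.isLt
  unfold gridVal cappedAdd
  have h1 : (0 : ℝ) ≤ (M : ℝ) - 1 := by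
    have : (1 : ℝ) ≤ M := by exact_mod_cast (by omega : 1 ≤ M)
    linarith
  rw [← add_div]
  gcongr
  have : min ((c : ℕ) + y) (M - 1) ≤ (c : ℕ) + y := min_le_left _ _
  exact_mod_cast this

end Shift

section Greedy

variable {𝒳 𝒜 : Type*} [Fintype 𝒜] [LinearOrder 𝒜] [Nonempty 𝒜] {M : ℕ}

theorem argmin_le (q : 𝒜 → ℝ) (b : 𝒜) : q (argmin q) ≤ q b := by
  have := Finset.min'_mem _ (minimizers_nonempty q)
  simp only [Set.Finite.mem_toFinset, Set.mem_ofPred_eq] at this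
  exact this b

/-- A characterization by finitely many comparisons. It makes the region where a given action is
greedy measurable, and shows that the greedy action depends only on the order of the values. -/
theorem argmin_eq_iff (q : 𝒜 → ℝ) (a : 𝒜) :
    argmin q = a ↔ (∀ b, q a ≤ q b) ∧ ∀ b < a, ¬ ∀ c, q b ≤ q c := by
  constructor
  · rintro rfl
    refine ⟨argmin_le q, fun b hb h => absurd hb (not_lt.2 ?_)⟩
    exact Finset.min'_le _ _ (by simpa using h)
  · rintro ⟨h1, h2⟩
    refine le_antisymm (Finset.min'_le _ _ (by simpa using h1)) ?_
    by_contra h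
    exact h2 _ (not_le.1 h) (argmin_le q)

theorem iInf_eq_argmin (q : 𝒜 → ℝ) : ⨅ a, q a = q (argmin q) :=
  le_antisymm (ciInf_le (Set.finite_range q).bddBelow _) (le_ciInf (argmin_le q))

variable [MeasurableSpace 𝒳]

/-- A measurable conditional distribution on the grid given a state and an action. -/
structure IsCondDist (f : 𝒳 → 𝒜 → Fin M → ℝ) : Prop where
  mem : ∀ x a, f x a ∈ stdSimplex ℝ (Fin M)
  measurable : ∀ a z, Measurable fun x => f x a z

/-- A measurable conditional distribution on the grid given a state. -/
structure IsNextDist (q : 𝒳 → Fin M → ℝ) : Prop where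
  mem : ∀ x, q x ∈ stdSimplex ℝ (Fin M)
  measurable : ∀ z, Measurable fun x => q x z

theorem measurable_mean {f : 𝒳 → 𝒜 → Fin M → ℝ} (hf : IsCondDist f) (a : 𝒜) :
    Measurable fun x => mean (f x a) :=
  Finset.measurable_sum _ fun z _ => (hf.measurable a z).mul_const _

theorem measurableSet_greedyAction {f : 𝒳 → 𝒜 → Fin M → ℝ} (hf : IsCondDist f) (a : 𝒜) :
    MeasurableSet {x | greedyAction f x = a} := by
  have hle : ∀ b c, MeasurableSet {x | mean (f x b) ≤ mean (f x c)} := fun b c =>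
    measurableSet_le (measurable_mean hf b) (measurable_mean hf c)
  have : {x | greedyAction f x = a} = (⋂ b, {x | mean (f x a) ≤ mean (f x b)}) ∩
      ⋂ b, ⋂ (_ : b < a), (⋂ c, {x | mean (f x b) ≤ mean (f x c)})ᶜ := by
    ext x; simp [greedyAction, argmin_eq_iff]
  rw [this]
  exact (MeasurableSet.iInter fun b => hle a b).inter (MeasurableSet.iInter fun b =>
    MeasurableSet.iInter fun _ => (MeasurableSet.iInter fun c => hle b c).compl)

theorem measurable_comp_greedyAction {f : 𝒳 → 𝒜 → Fin M → ℝ} (hf : IsCondDist f)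
    {β : Type*} [MeasurableSpace β] {g : 𝒳 → 𝒜 → β} (hg : ∀ a, Measurable fun x => g x a) :
    Measurable fun x => g x (greedyAction f x) := by
  intro E hE
  have : (fun x => g x (greedyAction f x)) ⁻¹' E =
      ⋃ a, {x | greedyAction f x = a} ∩ (fun x => g x a) ⁻¹' E := by
    ext x; simp
  rw [this]
  exact MeasurableSet.iUnion fun a => (measurableSet_greedyAction hf a).inter (hg a hE)

theorem isMeasurable_greedyPolicy {H : ℕ} {f : Fin H → 𝒳 → 𝒜 → Fin M → ℝ}
    (hf : ∀ h, IsCondDist (f h)) : (greedyPolicy f).IsMeasurable := fun h a =>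
  measurable_comp_greedyAction (hf h) (g := fun _ b => (PMF.pure b) a) fun _ => measurable_const

/-- The distribution `f(x, a)` at the greedy action `a`. -/
def greedyDist (f : 𝒳 → 𝒜 → Fin M → ℝ) (x : 𝒳) : Fin M → ℝ := f x (greedyAction f x)

theorem isNextDist_greedyDist {f : 𝒳 → 𝒜 → Fin M → ℝ} (hf : IsCondDist f) :
    IsNextDist (greedyDist f) :=
  ⟨fun x => hf.mem x _, fun z =>
    measurable_comp_greedyAction hf (g := fun x a => f x a z) fun a => hf.measurable a z⟩

/-- The point mass at `0` on the grid. -/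
def diracZero (M : ℕ) (z : Fin M) : ℝ := if (z : ℕ) = 0 then 1 else 0

theorem diracZero_mem [NeZero M] : diracZero M ∈ stdSimplex ℝ (Fin M) := by
  refine ⟨fun z => ?_, ?_⟩
  · unfold diracZero; split_ifs <;> simp
  · unfold diracZero
    rw [Finset.sum_eq_single (0 : Fin M)]
    · simp
    · intro b _ hb; rw [if_neg]; exact fun h => hb (Fin.ext (by simpa using h))
    · simp

theorem isNextDist_diracZero [NeZero M] : IsNextDist fun _ : 𝒳 => diracZero M :=
  ⟨fun _ => diracZero_mem, fun _ => measurable_const⟩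

/-- The distribution at step `n` along the greedy policy; the point mass at `0` after the end. -/
def curDist {H : ℕ} (f : Fin H → 𝒳 → 𝒜 → Fin M → ℝ) (n : ℕ) (x : 𝒳) : Fin M → ℝ :=
  if hn : n < H then greedyDist (f ⟨n, hn⟩) x else diracZero M

theorem nextDist_eq_curDist {H : ℕ} (f : Fin H → 𝒳 → 𝒜 → Fin M → ℝ) (h : Fin H) :
    nextDist f h = curDist f (h + 1) := by
  funext x; unfold nextDist curDist; split_ifs <;> rfl

theorem isNextDist_curDist [NeZero M] {H : ℕ} {f : Fin H → 𝒳 → 𝒜 → Fin M → ℝ}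
    (hf : ∀ h, IsCondDist (f h)) (n : ℕ) : IsNextDist (curDist f n) := by
  unfold curDist
  split_ifs with hn
  · exact isNextDist_greedyDist (hf _)
  · exact isNextDist_diracZero

end Greedy

section Backup

variable {𝒳 𝒜 : Type*} [MeasurableSpace 𝒳] [MeasurableSpace 𝒜] {M : ℕ}

/-- The distributional Bellman backup of the next-state distribution `q` through the step law `κ`. -/
def backup (κ : Kernel (𝒳 × 𝒜) (Fin M × 𝒳)) (q : 𝒳 → Fin M → ℝ) : 𝒳 → 𝒜 → Fin M → ℝ :=
  fun x a z => ∫ cx, shift cx.1 (q cx.2) z ∂(κ (x, a))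

theorem measurable_shift_comp {Ω : Type*} [MeasurableSpace Ω] {n : Ω → ℕ} (hn : Measurable n)
    {p : Ω → Fin M → ℝ} (hp : ∀ z, Measurable fun ω => p ω z) (j : Fin M) :
    Measurable fun ω => shift (n ω) (p ω) j := by
  unfold shift
  refine Finset.measurable_sum _ fun z _ => Measurable.ite ?_ (hp z) measurable_const
  exact hn (MeasurableSet.of_discrete (s := {k | cappedAdd z k = j}))

theorem measurable_shift_step {q : 𝒳 → Fin M → ℝ} (hq : ∀ z, Measurable fun x => q x z)
    (j : Fin M) : Measurable fun cx : Fin M × 𝒳 => shift cx.1 (q cx.2) j :=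
  measurable_shift_comp (n := fun cx : Fin M × 𝒳 => (cx.1 : ℕ))
    ((measurable_of_finite _).comp measurable_fst) (fun z => (hq z).comp measurable_snd) j

theorem abs_le_one_of_mem {p : Fin M → ℝ} (hp : p ∈ stdSimplex ℝ (Fin M)) (z : Fin M) :
    |p z| ≤ 1 := by
  rw [abs_of_nonneg (hp.1 z), ← hp.2]
  exact Finset.single_le_sum (f := p) (fun i _ => hp.1 i) (mem_univ z)

theorem integrable_shift_step (κ : Kernel (𝒳 × 𝒜) (Fin M × 𝒳)) [IsMarkovKernel κ]
    {q : 𝒳 → Fin M → ℝ} (hq : IsNextDist q) (y : 𝒳 × 𝒜) (j : Fin M) :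
    Integrable (fun cx : Fin M × 𝒳 => shift cx.1 (q cx.2) j) (κ y) :=
  Integrable.of_bound (measurable_shift_step hq.measurable j).aestronglyMeasurable 1
    (Filter.Eventually.of_forall fun _ => abs_le_one_of_mem (shift_mem (hq.mem _)) j)

theorem backup_mem (κ : Kernel (𝒳 × 𝒜) (Fin M × 𝒳)) [IsMarkovKernel κ]
    {q : 𝒳 → Fin M → ℝ} (hq : IsNextDist q) (x : 𝒳) (a : 𝒜) :
    backup κ q x a ∈ stdSimplex ℝ (Fin M) := by
  refine ⟨fun z => integral_nonneg fun cx => (shift_mem (hq.mem _)).1 z, ?_⟩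
  unfold backup
  rw [← integral_finsetSum _ fun z _ => integrable_shift_step κ hq _ z]
  simp [(shift_mem (hq.mem _)).2]

theorem sum_backup_mul (κ : Kernel (𝒳 × 𝒜) (Fin M × 𝒳)) [IsMarkovKernel κ]
    {q : 𝒳 → Fin M → ℝ} (hq : IsNextDist q) (x : 𝒳) (a : 𝒜) (g : Fin M → ℝ) :
    ∑ z, backup κ q x a z * g z =
      ∫ cx, ∑ y, q cx.2 y * g (cappedAdd y cx.1) ∂(κ (x, a)) := by
  simp only [← sum_shift_mul]
  rw [integral_finsetSum _ fun z _ => (integrable_shift_step κ hq _ z).mul_const _]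
  simp only [integral_mul_const]
  rfl

theorem measurable_backup (κ : Kernel (𝒳 × 𝒜) (Fin M × 𝒳)) [IsMarkovKernel κ]
    {q : 𝒳 → Fin M → ℝ} (hq : IsNextDist q) (z : Fin M) :
    Measurable fun y : 𝒳 × 𝒜 => backup κ q y.1 y.2 z := by
  have h : StronglyMeasurable fun cx : Fin M × 𝒳 => shift cx.1 (q cx.2) z :=
    (measurable_shift_step hq.measurable z).stronglyMeasurable
  exact (h.integral_kernel (κ := κ)).measurable

theorem isCondDist_backup (κ : Kernel (𝒳 × 𝒜) (Fin M × 𝒳)) [IsMarkovKernel κ]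
    {q : 𝒳 → Fin M → ℝ} (hq : IsNextDist q) : IsCondDist (backup κ q) :=
  ⟨backup_mem κ hq, fun a z => (measurable_backup κ hq z).comp (by fun_prop : Measurable fun x => (x, a))⟩

end Backup

section Mixture

variable {Ω : Type*} [MeasurableSpace Ω] (μ : Measure Ω) [IsProbabilityMeasure μ] {M : ℕ}

theorem integral_sqrt_mul_sqrt_le {A B : Ω → ℝ} (hA : Measurable A) (hB : Measurable B)
    (hA0 : ∀ ω, A ω ∈ Set.Icc (0 : ℝ) 1) (hB0 : ∀ ω, B ω ∈ Set.Icc (0 : ℝ) 1) :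
    ∫ ω, √(A ω) * √(B ω) ∂μ ≤ √(∫ ω, A ω ∂μ) * √(∫ ω, B ω ∂μ) := by
  have key := integral_mul_le_Lp_mul_Lq_of_nonneg (μ := μ) (f := fun ω => √(A ω))
    (g := fun ω => √(B ω)) Real.HolderConjugate.two_two
    (Filter.Eventually.of_forall fun _ => Real.sqrt_nonneg _)
    (Filter.Eventually.of_forall fun _ => Real.sqrt_nonneg _)
    (MemLp.of_bound hA.sqrt.aestronglyMeasurable 1 (Filter.Eventually.of_forall fun ω => by
      rw [Real.norm_eq_abs, abs_of_nonneg (Real.sqrt_nonneg _)]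
      exact Real.sqrt_le_one.2 (hA0 ω).2))
    (MemLp.of_bound hB.sqrt.aestronglyMeasurable 1 (Filter.Eventually.of_forall fun ω => by
      rw [Real.norm_eq_abs, abs_of_nonneg (Real.sqrt_nonneg _)]
      exact Real.sqrt_le_one.2 (hB0 ω).2))
  simp only [Real.rpow_two, Real.sq_sqrt (hA0 _).1, Real.sq_sqrt (hB0 _).1] at key
  rwa [← Real.sqrt_eq_rpow, ← Real.sqrt_eq_rpow] at key

/-- Joint convexity of the squared Hellinger distance. -/
theorem hellSq_integral_le {A B : Ω → Fin M → ℝ} (hA : ∀ z, Measurable fun ω => A ω z)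
    (hB : ∀ z, Measurable fun ω => B ω z) (hA0 : ∀ ω, A ω ∈ stdSimplex ℝ (Fin M))
    (hB0 : ∀ ω, B ω ∈ stdSimplex ℝ (Fin M)) :
    hellSq (fun z => ∫ ω, A ω z ∂μ) (fun z => ∫ ω, B ω z ∂μ) ≤ ∫ ω, hellSq (A ω) (B ω) ∂μ := by
  have hb : ∀ {C : Ω → Fin M → ℝ}, (∀ ω, C ω ∈ stdSimplex ℝ (Fin M)) →
      ∀ z ω, C ω z ∈ Set.Icc (0 : ℝ) 1 := fun hC z ω =>
    ⟨(hC ω).1 z, (le_abs_self _).trans (abs_le_one_of_mem (hC ω) z)⟩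
  have hint : ∀ z, Integrable (fun ω => √(A ω z) * √(B ω z)) μ := fun z =>
    Integrable.of_bound ((hA z).sqrt.mul (hB z).sqrt).aestronglyMeasurable 1
      (Filter.Eventually.of_forall fun ω => by
        rw [Real.norm_eq_abs, abs_of_nonneg (by positivity)]
        exact mul_le_one₀ (Real.sqrt_le_one.2 (hb hA0 z ω).2) (Real.sqrt_nonneg _)
          (Real.sqrt_le_one.2 (hb hB0 z ω).2))
  unfold hellSq bhatt
  rw [integral_sub (integrable_const _) (integrable_finsetSum _ fun z _ => hint z),
    integral_finsetSum _ fun z _ => hint z]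
  simp only [integral_const, probReal_univ, smul_eq_mul, one_mul]
  gcongr with z
  exact integral_sqrt_mul_sqrt_le μ (hA z) (hB z) (hb hA0 z) (hb hB0 z)

theorem integral_mem_stdSimplex {A : Ω → Fin M → ℝ} (hA : ∀ z, Measurable fun ω => A ω z)
    (hA0 : ∀ ω, A ω ∈ stdSimplex ℝ (Fin M)) :
    (fun z => ∫ ω, A ω z ∂μ) ∈ stdSimplex ℝ (Fin M) := by
  refine ⟨fun z => integral_nonneg fun ω => (hA0 ω).1 z, ?_⟩
  rw [← integral_finsetSum _ fun z _ => Integrable.of_bound (hA z).aestronglyMeasurable 1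
    (Filter.Eventually.of_forall fun ω => abs_le_one_of_mem (hA0 ω) z)]
  simp [(hA0 _).2]

end Mixture

end

end DistRL

namespace DistRL

noncomputable section

set_option linter.unusedSectionVars false

/-! ### Hybrid laws and the regret of one greedy policy. -/

section Regret

variable {𝒳 𝒜 : Type*} [MeasurableSpace 𝒳] [MeasurableSpace 𝒜] [MeasurableSingletonClass 𝒜]
  [Fintype 𝒜] [LinearOrder 𝒜] [Nonempty 𝒜] {H M : ℕ}

theorem sum_pure_mul (b : 𝒜) (G : 𝒜 → ℝ) : ∑ a, (PMF.pure b a).toReal * G a = G b := by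
  rw [Finset.sum_eq_single b]
  · simp
  · intro a _ ha; simp [PMF.pure_apply, ha]
  · simp

theorem shift_integral {Ω : Type*} [MeasurableSpace Ω] (μ : Measure Ω) (n : ℕ)
    {A : Ω → Fin M → ℝ} (hA : ∀ z, Integrable (fun ω => A ω z) μ) (j : Fin M) :
    shift n (fun z => ∫ ω, A ω z ∂μ) j = ∫ ω, shift n (A ω) j ∂μ := by
  unfold shift
  rw [integral_finsetSum]
  · refine Finset.sum_congr rfl fun z _ => ?_
    split_ifs <;> simp
  · intro z _
    split_ifs
    · exact hA z
    · exact integrable_zero _ _ _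

theorem shift_backup (κ : Kernel (𝒳 × 𝒜) (Fin M × 𝒳)) [IsMarkovKernel κ] {q : 𝒳 → Fin M → ℝ}
    (hq : IsNextDist q) (n : ℕ) (x : 𝒳) (a : 𝒜) (j : Fin M) :
    shift n (backup κ q x a) j = ∫ cx, shift (n + cx.1) (q cx.2) j ∂(κ (x, a)) := by
  have h := shift_integral (κ (x, a)) n (A := fun cx => shift cx.1 (q cx.2))
    (fun z => integrable_shift_step κ hq _ z) j
  simp only [shift_shift] at h
  exact h

/-- The law of the capped sum of the costs of the first `n` steps of the greedy policy of `f` and of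
a draw from the distribution predicted by `f` for the remaining costs. -/
def MDP.hybrid (mdp : MDP 𝒳 𝒜 H M) (f : Fin H → 𝒳 → 𝒜 → Fin M → ℝ) (n : ℕ) (j : Fin M) : ℝ :=
  ∫ xs, shift xs.2 (curDist f n xs.1) j ∂(mdp.rollInN (greedyPolicy f) n)

/-- The expected squared Hellinger Bellman error of `f` at step `h` along its greedy policy. -/
def MDP.bellmanErr (mdp : MDP 𝒳 𝒜 H M) (f : Fin H → 𝒳 → 𝒜 → Fin M → ℝ) (h : Fin H) : ℝ :=
  ∫ x, hellSq (f h x (greedyAction (f h) x))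
    (backup (mdp.step h) (nextDist f h) x (greedyAction (f h) x)) ∂(mdp.stateLaw (greedyPolicy f) h)

variable [NeZero M] (mdp : MDP 𝒳 𝒜 H M) {f : Fin H → 𝒳 → 𝒜 → Fin M → ℝ}
  (hf : ∀ h, IsCondDist (f h))

include hf

theorem measurable_shift_curDist (n : ℕ) (j : Fin M) :
    Measurable fun xs : 𝒳 × ℕ => shift xs.2 (curDist f n xs.1) j :=
  measurable_shift_comp measurable_snd
    (fun z => ((isNextDist_curDist hf n).measurable z).comp measurable_fst) j

theorem MDP.hybrid_mem (n : ℕ) : mdp.hybrid f n ∈ stdSimplex ℝ (Fin M) := by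
  have := mdp.isProbabilityMeasure_rollInN (isMeasurable_greedyPolicy hf) n
  exact integral_mem_stdSimplex _ (fun z => measurable_shift_curDist hf n z)
    fun xs => shift_mem ((isNextDist_curDist hf n).mem _)

/-- A real step turns the prediction at `h + 1` into its backup: the shift by the accumulated cost
passes through the integral and composes with the shift by the new cost. -/
theorem MDP.hybrid_succ (h : Fin H) (j : Fin M) :
    mdp.hybrid f (h + 1) j = ∫ xs, shift xs.2 (backup (mdp.step h) (nextDist f h) xs.1
      (greedyAction (f h) xs.1)) j ∂(mdp.rollInN (greedyPolicy f) h) := by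
  have := mdp.markov h
  have hq := isNextDist_curDist hf (h + 1)
  unfold MDP.hybrid
  rw [mdp.integral_rollInN_succ (isMeasurable_greedyPolicy hf) h.isLt
    (measurable_shift_curDist hf (h + 1) j) (B := 1)
    fun xs => abs_le_one_of_mem (shift_mem (hq.mem _)) j]
  refine integral_congr_ae (Filter.Eventually.of_forall fun xs => ?_)
  simp only [greedyPolicy, Fin.eta]
  rw [sum_pure_mul (greedyAction (f h) xs.1) fun a => ∫ cx,
    shift (xs.2 + cx.1) (curDist f (h + 1) cx.2) j ∂(mdp.step h (xs.1, a)),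
    nextDist_eq_curDist, shift_backup _ hq]

theorem measurable_backup_greedy (h : Fin H) (z : Fin M) : Measurable fun x =>
    backup (mdp.step h) (nextDist f h) x (greedyAction (f h) x) z := by
  have := mdp.markov h
  rw [nextDist_eq_curDist]
  exact measurable_comp_greedyAction (hf h) (g := fun x a => backup _ _ x a z) fun a =>
    (isCondDist_backup _ (isNextDist_curDist hf _)).measurable a z

theorem measurable_hellSq_comp {Ω : Type*} [MeasurableSpace Ω] {p q : Ω → Fin M → ℝ}
    (hp : ∀ z, Measurable fun ω => p ω z) (hq : ∀ z, Measurable fun ω => q ω z) :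
    Measurable fun ω => hellSq (p ω) (q ω) := by
  unfold hellSq bhatt
  exact measurable_const.sub (Finset.measurable_sum _ fun z _ => (hp z).sqrt.mul (hq z).sqrt)

/-- Both hybrids are mixtures over the same state and accumulated cost. Joint convexity reduces to
the components and data processing removes the shift; what is left depends on the state alone. -/
theorem MDP.hellSq_hybrid_le (h : Fin H) :
    hellSq (mdp.hybrid f h) (mdp.hybrid f (h + 1)) ≤ mdp.bellmanErr f h := by
  have := mdp.markov h
  have hπ := isMeasurable_greedyPolicy hf
  have hP := mdp.isProbabilityMeasure_rollInN hπ h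
  have hq := isNextDist_curDist hf (h + 1)
  have hb : ∀ x a, backup (mdp.step h) (nextDist f h) x a ∈ stdSimplex ℝ (Fin M) := by
    rw [nextDist_eq_curDist]; exact backup_mem _ hq
  have hc : ∀ x, curDist f h x = f h x (greedyAction (f h) x) := fun x => by
    simp [curDist, greedyDist]
  have hm := measurable_backup_greedy mdp hf h
  have hm' : ∀ z, Measurable fun x => f h x (greedyAction (f h) x) z :=
    (isNextDist_greedyDist (hf h)).measurable
  have e : mdp.hybrid f (h + 1) = fun j => ∫ xs, shift xs.2 (backup (mdp.step h) (nextDist f h) xs.1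
      (greedyAction (f h) xs.1)) j ∂(mdp.rollInN (greedyPolicy f) h) :=
    funext fun j => mdp.hybrid_succ hf h j
  rw [e]
  refine (hellSq_integral_le (mdp.rollInN (greedyPolicy f) h)
    (fun z => measurable_shift_curDist hf h z)
    (fun z => measurable_shift_comp measurable_snd (fun z => (hm z).comp measurable_fst) z)
    (fun xs => shift_mem ((isNextDist_curDist hf h).mem _)) fun xs => shift_mem (hb _ _)).trans ?_
  unfold MDP.bellmanErr
  rw [mdp.stateLaw_eq hπ, integral_map (by fun_prop)
    (measurable_hellSq_comp hf hm' hm).aestronglyMeasurable]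
  have hbd : ∀ {p q : Fin M → ℝ}, p ∈ stdSimplex ℝ (Fin M) → q ∈ stdSimplex ℝ (Fin M) →
      ‖hellSq p q‖ ≤ 1 := fun hp hq => by
    rw [Real.norm_eq_abs, abs_of_nonneg (hellSq_nonneg hp hq)]; exact hellSq_le_one _ _
  refine integral_mono (Integrable.of_bound ?_ 1 ?_) (Integrable.of_bound ?_ 1 ?_) fun xs => ?_
  · exact (measurable_hellSq_comp hf (fun z => measurable_shift_curDist hf h z)
      (fun z => measurable_shift_comp measurable_snd
        (fun z => (hm z).comp measurable_fst) z)).aestronglyMeasurable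
  · exact Filter.Eventually.of_forall fun xs =>
      hbd (shift_mem ((isNextDist_curDist hf h).mem _)) (shift_mem (hb _ _))
  · exact ((measurable_hellSq_comp hf hm' hm).comp measurable_fst).aestronglyMeasurable
  · exact Filter.Eventually.of_forall fun xs => hbd ((hf h).mem _ _) (hb _ _)
  · simp only [hc, hellSq]
    exact sub_le_sub_left (bhatt_shift_le ((hf h).mem _ _) (hb _ _)) 1

theorem MDP.sum_hybrid_zero [NeZero H] :
    ∑ j, mdp.hybrid f 0 j * gridVal j = optimisticValue f mdp.x₁ := by
  have h0 : mdp.hybrid f 0 = f 0 mdp.x₁ (greedyAction (f 0) mdp.x₁) := by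
    funext j
    unfold MDP.hybrid MDP.rollInN
    rw [integral_dirac' _ _ (measurable_shift_curDist hf 0 j).stronglyMeasurable]
    simp [shift_zero, curDist, greedyDist, Nat.pos_of_ne_zero (NeZero.ne H)]
  rw [h0]
  unfold optimisticValue
  rw [iInf_eq_argmin]
  rfl

theorem sum_diracZero_mul (g : Fin M → ℝ) : ∑ z, diracZero M z * g z = g 0 := by
  rw [Finset.sum_eq_single 0]
  · simp [diracZero]
  · intro b _ hb
    have : ¬ (b : ℕ) = 0 := fun h => hb (Fin.ext (by simpa using h))
    simp [diracZero, this]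
  · simp

/-- After the last step the prediction is the point mass at 0, and normalization makes the cap
inactive almost surely, so the capped sum is the return. -/
theorem MDP.sum_hybrid_end (hnorm : mdp.Normalized) {g : ℝ → ℝ} (hg : Measurable g) :
    ∑ j, mdp.hybrid f H j * g (gridVal j) = ∫ z, g z ∂(mdp.returnLaw (greedyPolicy f)) := by
  have hπ := isMeasurable_greedyPolicy hf
  have hP := mdp.isProbabilityMeasure_rollInN hπ H
  have hd : Measurable fun xs : 𝒳 × ℕ => (xs.2 : ℝ) / ((M : ℝ) - 1) :=
    (measurable_of_countable fun k : ℕ => (k : ℝ) / ((M : ℝ) - 1)).comp measurable_snd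
  have hn := hnorm _ hπ
  rw [mdp.returnLaw_eq hπ] at hn ⊢
  rw [integral_map hd.aemeasurable hg.aestronglyMeasurable]
  have hn' := ae_of_ae_map hd.aemeasurable hn
  have hint : ∀ j, Integrable (fun xs : 𝒳 × ℕ => shift xs.2 (curDist f H xs.1) j)
      (mdp.rollInN (greedyPolicy f) H) := fun j =>
    Integrable.of_bound (measurable_shift_curDist hf H j).aestronglyMeasurable 1
      (Filter.Eventually.of_forall fun xs =>
        abs_le_one_of_mem (shift_mem ((isNextDist_curDist hf H).mem _)) j)
  simp only [MDP.hybrid, ← integral_mul_const]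
  rw [← integral_finsetSum _ fun j _ => (hint j).mul_const _]
  refine integral_congr_ae (hn'.mono fun xs hxs => ?_)
  simp only
  rw [sum_shift_mul xs.2 (curDist f H xs.1) fun j => g (gridVal j)]
  simp only [curDist, lt_irrefl, ↓reduceDIte]
  rw [sum_diracZero_mul hf fun z => g (gridVal (cappedAdd z xs.2)),
    gridVal_cappedAdd_of_le (by simp) hxs]

theorem MDP.value_greedyPolicy (hnorm : mdp.Normalized) :
    mdp.value (greedyPolicy f) = ∑ j, mdp.hybrid f H j * gridVal j :=
  (mdp.sum_hybrid_end hf hnorm measurable_id).symm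

theorem MDP.returnVar_greedyPolicy (hnorm : mdp.Normalized) :
    mdp.returnVar (greedyPolicy f) =
      ∑ j, mdp.hybrid f H j * (gridVal j - ∑ i, mdp.hybrid f H i * gridVal i) ^ 2 := by
  rw [← mdp.value_greedyPolicy hf hnorm]
  unfold MDP.returnVar
  rw [variance_eq_integral aemeasurable_id]
  exact (mdp.sum_hybrid_end hf hnorm (g := fun z => (z - mdp.value (greedyPolicy f)) ^ 2)
    (by fun_prop)).symm

/-- The second-order regret bound of one greedy policy. -/
theorem MDP.value_sub_optimisticValue_le [NeZero H] (hnorm : mdp.Normalized) :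
    mdp.value (greedyPolicy f) - optimisticValue f mdp.x₁ ≤
      4 * √(H * (∑ h, mdp.bellmanErr f h) * mdp.returnVar (greedyPolicy f)) +
        4 * (H * ∑ h, mdp.bellmanErr f h) := by
  have hmem := mdp.hybrid_mem hf
  have h1 := abs_mean_sub_le (hmem 0) (hmem H) gridVal_mem (mdp.returnVar_greedyPolicy hf hnorm)
  rw [mdp.sum_hybrid_zero hf, ← mdp.value_greedyPolicy hf hnorm, abs_sub_comm] at h1
  have h2 : hellSq (mdp.hybrid f 0) (mdp.hybrid f H) ≤ H * ∑ h, mdp.bellmanErr f h := by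
    refine (hellSq_chain hmem H).trans ?_
    rw [Finset.sum_range]
    gcongr with h
    exact mdp.hellSq_hybrid_le hf h
  refine (le_abs_self _).trans (h1.trans ?_)
  have hV : 0 ≤ mdp.returnVar (greedyPolicy f) := variance_nonneg _ _
  gcongr

theorem MDP.bellmanErr_mem (h : Fin H) : mdp.bellmanErr f h ∈ Set.Icc (0 : ℝ) 1 := by
  have := mdp.markov h
  have hP := mdp.isProbabilityMeasure_stateLaw (isMeasurable_greedyPolicy hf) h
  have hb : ∀ x a, backup (mdp.step h) (nextDist f h) x a ∈ stdSimplex ℝ (Fin M) := by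
    rw [nextDist_eq_curDist]; exact backup_mem _ (isNextDist_curDist hf (h + 1))
  have hm' : ∀ z, Measurable fun x => f h x (greedyAction (f h) x) z :=
    (isNextDist_greedyDist (hf h)).measurable
  refine ⟨integral_nonneg fun x => hellSq_nonneg ((hf h).mem _ _) (hb _ _), ?_⟩
  have := integral_mono_of_nonneg (μ := mdp.stateLaw (greedyPolicy f) h)
    (Filter.Eventually.of_forall fun x => hellSq_nonneg ((hf h).mem x (greedyAction (f h) x))
      (hb x (greedyAction (f h) x))) (integrable_const (1 : ℝ))
    (Filter.Eventually.of_forall fun x => hellSq_le_one _ _)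
  rw [integral_const, probReal_univ, one_smul] at this
  exact this

end Regret

/-! ### The fixed point of the optimality backups is optimistic. -/

section Optimism

variable {𝒳 𝒜 : Type*} [MeasurableSpace 𝒳] [MeasurableSpace 𝒜] [MeasurableSingletonClass 𝒜]
  [Fintype 𝒜] [LinearOrder 𝒜] [Nonempty 𝒜] {H M : ℕ} [NeZero M] (mdp : MDP 𝒳 𝒜 H M)

/-- The optimal return distribution with `n` steps to go, at the greedy action. -/
def MDP.optDist : ℕ → 𝒳 → Fin M → ℝ
  | 0 => fun _ => diracZero M
  | n + 1 => if hn : n < H then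
      greedyDist (backup (mdp.step ⟨H - 1 - n, by omega⟩) (MDP.optDist n))
    else fun _ => diracZero M

/-- The fixed point of the optimality backups. -/
def MDP.optCondDist (h : Fin H) : 𝒳 → 𝒜 → Fin M → ℝ :=
  backup (mdp.step h) (mdp.optDist (H - 1 - h))

theorem MDP.isNextDist_optDist (n : ℕ) : IsNextDist (mdp.optDist n) := by
  induction n with
  | zero => exact isNextDist_diracZero
  | succ n ih =>
    unfold MDP.optDist
    split_ifs with hn
    · have := mdp.markov ⟨H - 1 - n, by omega⟩
      exact isNextDist_greedyDist (isCondDist_backup _ ih)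
    · exact isNextDist_diracZero

theorem MDP.isCondDist_optCondDist (h : Fin H) : IsCondDist (mdp.optCondDist h) :=
  have := mdp.markov h
  isCondDist_backup _ (mdp.isNextDist_optDist _)

/-- The recursion counts steps to go: `H - 1 - h` remain after step `h`, and having `n + 1` to go
means standing at step `H - 1 - n`. -/
theorem MDP.optDist_eq (h : Fin H) :
    mdp.optDist (H - 1 - h) = nextDist mdp.optCondDist h := by
  rw [nextDist_eq_curDist]
  funext x
  unfold curDist
  split_ifs with hh
  · have e : H - 1 - (h : ℕ) = (H - 1 - (h + 1)) + 1 := by omega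
    rw [e, MDP.optDist, dif_pos (by omega)]
    have e2 : (⟨H - 1 - (H - 1 - (h + 1)), by omega⟩ : Fin H) = ⟨h + 1, hh⟩ :=
      Fin.ext (by simp only; omega)
    unfold MDP.optCondDist
    rw [e2]
  · have e : H - 1 - (h : ℕ) = 0 := by omega
    rw [e, MDP.optDist]

theorem MDP.optCondDist_eq (h : Fin H) :
    mdp.optCondDist h = backup (mdp.step h) (nextDist mdp.optCondDist h) := by
  rw [← mdp.optDist_eq, MDP.optCondDist]

theorem MDP.lintegral_rollInN_succ {π : Policy 𝒳 𝒜 H} (hπ : π.IsMeasurable) {n : ℕ} (hn : n < H)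
    {F : 𝒳 × ℕ → ℝ≥0∞} (hF : Measurable F) :
    ∫⁻ y, F y ∂(mdp.rollInN π (n + 1)) = ∫⁻ xs, ∑ a, π ⟨n, hn⟩ xs.1 a *
        ∫⁻ cx, F (cx.2, xs.2 + cx.1) ∂(mdp.step ⟨n, hn⟩ (xs.1, a)) ∂(mdp.rollInN π n) := by
  have hst := mdp.markov ⟨n, hn⟩
  have hm1 := measurable_rollStep (hπ ⟨n, hn⟩) (mdp.step ⟨n, hn⟩) (S := ℕ) (M := M)
    (u := fun s c => s + c) (fun c => measurable_of_countable _)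
  rw [mdp.rollInN_succ π hn, Measure.lintegral_bind hm1.aemeasurable hF.aemeasurable]
  exact lintegral_congr fun xs => lintegral_rollStep _ _ _ _ hF

theorem mean_mem {p : Fin M → ℝ} (hp : p ∈ stdSimplex ℝ (Fin M)) : mean p ∈ Set.Icc (0 : ℝ) 1 := by
  refine ⟨Finset.sum_nonneg fun z _ => mul_nonneg (hp.1 z) (gridVal_mem z).1, ?_⟩
  rw [← hp.2]
  exact Finset.sum_le_sum fun z _ => mul_le_of_le_one_right (hp.1 z) (gridVal_mem z).2

/-- The cap can only lower the mean. Equality may fail, as normalization says nothing about states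
that are not reached, but optimism needs only this direction. -/
theorem mean_backup_le (κ : Kernel (𝒳 × 𝒜) (Fin M × 𝒳)) [IsMarkovKernel κ]
    {q : 𝒳 → Fin M → ℝ} (hq : IsNextDist q) (x : 𝒳) (a : 𝒜) :
    mean (backup κ q x a) ≤ ∫ cx, (gridVal cx.1 + mean (q cx.2)) ∂(κ (x, a)) := by
  unfold mean
  rw [sum_backup_mul κ hq]
  have hm : Measurable fun cx : Fin M × 𝒳 => gridVal cx.1 :=
    (measurable_of_finite (gridVal (M := M))).comp measurable_fst
  have hq' : ∀ y, Measurable fun cx : Fin M × 𝒳 => q cx.2 y :=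
    fun y => (hq.measurable y).comp measurable_snd
  have hle : ∀ cx : Fin M × 𝒳, ∑ y, q cx.2 y * gridVal (cappedAdd y cx.1) ≤
      gridVal cx.1 + ∑ y, q cx.2 y * gridVal y := fun cx => by
    calc ∑ y, q cx.2 y * gridVal (cappedAdd y cx.1)
        ≤ ∑ y, q cx.2 y * (gridVal y + gridVal cx.1) := Finset.sum_le_sum fun y _ =>
          mul_le_mul_of_nonneg_left (gridVal_cappedAdd_le _ _) ((hq.mem _).1 y)
      _ = _ := by simp only [mul_add, Finset.sum_add_distrib, ← Finset.sum_mul, (hq.mem _).2]; ring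
  have h0 : ∀ cx : Fin M × 𝒳, 0 ≤ ∑ y, q cx.2 y * gridVal (cappedAdd y cx.1) := fun cx =>
    Finset.sum_nonneg fun y _ => mul_nonneg ((hq.mem _).1 y) (gridVal_mem _).1
  refine integral_mono_of_nonneg (Filter.Eventually.of_forall h0) ?_
    (Filter.Eventually.of_forall hle)
  refine Integrable.of_bound (hm.add (Finset.measurable_sum _ fun y _ =>
    (hq' y).mul_const _)).aestronglyMeasurable 2 (Filter.Eventually.of_forall fun cx => ?_)
  have h1 := gridVal_mem cx.1
  have h2 := mean_mem (hq.mem cx.2)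
  unfold mean at h2
  rw [Real.norm_eq_abs, abs_of_nonneg (add_nonneg h1.1 h2.1)]
  linarith [h1.2, h2.2]

theorem MDP.mean_curDist_optCondDist_le {n : ℕ} (hn : n < H) (x : 𝒳) (a : 𝒜) :
    mean (curDist mdp.optCondDist n x) ≤ ∫ cx, (gridVal cx.1 +
      mean (curDist mdp.optCondDist (n + 1) cx.2)) ∂(mdp.step ⟨n, hn⟩ (x, a)) := by
  have := mdp.markov ⟨n, hn⟩
  have h1 : mean (curDist mdp.optCondDist n x) ≤ mean (mdp.optCondDist ⟨n, hn⟩ x a) := by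
    simp only [curDist, hn, ↓reduceDIte, greedyDist]
    exact argmin_le (fun a => mean (mdp.optCondDist ⟨n, hn⟩ x a)) a
  rw [mdp.optCondDist_eq, nextDist_eq_curDist] at h1
  exact h1.trans (mean_backup_le _ (isNextDist_curDist mdp.isCondDist_optCondDist _) x a)

/-- Accumulated cost plus the mean of the optimal prediction has nondecreasing expectation along
every policy, since the greedy mean is at most the one-step lookahead of any action. The
expectations are Lebesgue integrals; integrability of the accumulated cost is needed only at the
end, where normalization supplies it. -/
theorem MDP.optimisticValue_le_value [NeZero H] (hnorm : mdp.Normalized) {π : Policy 𝒳 𝒜 H}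
    (hπ : π.IsMeasurable) : optimisticValue mdp.optCondDist mdp.x₁ ≤ mdp.value π := by
  set q := curDist mdp.optCondDist with hq
  have hqd : ∀ n, IsNextDist (q n) := isNextDist_curDist mdp.isCondDist_optCondDist
  have hM : (0 : ℝ) ≤ (M : ℝ) - 1 := by
    have : (1 : ℝ) ≤ M := by exact_mod_cast Nat.one_le_iff_ne_zero.2 (NeZero.ne M)
    linarith
  let F : ℕ → 𝒳 × ℕ → ℝ := fun n xs => (xs.2 : ℝ) / ((M : ℝ) - 1) + mean (q n xs.1)
  have hd : Measurable fun xs : 𝒳 × ℕ => (xs.2 : ℝ) / ((M : ℝ) - 1) :=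
    (measurable_of_countable fun k : ℕ => (k : ℝ) / ((M : ℝ) - 1)).comp measurable_snd
  have hF : ∀ n, Measurable (F n) := fun n => hd.add
    (Finset.measurable_sum _ fun z _ => (((hqd n).measurable z).comp measurable_fst).mul_const _)
  have hstep : ∀ n, n < H → ∫⁻ y, ENNReal.ofReal (F n y) ∂(mdp.rollInN π n) ≤
      ∫⁻ y, ENNReal.ofReal (F (n + 1) y) ∂(mdp.rollInN π (n + 1)) := fun n hn => by
    have hst := mdp.markov ⟨n, hn⟩
    rw [mdp.lintegral_rollInN_succ hπ hn (hF (n + 1)).ennreal_ofReal]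
    refine lintegral_mono fun xs => ?_
    have h1 : ∀ a, ENNReal.ofReal (F n xs) ≤ ∫⁻ cx, ENNReal.ofReal (F (n + 1)
        (cx.2, xs.2 + cx.1)) ∂(mdp.step ⟨n, hn⟩ (xs.1, a)) := fun a => by
      have e : ∀ cx : Fin M × 𝒳, F (n + 1) (cx.2, xs.2 + cx.1) =
          (xs.2 : ℝ) / ((M : ℝ) - 1) + (gridVal cx.1 + mean (q (n + 1) cx.2)) := fun cx => by
        simp only [F, gridVal, Nat.cast_add]; ring
      have hb : ∀ cx : Fin M × 𝒳, gridVal cx.1 + mean (q (n + 1) cx.2) ∈ Set.Icc (0 : ℝ) 2 :=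
        fun cx => by
          have h1 := gridVal_mem cx.1
          have h2 := mean_mem ((hqd (n + 1)).mem cx.2)
          exact ⟨by linarith [h1.1, h2.1], by linarith [h1.2, h2.2]⟩
      have hk : (0 : ℝ) ≤ (xs.2 : ℝ) / ((M : ℝ) - 1) := by positivity
      have hint : Integrable (fun cx : Fin M × 𝒳 => gridVal cx.1 + mean (q (n + 1) cx.2))
          (mdp.step ⟨n, hn⟩ (xs.1, a)) := by
        refine Integrable.of_bound (Measurable.aestronglyMeasurable ?_) 2
          (Filter.Eventually.of_forall fun cx => ?_)
        · exact ((measurable_of_finite (gridVal (M := M))).comp measurable_fst).add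
            (Finset.measurable_sum _ fun z _ =>
              (((hqd (n + 1)).measurable z).comp measurable_snd).mul_const _)
        · rw [Real.norm_eq_abs, abs_of_nonneg (hb cx).1]; exact (hb cx).2
      simp only [e]
      rw [← ofReal_integral_eq_lintegral_ofReal
        (f := fun cx : Fin M × 𝒳 => (xs.2 : ℝ) / ((M : ℝ) - 1) +
          (gridVal cx.1 + mean (q (n + 1) cx.2))) ((integrable_const _).add hint)
        (Filter.Eventually.of_forall fun cx => add_nonneg hk (hb cx).1)]
      refine ENNReal.ofReal_le_ofReal ?_
      rw [integral_add (integrable_const _) hint]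
      simp only [integral_const, probReal_univ, one_smul, F]
      gcongr
      exact mdp.mean_curDist_optCondDist_le hn xs.1 a
    calc ENNReal.ofReal (F n xs) = ∑ a, π ⟨n, hn⟩ xs.1 a * ENNReal.ofReal (F n xs) := by
          rw [← Finset.sum_mul, ← tsum_fintype (L := .unconditional _), PMF.tsum_coe, one_mul]
      _ ≤ _ := Finset.sum_le_sum fun a _ => by gcongr; exact h1 a
  have hall : ∀ n, n ≤ H → ∫⁻ y, ENNReal.ofReal (F 0 y) ∂(mdp.rollInN π 0) ≤
      ∫⁻ y, ENNReal.ofReal (F n y) ∂(mdp.rollInN π n) := fun n => by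
    induction n with
    | zero => exact fun _ => le_rfl
    | succ n ih => exact fun hn => (ih (by omega)).trans (hstep n (by omega))
  have h0 : ∫⁻ y, ENNReal.ofReal (F 0 y) ∂(mdp.rollInN π 0) =
      ENNReal.ofReal (optimisticValue mdp.optCondDist mdp.x₁) := by
    rw [MDP.rollInN, lintegral_dirac' _ (hF 0).ennreal_ofReal]
    simp only [F, hq, curDist, Nat.pos_of_ne_zero (NeZero.ne H), ↓reduceDIte, greedyDist,
      optimisticValue, iInf_eq_argmin]
    simp [greedyAction]
  have hP := mdp.isProbabilityMeasure_rollInN hπ H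
  have hn := hnorm _ hπ
  unfold MDP.value
  rw [mdp.returnLaw_eq hπ] at hn ⊢
  have hn' := ae_of_ae_map hd.aemeasurable hn
  rw [integral_map (f := fun z : ℝ => z) hd.aemeasurable measurable_id.aestronglyMeasurable]
  have hpos : ∀ xs : 𝒳 × ℕ, (0 : ℝ) ≤ (xs.2 : ℝ) / ((M : ℝ) - 1) := fun xs => by positivity
  have hint : Integrable (fun xs : 𝒳 × ℕ => (xs.2 : ℝ) / ((M : ℝ) - 1)) (mdp.rollInN π H) :=
    Integrable.of_bound hd.aestronglyMeasurable 1 (hn'.mono fun xs hxs => by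
      rw [Real.norm_eq_abs, abs_of_nonneg (hpos xs)]; exact hxs)
  have hH := hall H le_rfl
  have hz : mean (diracZero M) = 0 := by
    unfold mean
    refine Finset.sum_eq_zero fun z _ => ?_
    by_cases h : (z : ℕ) = 0 <;> simp [diracZero, gridVal, h]
  have hFH : ∀ y, F H y = (y.2 : ℝ) / ((M : ℝ) - 1) := fun y => by
    simp [F, hq, curDist, hz]
  rw [h0] at hH
  simp only [hFH] at hH
  rw [← ofReal_integral_eq_lintegral_ofReal hint (Filter.Eventually.of_forall hpos)] at hH
  exact (ENNReal.ofReal_le_ofReal_iff (integral_nonneg hpos)).1 hH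

theorem MDP.optimisticValue_le_optValue [NeZero H] (hnorm : mdp.Normalized) :
    optimisticValue mdp.optCondDist mdp.x₁ ≤ mdp.optValue :=
  haveI : Nonempty {π : Policy 𝒳 𝒜 H // π.IsMeasurable} :=
    ⟨⟨greedyPolicy mdp.optCondDist, isMeasurable_greedyPolicy mdp.isCondDist_optCondDist⟩⟩
  le_ciInf fun π => mdp.optimisticValue_le_value hnorm π.2

end Optimism

end

end DistRL

namespace DistRL

noncomputable section

/-! ### The linear `ℓ₁` eluder bound by a determinant potential. -/

section Eluder

open Matrix

variable {d : ℕ}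

/-- Cramer's rule: the coefficient of `x` on row `j` is the ratio of the updated determinant to the
old one. If all ratios were below 2 in absolute value, `x ⬝ᵥ θ` would be at most `2 * ∑ j, |b j ⬝ᵥ
θ| ≤ t`. -/
theorem exists_coeff_gt_of_sum_lt {b : Matrix (Fin d) (Fin d) ℝ} (hb : b.det ≠ 0)
    {x θ : Fin d → ℝ} {t : ℝ} (ht : t < x ⬝ᵥ θ) (hs : 2 * ∑ j, |b j ⬝ᵥ θ| ≤ t) :
    ∃ j, 2 * |b.det| ≤ |(b.updateRow j x).det| := by
  set c := x ᵥ* b⁻¹ with hc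
  have hx : x = ∑ j, c j • b j := by
    have h1 : c ᵥ* b = x := by
      rw [hc, vecMul_vecMul, nonsing_inv_mul _ (isUnit_iff_ne_zero.2 hb), vecMul_one]
    rw [← h1, vecMul_eq_sum]
  have hdet : ∀ j, (b.updateRow j x).det = c j * b.det := fun j => by
    rw [hx, det_updateRow_sum, smul_eq_mul]
  by_contra! hcon
  have hcj : ∀ j, |c j| ≤ 2 := fun j => by
    have h := hcon j
    rw [hdet, abs_mul] at h
    exact (lt_of_mul_lt_mul_right h (abs_nonneg _)).le
  have h2 : x ⬝ᵥ θ ≤ 2 * ∑ j, |b j ⬝ᵥ θ| := by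
    rw [hx, sum_dotProduct, Finset.mul_sum]
    refine Finset.sum_le_sum fun j _ => ?_
    rw [smul_dotProduct, smul_eq_mul]
    refine (le_abs_self _).trans ?_
    rw [abs_mul]
    exact mul_le_mul_of_nonneg_right (hcj j) (abs_nonneg _)
  linarith

/-- The potential argument: `N` bases, one of which doubles its volume at each large error. -/
theorem exists_bases {X θ : ℕ → Fin d → ℝ} {lam t B R : ℝ} {K N : ℕ}
    (hN : 0 < N) (hl : 0 < lam) (hl1 : lam ≤ 1) (hX : ∀ i < K, ∀ l, |X i l| ≤ 1)
    (hθ : ∀ k < K, ∀ l, |θ k l| ≤ R) (h0 : ∀ i < K, ∀ k < K, 0 ≤ X i ⬝ᵥ θ k)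
    (hB : ∀ k < K, ∑ i ∈ range k, X i ⬝ᵥ θ k ≤ B)
    (ht : B + N * (d * (lam * R)) ≤ N * (t / 2)) (m : ℕ) (hm : m ≤ K) :
    ∃ b : Fin N → Matrix (Fin d) (Fin d) ℝ, (∀ c i l, |b c i l| ≤ 1) ∧
      (∀ k < K, ∑ c, ∑ j, |b c j ⬝ᵥ θ k| ≤
        ∑ i ∈ range m, X i ⬝ᵥ θ k + N * (d * (lam * R))) ∧
      (lam ^ d) ^ N * 2 ^ #{i ∈ range m | t < X i ⬝ᵥ θ i} ≤ ∏ c, |(b c).det| := by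
  induction m with
  | zero =>
    refine ⟨fun _ => lam • (1 : Matrix _ _ ℝ), fun c i l => ?_, fun k hk => ?_, ?_⟩
    · by_cases h : i = l
      · subst h; simpa [abs_of_pos hl] using hl1
      · simp [h]
    · have : ∀ j, |(lam • (1 : Matrix (Fin d) (Fin d) ℝ)) j ⬝ᵥ θ k| ≤ lam * R := fun j => by
        have e : (lam • (1 : Matrix (Fin d) (Fin d) ℝ)) j ⬝ᵥ θ k = lam * θ k j := by
          rw [show (lam • (1 : Matrix (Fin d) (Fin d) ℝ)) j = lam • Pi.single j 1 by
            ext l; simp [Matrix.one_apply, Pi.single_apply, eq_comm], smul_dotProduct]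
          simp
        rw [e, abs_mul, abs_of_pos hl]
        exact mul_le_mul_of_nonneg_left (hθ k hk j) hl.le
      refine (Finset.sum_le_sum fun c _ => Finset.sum_le_sum fun j _ => this j).trans ?_
      simp
    · simp [abs_of_pos hl]
  | succ m ih =>
    obtain ⟨b, hb1, hb2, hb3⟩ := ih (by omega)
    by_cases hlt : t < X m ⬝ᵥ θ m
    -- Each earlier `X i` was inserted into at most one basis, so the errors of `θ m` summed over
    -- all bases are at most the past error plus the contribution of the initial rows. By averaging,
    -- some basis carries at most `t / 2`.
    · have hs : ∑ c, ∑ j, |b c j ⬝ᵥ θ m| ≤ ∑ _c : Fin N, t / 2 := by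
        refine (hb2 m (by omega)).trans ((add_le_add_left (hB m (by omega)) _).trans ?_)
        simpa using ht
      have hne : (univ : Finset (Fin N)).Nonempty := ⟨⟨0, hN⟩, mem_univ _⟩
      obtain ⟨c, -, hc⟩ := Finset.exists_le_of_sum_le hne hs
      have hpos : 0 < ∏ c, |(b c).det| := lt_of_lt_of_le (by positivity) hb3
      have hdet : (b c).det ≠ 0 := fun h =>
        hpos.ne' (Finset.prod_eq_zero (mem_univ c) (by simp [h]))
      obtain ⟨j, hj⟩ := exists_coeff_gt_of_sum_lt hdet hlt (by linarith)
      refine ⟨Function.update b c ((b c).updateRow j (X m)), fun c' i l => ?_, fun k hk => ?_, ?_⟩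
      · by_cases h : c' = c
        · subst h
          by_cases hi : i = j
          · subst hi; simpa using hX m (by omega) l
          · simpa [hi] using hb1 c' i l
        · simpa [h] using hb1 c' i l
      · rw [Finset.sum_range_succ]
        have h1 : ∀ i, |(b c).updateRow j (X m) i ⬝ᵥ θ k| ≤
            |b c i ⬝ᵥ θ k| + if i = j then X m ⬝ᵥ θ k else 0 := fun i => by
          by_cases hi : i = j
          · subst hi
            simp [abs_of_nonneg (h0 m (by omega) k hk)]
          · simp [hi]
        have h2 : ∀ c', ∑ i, |Function.update b c ((b c).updateRow j (X m)) c' i ⬝ᵥ θ k| ≤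
            ∑ i, |b c' i ⬝ᵥ θ k| + if c' = c then X m ⬝ᵥ θ k else 0 := fun c' => by
          by_cases h : c' = c
          · subst h
            simp only [Function.update_self, if_true]
            refine (Finset.sum_le_sum fun i _ => h1 i).trans ?_
            simp [Finset.sum_add_distrib]
          · simp [h]
        refine (Finset.sum_le_sum fun c' _ => h2 c').trans ?_
        rw [Finset.sum_add_distrib]
        simp only [sum_ite_eq', mem_univ, if_true]
        linarith [hb2 k hk]
      · have hcard : #{i ∈ range (m + 1) | t < X i ⬝ᵥ θ i} =
            #{i ∈ range m | t < X i ⬝ᵥ θ i} + 1 := by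
          rw [Finset.range_add_one, Finset.filter_insert, if_pos hlt, Finset.card_insert_of_notMem]
          simp
        rw [hcard, pow_succ]
        have h3 : ∏ c', |(Function.update b c ((b c).updateRow j (X m)) c').det| =
            |((b c).updateRow j (X m)).det| * ∏ c' ∈ univ.erase c, |(b c').det| := by
          rw [← Finset.mul_prod_erase _ _ (mem_univ c)]
          simp only [Function.update_self]
          congr 1
          refine Finset.prod_congr rfl fun c' hc' => ?_
          rw [Function.update_of_ne (Finset.ne_of_mem_erase hc')]
        rw [h3]
        rw [← Finset.mul_prod_erase _ _ (mem_univ c)] at hb3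
        have h4 : (0 : ℝ) ≤ ∏ c' ∈ univ.erase c, |(b c').det| :=
          Finset.prod_nonneg fun _ _ => abs_nonneg _
        nlinarith [mul_le_mul_of_nonneg_right hj h4]
    · refine ⟨b, hb1, fun k hk => ?_, ?_⟩
      · rw [Finset.sum_range_succ]
        linarith [hb2 k hk, h0 m (by omega) k hk]
      · rwa [Finset.range_add_one, Finset.filter_insert, if_neg hlt]

/-- A determinant with entries in `[-1, 1]` is at most `d ! ≤ d ^ d`, while each large error at
least doubles a product of `N` determinants that starts at `lam ^ (d * N)`. -/
theorem card_large_le {X θ : ℕ → Fin d → ℝ} {lam t B R : ℝ} {K N : ℕ} (hd : 0 < d)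
    (hN : 0 < N) (hl : 0 < lam) (hl1 : lam ≤ 1) (hX : ∀ i < K, ∀ l, |X i l| ≤ 1)
    (hθ : ∀ k < K, ∀ l, |θ k l| ≤ R) (h0 : ∀ i < K, ∀ k < K, 0 ≤ X i ⬝ᵥ θ k)
    (hB : ∀ k < K, ∑ i ∈ range k, X i ⬝ᵥ θ k ≤ B)
    (ht : B + N * (d * (lam * R)) ≤ N * (t / 2)) :
    #{i ∈ range K | t < X i ⬝ᵥ θ i} * Real.log 2 ≤ N * (d * Real.log (d / lam)) := by
  obtain ⟨b, hb1, -, hb3⟩ := exists_bases hN hl hl1 hX hθ h0 hB ht K le_rfl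
  have hdet : ∀ c, |(b c).det| ≤ (d : ℝ) ^ d := fun c => by
    have h := Matrix.det_le (A := b c) (abv := AbsoluteValue.abs) (x := 1) (hb1 c)
    simp only [Fintype.card_fin, one_pow, nsmul_eq_mul, mul_one] at h
    refine h.trans ?_
    exact_mod_cast Nat.factorial_le_pow d
  have h1 : (lam ^ d) ^ N * 2 ^ #{i ∈ range K | t < X i ⬝ᵥ θ i} ≤ ((d : ℝ) ^ d) ^ N := by
    refine hb3.trans ?_
    calc ∏ c, |(b c).det| ≤ ∏ _c : Fin N, (d : ℝ) ^ d :=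
          Finset.prod_le_prod (fun _ _ => abs_nonneg _) fun c _ => hdet c
      _ = _ := by simp
  have hd' : (0 : ℝ) < d := by exact_mod_cast hd
  have h2 := Real.log_le_log (by positivity) h1
  rw [Real.log_mul (by positivity) (by positivity)] at h2
  simp only [Real.log_pow] at h2
  rw [Real.log_div hd'.ne' hl.ne']
  linarith

/-- The linear `ℓ₁` eluder bound. -/
theorem sum_diag_le {X θ : ℕ → Fin d → ℝ} {B : ℝ} {K : ℕ} (hd : 0 < d) (hK : 0 < K) (hB1 : 1 ≤ B)
    (hX : ∀ i < K, ∀ l, |X i l| ≤ 1) (hθ : ∀ k < K, ∀ l, |θ k l| ≤ d)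
    (h0 : ∀ i < K, ∀ k < K, 0 ≤ X i ⬝ᵥ θ k) (h1 : ∀ k < K, X k ⬝ᵥ θ k ≤ 1)
    (hB : ∀ k < K, ∑ i ∈ range k, X i ⬝ᵥ θ k ≤ B) :
    ∑ k ∈ range K, X k ⬝ᵥ θ k ≤ 170 * B * d * (1 + Real.log (d * K)) ^ 2 := by
  have hd1 : (1 : ℝ) ≤ d := by exact_mod_cast hd
  have hK1 : (1 : ℝ) ≤ K := by exact_mod_cast hK
  set l1 := 1 + Real.log (d * K) with hl1
  have hlogd : 0 ≤ Real.log d := Real.log_nonneg hd1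
  have hlogK : 0 ≤ Real.log K := Real.log_nonneg hK1
  have hl1' : l1 = 1 + Real.log d + Real.log K := by
    rw [hl1, Real.log_mul (by positivity) (by positivity)]; ring
  have hl1_one : 1 ≤ l1 := by rw [hl1']; linarith
  have hlog2 : (0.69 : ℝ) ≤ Real.log 2 := by linarith [Real.log_two_gt_d9]
  have hlog2' : Real.log 2 ≤ (0.7 : ℝ) := by linarith [Real.log_two_lt_d9]
  -- Values below `(1 / 2) ^ J ≤ 1 / K` need no counting: over `K` indices they contribute at most
  -- 1.
  set J := Nat.clog 2 K with hJ
  have hJK : (K : ℝ) ≤ 2 ^ J := by exact_mod_cast Nat.le_pow_clog (by norm_num) K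
  have hJ2 : ∀ j ∈ Finset.Icc 1 J, (2 : ℝ) ^ j ≤ 2 * K := fun j hj => by
    rw [Finset.mem_Icc] at hj
    have hK2 : 1 < K := by
      by_contra h
      have : K = 1 := by omega
      rw [hJ, this, Nat.clog_one_right] at hj; omega
    have h3 : 2 ^ J.pred < K := Nat.pow_pred_clog_lt_self (by norm_num) hK2
    have h4 : (2 : ℝ) ^ (J - 1) < K := by exact_mod_cast h3
    calc (2 : ℝ) ^ j ≤ 2 ^ J := pow_le_pow_right₀ (by norm_num) hj.2
      _ = 2 * 2 ^ (J - 1) := by rw [← pow_succ']; congr 1; omega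
      _ ≤ 2 * K := by linarith
  -- the number of errors at each dyadic level
  have hlevel : ∀ j ∈ Finset.Icc 1 J,
      2 * (1 / 2 : ℝ) ^ j * #{i ∈ range K | (1 / 2 : ℝ) ^ j < X i ⬝ᵥ θ i} ≤ 80 * B * d * l1 := by
    intro j hj
    set t := (1 / 2 : ℝ) ^ j with ht
    have ht0 : 0 < t := by positivity
    have ht1 : t ≤ 1 := pow_le_one₀ (by norm_num) (by norm_num)
    have htinv : 1 / t ≤ 2 * K := by
      rw [ht, _root_.one_div_pow, one_div_one_div]; exact hJ2 j hj
    set N := ⌈8 * B / t⌉₊ with hN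
    have hN1 : 8 * B / t ≤ N := Nat.le_ceil _
    have hN2 : (N : ℝ) ≤ 9 * B / t := by
      have h5 : (N : ℝ) < 8 * B / t + 1 := Nat.ceil_lt_add_one (by positivity)
      have h6 : 1 ≤ B / t := by rw [le_div_iff₀ ht0]; linarith
      have h7 : 9 * B / t = 8 * B / t + B / t := by ring
      linarith
    have hN0 : 0 < N := Nat.ceil_pos.2 (by positivity)
    have hc := card_large_le (lam := t / (8 * d ^ 2)) (t := t) (N := N) hd hN0 (by positivity)
      (by rw [div_le_one (by positivity)]; nlinarith) hX hθ h0 hB (by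
        have h8 : (d : ℝ) * (t / (8 * d ^ 2) * d) = t / 8 := by field_simp
        have h9 : 8 * B ≤ N * t := by rwa [div_le_iff₀ ht0] at hN1
        rw [h8]
        nlinarith [mul_pos (Nat.cast_pos (α := ℝ).2 hN0) ht0])
    set n := #{i ∈ range K | t < X i ⬝ᵥ θ i}
    have hlog : Real.log (d / (t / (8 * d ^ 2))) ≤ 3 * l1 := by
      have e : (d : ℝ) / (t / (8 * d ^ 2)) = 8 * d ^ 3 * (1 / t) := by field_simp
      have h16 : Real.log 16 = 4 * Real.log 2 := by
        rw [show (16 : ℝ) = 2 ^ 4 by norm_num, Real.log_pow]; norm_num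
      rw [e]
      calc Real.log (8 * d ^ 3 * (1 / t)) ≤ Real.log (8 * d ^ 3 * (2 * K)) :=
            Real.log_le_log (by positivity) (by gcongr)
        _ = Real.log (16 * (d ^ 3 * K)) := by ring_nf
        _ = Real.log 16 + (3 * Real.log d + Real.log K) := by
            rw [Real.log_mul (by norm_num) (by positivity), Real.log_mul (by positivity)
              (by positivity), Real.log_pow]; norm_num
        _ ≤ 3 * l1 := by rw [hl1', h16]; linarith
    have hn : (n : ℝ) * 0.69 ≤ 9 * B / t * (d * (3 * l1)) :=
      calc (n : ℝ) * 0.69 ≤ n * Real.log 2 := by gcongr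
        _ ≤ N * (d * Real.log (d / (t / (8 * d ^ 2)))) := hc
        _ ≤ N * (d * (3 * l1)) := by gcongr
        _ ≤ _ := by gcongr
    have h10 : t * ((n : ℝ) * 0.69) ≤ 27 * (B * d * l1) := by
      calc t * ((n : ℝ) * 0.69) ≤ t * (9 * B / t * (d * (3 * l1))) := by gcongr
        _ = 27 * (B * d * l1) := by field_simp; norm_num
    have h11 : 0 ≤ B * d * l1 := by positivity
    nlinarith
  -- Dyadic decomposition: if `j` is the first level with `(1 / 2) ^ j` below the value, the value
  -- is at most `2 * (1 / 2) ^ j`.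
  have hpt : ∀ k ∈ range K, X k ⬝ᵥ θ k ≤ (1 / 2 : ℝ) ^ J +
      ∑ j ∈ Finset.Icc 1 J, if (1 / 2 : ℝ) ^ j < X k ⬝ᵥ θ k then 2 * (1 / 2 : ℝ) ^ j else 0 := by
    intro k hk
    have hnn : ∀ j ∈ Finset.Icc 1 J,
        0 ≤ if (1 / 2 : ℝ) ^ j < X k ⬝ᵥ θ k then 2 * (1 / 2 : ℝ) ^ j else 0 := fun j _ => by
      split_ifs <;> positivity
    by_cases hle : X k ⬝ᵥ θ k ≤ (1 / 2 : ℝ) ^ J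
    · linarith [Finset.sum_nonneg hnn]
    · have hex : ∃ j, (1 / 2 : ℝ) ^ j < X k ⬝ᵥ θ k := ⟨J, not_le.1 hle⟩
      classical
      set j := Nat.find hex with hj
      have hj1 : (1 / 2 : ℝ) ^ j < X k ⬝ᵥ θ k := Nat.find_spec hex
      have hj2 : j ≤ J := Nat.find_min' hex (not_le.1 hle)
      have hj0 : 1 ≤ j := by
        by_contra h
        have : j = 0 := by omega
        rw [this, pow_zero] at hj1
        linarith [h1 k (Finset.mem_range.1 hk)]
      have hj3 : X k ⬝ᵥ θ k ≤ (1 / 2 : ℝ) ^ (j - 1) := not_lt.1 (Nat.find_min hex (by omega))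
      have hs := Finset.single_le_sum hnn (Finset.mem_Icc.2 ⟨hj0, hj2⟩)
      rw [if_pos hj1] at hs
      have e : (1 / 2 : ℝ) ^ (j - 1) = 2 * (1 / 2) ^ j := by
        conv_rhs => rw [show j = (j - 1) + 1 by omega, pow_succ]
        ring
      have : (0 : ℝ) < (1 / 2) ^ J := by positivity
      linarith
  have hsum := Finset.sum_le_sum hpt
  rw [Finset.sum_add_distrib, Finset.sum_comm] at hsum
  have h12 : ∑ j ∈ Finset.Icc 1 J, ∑ k ∈ range K,
      (if (1 / 2 : ℝ) ^ j < X k ⬝ᵥ θ k then 2 * (1 / 2 : ℝ) ^ j else 0) ≤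
      ∑ _j ∈ Finset.Icc 1 J, 80 * B * d * l1 := Finset.sum_le_sum fun j hj => by
    rw [← Finset.sum_filter, Finset.sum_const, nsmul_eq_mul, mul_comm]
    exact hlevel j hj
  have h13 : ∑ _k ∈ range K, (1 / 2 : ℝ) ^ J ≤ 1 := by
    rw [Finset.sum_const, Finset.card_range, nsmul_eq_mul, _root_.one_div_pow, mul_one_div]
    exact div_le_one_of_le₀ hJK (by positivity)
  have h14 : (J : ℝ) ≤ 2 * l1 := by
    by_cases hJ0 : J = 0
    · rw [hJ0]; push_cast; linarith
    · have h15 := Real.log_le_log (by positivity) (hJ2 J (Finset.mem_Icc.2 ⟨by omega, le_rfl⟩))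
      rw [Real.log_pow, Real.log_mul (by norm_num) (by positivity)] at h15
      rw [hl1']
      nlinarith
  rw [Finset.sum_const, Nat.card_Icc, nsmul_eq_mul] at h12
  simp only [Nat.add_sub_cancel] at h12
  have h16 : (J : ℝ) * (80 * B * d * l1) ≤ 2 * l1 * (80 * B * d * l1) := by gcongr
  have h17 : 1 ≤ B * d * l1 ^ 2 := by
    have : 1 ≤ l1 ^ 2 := one_le_pow₀ hl1_one
    have : 1 ≤ B * d := one_le_mul_of_one_le_of_one_le hB1 hd1
    exact one_le_mul_of_one_le_of_one_le ‹_› ‹_›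
  nlinarith

end Eluder

end

end DistRL

namespace DistRL

noncomputable section

set_option linter.unusedSectionVars false

/-! ### Integration against the vector measures of the rank decomposition. -/

section VectorMeasure

variable {Y : Type*} [MeasurableSpace Y] {d : ℕ}

/-- The variation is dominated by the sum of the total variations of the `d` coordinates, which are
finite signed measures. Finiteness makes bounded functions integrable and dominated convergence
available. -/
theorem isFiniteMeasure_variation (μ : VectorMeasure Y (EuclideanSpace ℝ (Fin d))) :
    IsFiniteMeasure μ.variation := by
  let ν : Fin d → SignedMeasure Y := fun l => μ.mapRange
    (EuclideanSpace.proj (𝕜 := ℝ) l : EuclideanSpace ℝ (Fin d) →L[ℝ] ℝ).toLinearMap.toAddMonoidHom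
    (EuclideanSpace.proj l).continuous
  have hν : ∀ l E, ν l E = μ E l := fun l E => rfl
  have hfin : IsFiniteMeasure (∑ l, (ν l).totalVariation) := inferInstance
  refine isFiniteMeasure_of_le _ (VectorMeasure.variation_le_of_forall_enorm_le
    (m := ∑ l, (ν l).totalVariation) fun E hE => ?_)
  rw [Measure.finsetSum_apply]
  calc ‖μ E‖ₑ ≤ ∑ l, ‖μ E l‖ₑ := by
        rw [← ofReal_norm, EuclideanSpace.norm_eq]
        have h1 : √(∑ l, ‖μ E l‖ ^ 2) ≤ ∑ l, ‖μ E l‖ := by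
          rw [Real.sqrt_le_left (Finset.sum_nonneg fun _ _ => norm_nonneg _)]
          exact Finset.sum_sq_le_sq_sum_of_nonneg fun _ _ => norm_nonneg _
        refine (ENNReal.ofReal_le_ofReal h1).trans_eq ?_
        rw [ENNReal.ofReal_sum_of_nonneg fun _ _ => norm_nonneg _]
        simp only [ofReal_norm]
    _ ≤ _ := Finset.sum_le_sum fun l _ => (hν l E ▸ SignedMeasure.enorm_le_totalVariation (ν l) E)

/-- The identity holds on indicators by hypothesis, extends to simple functions by linearity, and
passes to bounded measurable `g` because both sides are continuous under bounded pointwise limits.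
-/
theorem integral_eq_inner {ν : Measure Y} [IsFiniteMeasure ν]
    {μ : VectorMeasure Y (EuclideanSpace ℝ (Fin d))} {φ : EuclideanSpace ℝ (Fin d)}
    (h : ∀ S, MeasurableSet S → ν.real S = inner ℝ φ (μ S)) {g : Y → ℝ} (hg : Measurable g)
    {B : ℝ} (hB : ∀ y, |g y| ≤ B) : ∫ y, g y ∂ν = inner ℝ φ (∫ᵛ y, g y ∂•μ) := by
  have hfin := isFiniteMeasure_variation μ
  have hsimple : ∀ s : SimpleFunc Y ℝ, ∫ y, s y ∂ν = inner ℝ φ (∫ᵛ y, s y ∂•μ) := fun s => by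
    induction s using SimpleFunc.induction with
    | @const c S hS =>
      have e : ⇑(SimpleFunc.piecewise S hS (SimpleFunc.const Y c) (SimpleFunc.const Y 0)) =
          S.indicator fun _ => c := by
        ext y; by_cases hy : y ∈ S <;> simp [hy]
      rw [e, integral_indicator_const c hS, h S hS]
      have e2 : ∫ᵛ y, S.indicator (fun _ => c) y ∂•μ = c • μ S :=
        setToFun_indicator_const _ hS (measure_ne_top _ _) c
      rw [e2, inner_smul_right, smul_eq_mul, mul_comm]
    | @add f g _ hf hg =>
      have hi : ∀ (m : Measure Y) [IsFiniteMeasure m] (s : SimpleFunc Y ℝ), Integrable s m :=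
        fun m _ s => SimpleFunc.integrable_of_isFiniteMeasure s
      rw [show (⇑(f + g) : Y → ℝ) = fun y => f y + g y from rfl,
        integral_add (hi ν f) (hi ν g), VectorMeasure.integral_fun_add (hi _ f) (hi _ g),
        inner_add_right, hf, hg]
  have hB0 : ∀ y, ‖g y‖ ≤ max B 0 := fun y => (hB y).trans (le_max_left _ _)
  let s := hg.stronglyMeasurable.approxBounded (max B 0)
  have hs : ∀ y, Filter.Tendsto (fun n => s n y) Filter.atTop (nhds (g y)) := fun y =>
    hg.stronglyMeasurable.tendsto_approxBounded_of_norm_le (hB0 y)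
  have hsb : ∀ n y, ‖s n y‖ ≤ max B 0 := fun n y =>
    hg.stronglyMeasurable.norm_approxBounded_le (le_max_right _ _) n y
  have t1 : Filter.Tendsto (fun n => ∫ y, s n y ∂ν) Filter.atTop (nhds (∫ y, g y ∂ν)) :=
    tendsto_integral_of_dominated_convergence (fun _ => max B 0)
      (fun n => (s n).stronglyMeasurable.aestronglyMeasurable) (integrable_const _)
      (fun n => Filter.Eventually.of_forall (hsb n)) (Filter.Eventually.of_forall hs)
  have t2 : Filter.Tendsto (fun n => ∫ᵛ y, s n y ∂•μ) Filter.atTop (nhds (∫ᵛ y, g y ∂•μ)) :=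
    VectorMeasure.tendsto_integral_of_dominated_convergence (fun _ => max B 0)
      (fun n => (s n).stronglyMeasurable.aestronglyMeasurable) (integrable_const _)
      (fun n => Filter.Eventually.of_forall (hsb n)) (Filter.Eventually.of_forall hs)
  have t3 := (tendsto_const_nhds (x := φ)).inner (𝕜 := ℝ) t2
  simp only [← hsimple] at t3
  exact tendsto_nhds_unique t1 t3

end VectorMeasure

/-! ### Consequences of low rank: bounded weights and completeness of the class. -/

section LowRank

variable {𝒳 𝒜 : Type*} [MeasurableSpace 𝒳] [MeasurableSpace 𝒜] {H M d : ℕ}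

theorem MDP.IsLowRank.exists_integral_eq {mdp : MDP 𝒳 𝒜 H M}
    {φs : Fin H → 𝒳 → 𝒜 → EuclideanSpace ℝ (Fin d)} (hr : mdp.IsLowRank φs) (h : Fin H)
    {g : Fin M × 𝒳 → ℝ} (hg : Measurable g) {B : ℝ} (hB : ∀ y, |g y| ≤ B) :
    ∃ θ : EuclideanSpace ℝ (Fin d), ‖θ‖ ≤ B * √d ∧
      ∀ x a, ∫ y, g y ∂(mdp.step h (x, a)) = inner ℝ (φs h x a) θ := by
  obtain ⟨-, μs, h1, h2⟩ := hr
  have := mdp.markov h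
  exact ⟨∫ᵛ y, g y ∂•(μs h), h2 h g B hg hB, fun x a =>
    integral_eq_inner (fun S hS => h1 h x a S hS) hg hB⟩

theorem MDP.IsLowRank.dim_pos {mdp : MDP 𝒳 𝒜 H M} [NeZero H] [Nonempty 𝒜]
    {φs : Fin H → 𝒳 → 𝒜 → EuclideanSpace ℝ (Fin d)} (hr : mdp.IsLowRank φs) : 0 < d := by
  obtain ⟨-, μs, h1, -⟩ := hr
  have := mdp.markov 0
  rw [Nat.pos_iff_ne_zero]
  rintro rfl
  obtain ⟨a⟩ := ‹Nonempty 𝒜›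
  have h := h1 0 mdp.x₁ a Set.univ MeasurableSet.univ
  rw [probReal_univ, Subsingleton.elim (φs 0 mdp.x₁ a) 0, inner_zero_left] at h
  exact one_ne_zero h

theorem MDP.grid_pos (mdp : MDP 𝒳 𝒜 H M) [NeZero H] [Nonempty 𝒜] : 0 < M := by
  have := mdp.markov 0
  obtain ⟨a⟩ := ‹Nonempty 𝒜›
  obtain ⟨y⟩ := nonempty_of_isProbabilityMeasure (mdp.step 0 (mdp.x₁, a))
  exact lt_of_le_of_lt (Nat.zero_le _) y.1.isLt

variable {Φ : Finset (𝒳 → 𝒜 → EuclideanSpace ℝ (Fin d))}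

theorem isCondDist_of_mem_linClass (hΦ : ∀ φ ∈ Φ, Measurable fun y : 𝒳 × 𝒜 => φ y.1 y.2)
    {f : 𝒳 → 𝒜 → Fin M → ℝ} (hf : f ∈ linClass Φ M) : IsCondDist f := by
  obtain ⟨h1, φ, hφ, w, -, hw⟩ := hf
  refine ⟨h1, fun a z => ?_⟩
  simp only [hw]
  exact ((hΦ φ hφ).comp (by fun_prop : Measurable fun x : 𝒳 => (x, a))).inner measurable_const

/-- Distributional Bellman completeness of the linear class, also after mixing with the uniform
distribution. -/
theorem MDP.IsLowRank.backup_mem_linClass {mdp : MDP 𝒳 𝒜 H M}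
    {φs : Fin H → 𝒳 → 𝒜 → EuclideanSpace ℝ (Fin d)} (hr : mdp.IsLowRank φs)
    (hreal : ∀ h, φs h ∈ Φ) (h : Fin H) {q : 𝒳 → Fin M → ℝ} (hq : IsNextDist q)
    {η : ℝ} (hη : η ∈ Set.Icc (0 : ℝ) 1) :
    (fun x a z => (1 - η) * backup (mdp.step h) q x a z + η / M) ∈ linClass Φ M := by
  have := mdp.markov h
  -- The mixture is itself the integral of one function with values in `[0, 1]`, so its weights
  -- inherit the bound `√d` with no separate treatment of the uniform part.
  have hg : ∀ z, Measurable fun cx : Fin M × 𝒳 => (1 - η) * shift cx.1 (q cx.2) z + η / M :=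
    fun z => ((measurable_shift_step hq.measurable z).const_mul _).add_const _
  have hM : ∀ z : Fin M, (1 : ℝ) ≤ M := fun z => by
    exact_mod_cast (by have := z.isLt; omega : 1 ≤ M)
  have hb : ∀ z (cx : Fin M × 𝒳), |(1 - η) * shift cx.1 (q cx.2) z + η / M| ≤ 1 := fun z cx => by
    have h1 := shift_mem (n := cx.1) (hq.mem cx.2)
    have h2 := h1.1 z
    have h3 := (le_abs_self _).trans (abs_le_one_of_mem h1 z)
    have h4 : η / M ≤ η := div_le_self hη.1 (hM z)
    have h5 : 0 ≤ η / M := div_nonneg hη.1 (by linarith [hM z])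
    have h6 : 0 ≤ 1 - η := by linarith [hη.2]
    rw [abs_of_nonneg (by positivity)]
    nlinarith
  choose θ hθ1 hθ2 using fun z => hr.exists_integral_eq h (hg z) (hb z)
  have he : ∀ x a z, (1 - η) * backup (mdp.step h) q x a z + η / M = inner ℝ (φs h x a) (θ z) := by
    intro x a z
    rw [← hθ2, integral_add ((integrable_shift_step _ hq _ z).const_mul _) (integrable_const _),
      integral_const_mul]
    simp [backup]
  refine ⟨fun x a => ⟨fun z => ?_, ?_⟩, φs h, hreal h, θ, fun z => by simpa using hθ1 z, he⟩
  · have h1 := (backup_mem (mdp.step h) hq x a).1 z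
    have h5 : 0 ≤ η / M := div_nonneg hη.1 (by positivity)
    have h6 : 0 ≤ 1 - η := by linarith [hη.2]
    positivity
  · have h1 := (backup_mem (mdp.step h) hq x a).2
    have hM0 : M ≠ 0 := by
      rintro rfl
      simp at h1
    have hM0' : (M : ℝ) ≠ 0 := by exact_mod_cast hM0
    rw [Finset.sum_add_distrib, ← Finset.mul_sum, h1]
    simp
    field_simp
    ring

end LowRank

end

end DistRL

namespace DistRL

noncomputable section

set_option linter.unusedSectionVars false

/-! ### Summing Bellman errors over episodes and the deterministic regret bound. -/

section Assembly

open Matrix in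
theorem sum_diag_le_fin {d K : ℕ} {X θ : Fin K → Fin d → ℝ} {B : ℝ} (hd : 0 < d) (hK : 0 < K)
    (hB1 : 1 ≤ B) (hX : ∀ i l, |X i l| ≤ 1) (hθ : ∀ k l, |θ k l| ≤ d)
    (h0 : ∀ i k, 0 ≤ X i ⬝ᵥ θ k) (h1 : ∀ k, X k ⬝ᵥ θ k ≤ 1)
    (hB : ∀ k, ∑ i ∈ Iio k, X i ⬝ᵥ θ k ≤ B) :
    ∑ k, X k ⬝ᵥ θ k ≤ 170 * B * d * (1 + Real.log (d * K)) ^ 2 := by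
  let X' : ℕ → Fin d → ℝ := fun i => if hi : i < K then X ⟨i, hi⟩ else 0
  let θ' : ℕ → Fin d → ℝ := fun i => if hi : i < K then θ ⟨i, hi⟩ else 0
  have eX : ∀ i (hi : i < K), X' i = X ⟨i, hi⟩ := fun i hi => by simp [X', hi]
  have eθ : ∀ i (hi : i < K), θ' i = θ ⟨i, hi⟩ := fun i hi => by simp [θ', hi]
  have h := sum_diag_le (X := X') (θ := θ') hd hK hB1 (fun i hi l => by rw [eX i hi]; exact hX _ l)
    (fun i hi l => by rw [eθ i hi]; exact hθ _ l)
    (fun i hi k hk => by rw [eX i hi, eθ k hk]; exact h0 _ _)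
    (fun k hk => by rw [eX k hk, eθ k hk]; exact h1 _) (fun k hk => by
      refine le_trans (le_of_eq ?_) (hB ⟨k, hk⟩)
      rw [eθ k hk]
      symm
      refine Finset.sum_bij (fun i _ => (i : ℕ)) (fun i hi => ?_) (fun i _ j _ hij => ?_)
        (fun i hi => ?_) fun i hi => ?_
      · exact Finset.mem_range.2 (Fin.lt_def.1 (Finset.mem_Iio.1 hi))
      · exact Fin.ext hij
      · exact ⟨⟨i, (Finset.mem_range.1 hi).trans hk⟩, Finset.mem_Iio.2 (Finset.mem_range.1 hi), rfl⟩
      · rw [eX i i.isLt])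
  rw [Finset.sum_range] at h
  simpa [eX, eθ] using h

variable {𝒳 𝒜 : Type*} [MeasurableSpace 𝒳] [MeasurableSpace 𝒜] [MeasurableSingletonClass 𝒜]
  [Fintype 𝒜] [LinearOrder 𝒜] [Nonempty 𝒜] {H M d : ℕ} {mdp : MDP 𝒳 𝒜 H M}
  {φs : Fin H → 𝒳 → 𝒜 → EuclideanSpace ℝ (Fin d)}
  {Φ : Finset (𝒳 → 𝒜 → EuclideanSpace ℝ (Fin d))}

open Matrix in
/-- State occupancies of greedy policies are linear in `d`-dimensional features. -/
theorem MDP.IsLowRank.exists_features (hr : mdp.IsLowRank φs) (hd : 0 < d)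
    (hφs : ∀ h, Measurable fun y : 𝒳 × 𝒜 => φs h y.1 y.2) (h : Fin H) :
    ∃ (X : (Fin H → 𝒳 → 𝒜 → Fin M → ℝ) → Fin d → ℝ) (Θ : (𝒳 → ℝ) → Fin d → ℝ),
      (∀ f, (∀ h, IsCondDist (f h)) → ∀ l, |X f l| ≤ 1) ∧
      (∀ G, Measurable G → (∀ x, |G x| ≤ 1) → ∀ l, |Θ G l| ≤ d) ∧
      ∀ f, (∀ h, IsCondDist (f h)) → ∀ G, Measurable G → (∀ x, |G x| ≤ 1) →
        ∫ x, G x ∂(mdp.stateLaw (greedyPolicy f) h) = X f ⬝ᵥ Θ G := by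
  have hd1 : (1 : ℝ) ≤ d := by exact_mod_cast hd
  rcases h with ⟨n, hn⟩
  rcases n with _ | n
  -- The initial state is fixed, so one coordinate suffices to carry the value of `G` there.
  · refine ⟨fun _ => Pi.single ⟨0, hd⟩ 1, fun G => Pi.single ⟨0, hd⟩ (G mdp.x₁),
      fun f _ l => ?_, fun G _ hG l => ?_, fun f _ G hG _ => ?_⟩
    · by_cases hl : l = ⟨0, hd⟩ <;> simp [hl]
    · by_cases hl : l = ⟨0, hd⟩
      · subst hl; simpa using (hG mdp.x₁).trans hd1
      · simp [hl]
    · have : mdp.stateLaw (greedyPolicy f) ⟨0, hn⟩ = Measure.dirac mdp.x₁ := by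
        simp [MDP.stateLaw, MDP.rollIn, Measure.map_dirac' measurable_fst]
      rw [this, integral_dirac' _ _ hG.stronglyMeasurable]
      simp
  · classical
    have hn' : n < H := by omega
    -- At later steps the features are those of the preceding state-action pair, averaged over the
    -- roll-in, and `Θ G` is the weight vector representing `G`. It is made total so as to be chosen
    -- for all `G` at once.
    have hex : ∀ G : 𝒳 → ℝ, ∃ θ : EuclideanSpace ℝ (Fin d), (Measurable G → (∀ x, |G x| ≤ 1) →
        ‖θ‖ ≤ 1 * √d ∧ ∀ x a, ∫ y, G y.2 ∂(mdp.step ⟨n, hn'⟩ (x, a)) =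
          inner ℝ (φs ⟨n, hn'⟩ x a) θ) := fun G => by
      by_cases hG : Measurable G ∧ ∀ x, |G x| ≤ 1
      · obtain ⟨θ, hθ⟩ := hr.exists_integral_eq ⟨n, hn'⟩ (g := fun y => G y.2)
          (hG.1.comp measurable_snd) (B := 1) fun y => hG.2 y.2
        exact ⟨θ, fun _ _ => hθ⟩
      · exact ⟨0, fun h1 h2 => absurd ⟨h1, h2⟩ hG⟩
    choose Θ hΘ using hex
    have hcoord : ∀ (v : EuclideanSpace ℝ (Fin d)) l, |v l| ≤ ‖v‖ := fun v l => by
      simpa using PiLp.norm_apply_le v l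
    have hb : ∀ f : Fin H → 𝒳 → 𝒜 → Fin M → ℝ, ∀ l (x : 𝒳),
        |φs ⟨n, hn'⟩ x (greedyAction (f ⟨n, hn'⟩) x) l| ≤ 1 := fun f l x =>
      (hcoord _ l).trans (hr.1 _ _ _)
    have hmeas : ∀ f : Fin H → 𝒳 → 𝒜 → Fin M → ℝ, (∀ h, IsCondDist (f h)) → ∀ l,
        Measurable fun x => φs ⟨n, hn'⟩ x (greedyAction (f ⟨n, hn'⟩) x) l := fun f hf l =>
      measurable_comp_greedyAction (hf _) (g := fun x a => φs ⟨n, hn'⟩ x a l) fun a => by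
        have := (hφs ⟨n, hn'⟩).comp (by fun_prop : Measurable fun x : 𝒳 => (x, a))
        exact (EuclideanSpace.proj (𝕜 := ℝ) l).continuous.measurable.comp this
    refine ⟨fun f l => ∫ xs, φs ⟨n, hn'⟩ xs.1 (greedyAction (f ⟨n, hn'⟩) xs.1) l
      ∂(mdp.rollInN (greedyPolicy f) n), fun G l => Θ G l, fun f hf l => ?_, fun G h1 h2 l => ?_,
      fun f hf G h1 h2 => ?_⟩
    · have := mdp.isProbabilityMeasure_rollInN (isMeasurable_greedyPolicy hf) n
      have h3 := norm_integral_le_of_norm_le_const (μ := mdp.rollInN (greedyPolicy f) n) (C := 1)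
        (f := fun xs : 𝒳 × ℕ => φs ⟨n, hn'⟩ xs.1 (greedyAction (f ⟨n, hn'⟩) xs.1) l)
        (Filter.Eventually.of_forall fun xs : 𝒳 × ℕ => hb f l xs.1)
      simpa using h3
    · refine (hcoord _ l).trans (((hΘ G h1 h2).1).trans ?_)
      rw [one_mul, Real.sqrt_le_left (by linarith)]
      nlinarith
    · have hP := mdp.isProbabilityMeasure_rollInN (isMeasurable_greedyPolicy hf) n
      rw [mdp.stateLaw_eq (isMeasurable_greedyPolicy hf),
        integral_map (by fun_prop) h1.aestronglyMeasurable]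
      refine (mdp.integral_rollInN_succ (isMeasurable_greedyPolicy hf) hn'
        (F := fun y : 𝒳 × ℕ => G y.1) (h1.comp measurable_fst) (B := 1) fun y => h2 y.1).trans ?_
      simp only [dotProduct, ← integral_mul_const]
      have hint : ∀ l ∈ (univ : Finset (Fin d)), Integrable (fun xs : 𝒳 × ℕ =>
          φs ⟨n, hn'⟩ xs.1 (greedyAction (f ⟨n, hn'⟩) xs.1) l * Θ G l)
          (mdp.rollInN (greedyPolicy f) n) := fun l _ => Integrable.mul_const (Integrable.of_bound
        ((hmeas f hf l).comp measurable_fst).aestronglyMeasurable 1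
        (Filter.Eventually.of_forall fun xs => hb f l xs.1)) _
      rw [← integral_finsetSum _ hint]
      refine integral_congr_ae (Filter.Eventually.of_forall fun xs => ?_)
      simp only [greedyPolicy]
      rw [sum_pure_mul (greedyAction (f ⟨n, hn'⟩) xs.1) fun a => ∫ cx, G cx.2
        ∂(mdp.step ⟨n, hn'⟩ (xs.1, a)), (hΘ G h1 h2).2]
      simp [PiLp.inner_apply, mul_comm]

/-- The Hellinger Bellman error of `f` at step `h` under the states visited by `f'` and uniformly
random actions. -/
def MDP.exploreErr (mdp : MDP 𝒳 𝒜 H M) (f' f : Fin H → 𝒳 → 𝒜 → Fin M → ℝ) (h : Fin H) : ℝ :=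
  ∫ x, (Fintype.card 𝒜 : ℝ)⁻¹ * ∑ a, hellSq (f h x a) (backup (mdp.step h) (nextDist f h) x a)
    ∂(mdp.stateLaw (greedyPolicy f') h)

/-- The greedy action has probability `1 / |𝒜|` under uniform exploration, so the error at greedy
actions is at most `|𝒜|` times the exploration error, under the states of any episode. The eluder
bound then applies with budget `|𝒜| * B`. -/
theorem MDP.IsLowRank.sum_bellmanErr_le [NeZero M] (hr : mdp.IsLowRank φs) (hd : 0 < d)
    (hφs : ∀ h, Measurable fun y : 𝒳 × 𝒜 => φs h y.1 y.2) {K : ℕ} (hK : 0 < K)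
    {f : Fin K → Fin H → 𝒳 → 𝒜 → Fin M → ℝ} (hf : ∀ k h, IsCondDist (f k h)) {B : ℝ} (hB1 : 1 ≤ B)
    (h : Fin H) (hB : ∀ k, ∑ i ∈ Iio k, mdp.exploreErr (f i) (f k) h ≤ B) :
    ∑ k, mdp.bellmanErr (f k) h ≤
      170 * (Fintype.card 𝒜 * B) * d * (1 + Real.log (d * K)) ^ 2 := by
  have := mdp.markov h
  obtain ⟨X, Θ, hX, hΘ, hXΘ⟩ := hr.exists_features hd hφs h
  have hb : ∀ k x a, backup (mdp.step h) (nextDist (f k) h) x a ∈ stdSimplex ℝ (Fin M) :=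
    fun k => by rw [nextDist_eq_curDist]; exact backup_mem _ (isNextDist_curDist (hf k) (h + 1))
  have hbm : ∀ k, IsCondDist (backup (mdp.step h) (nextDist (f k) h)) := fun k => by
    rw [nextDist_eq_curDist]; exact isCondDist_backup _ (isNextDist_curDist (hf k) (h + 1))
  let E : Fin K → 𝒳 → 𝒜 → ℝ := fun k x a =>
    hellSq (f k h x a) (backup (mdp.step h) (nextDist (f k) h) x a)
  have hE0 : ∀ k x a, 0 ≤ E k x a := fun k x a => hellSq_nonneg ((hf k h).mem x a) (hb k x a)
  have hE1 : ∀ k x a, E k x a ≤ 1 := fun k x a => hellSq_le_one _ _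
  have hEm : ∀ k a, Measurable fun x => E k x a := fun k a =>
    measurable_hellSq_comp (hf k) ((hf k h).measurable a) ((hbm k).measurable a)
  let G : Fin K → 𝒳 → ℝ := fun k x => E k x (greedyAction (f k h) x)
  have hGm : ∀ k, Measurable (G k) := fun k =>
    measurable_comp_greedyAction (hf k h) (g := fun x a => E k x a) (hEm k)
  have hG1 : ∀ k x, |G k x| ≤ 1 := fun k x => by
    rw [abs_of_nonneg (hE0 _ _ _)]; exact hE1 _ _ _
  have hA : (1 : ℝ) ≤ Fintype.card 𝒜 := by exact_mod_cast Fintype.card_pos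
  have key : ∀ i k, X (f i) ⬝ᵥ Θ (G k) ≤ Fintype.card 𝒜 * mdp.exploreErr (f i) (f k) h :=
    fun i k => by
    have hP := mdp.isProbabilityMeasure_stateLaw (isMeasurable_greedyPolicy (hf i)) h
    rw [← hXΘ _ (hf i) _ (hGm k) (hG1 k)]
    unfold MDP.exploreErr
    rw [← integral_const_mul]
    refine integral_mono (Integrable.of_bound (hGm k).aestronglyMeasurable 1
      (Filter.Eventually.of_forall (hG1 k))) ?_ fun x => ?_
    · refine Integrable.const_mul (Integrable.const_mul (integrable_finsetSum _ fun a _ => ?_) _) _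
      refine Integrable.of_bound (hEm k a).aestronglyMeasurable 1
        (Filter.Eventually.of_forall fun x => ?_)
      rw [Real.norm_eq_abs, abs_of_nonneg (hE0 k x a)]; exact hE1 k x a
    · simp only
      rw [mul_inv_cancel_left₀ (by positivity)]
      exact Finset.single_le_sum (f := fun a => E k x a) (fun a _ => hE0 k x a) (mem_univ _)
  have hdiag : ∀ k, mdp.bellmanErr (f k) h = X (f k) ⬝ᵥ Θ (G k) := fun k => by
    rw [← hXΘ _ (hf k) _ (hGm k) (hG1 k)]; rfl
  simp only [hdiag]
  refine sum_diag_le_fin hd hK ?_ (fun i => hX _ (hf i)) (fun k => hΘ _ (hGm k) (hG1 k))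
    (fun i k => ?_) (fun k => ?_) fun k => ?_
  · nlinarith
  · rw [← hXΘ _ (hf i) _ (hGm k) (hG1 k)]
    exact integral_nonneg fun x => hE0 _ _ _
  · rw [← hdiag]; exact (mdp.bellmanErr_mem (hf k) h).2
  · refine (Finset.sum_le_sum fun i _ => key i k).trans ?_
    rw [← Finset.mul_sum]
    exact mul_le_mul_of_nonneg_left (hB k) (by linarith)

/-- The deterministic part of the regret analysis. -/
theorem MDP.IsLowRank.mixtureValue_sub_le [NeZero M] [NeZero H] (hr : mdp.IsLowRank φs)
    (hd : 0 < d) (hφs : ∀ h, Measurable fun y : 𝒳 × 𝒜 => φs h y.1 y.2) (hnorm : mdp.Normalized)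
    {K : ℕ} (hK : 0 < K) {f : Fin K → Fin H → 𝒳 → 𝒜 → Fin M → ℝ} (hf : ∀ k h, IsCondDist (f k h))
    {B : ℝ} (hB1 : 1 ≤ B) (hB : ∀ h k, ∑ i ∈ Iio k, mdp.exploreErr (f i) (f k) h ≤ B)
    (hopt : ∀ k, optimisticValue (f k) mdp.x₁ ≤ optimisticValue mdp.optCondDist mdp.x₁ + 1 / K)
    {Λ : ℝ} (hΛ : Λ = 170 * (Fintype.card 𝒜 * B) * d * (1 + Real.log (d * K)) ^ 2) :
    mdp.mixtureValue (fun k => greedyPolicy (f k)) - mdp.optValue ≤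
      1 / K + 4 * (H * √(mdp.avgVar (fun k => greedyPolicy (f k)) * Λ / K)) +
        4 * (H ^ 2 * Λ / K) := by
  have hK0 : (0 : ℝ) < K := by exact_mod_cast hK
  set V : Fin K → ℝ := fun k => mdp.returnVar (greedyPolicy (f k))
  set Δ : Fin K → ℝ := fun k => ∑ h, mdp.bellmanErr (f k) h
  have hV : ∀ k, 0 ≤ V k := fun k => variance_nonneg _ _
  have hΔ : ∀ k, 0 ≤ Δ k := fun k => Finset.sum_nonneg fun h _ => (mdp.bellmanErr_mem (hf k) h).1
  have hΔs : ∑ k, Δ k ≤ H * Λ := by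
    rw [Finset.sum_comm]
    calc ∑ h, ∑ k, mdp.bellmanErr (f k) h ≤ ∑ _h : Fin H, Λ := Finset.sum_le_sum fun h _ => by
          rw [hΛ]; exact hr.sum_bellmanErr_le hd hφs hK hf hB1 h (hB h)
      _ = H * Λ := by simp
  have hΔs0 : 0 ≤ ∑ k, Δ k := Finset.sum_nonneg fun k _ => hΔ k
  have h1 : ∀ k, mdp.value (greedyPolicy (f k)) - mdp.optValue ≤
      1 / K + (4 * (√H * (√(V k) * √(Δ k))) + 4 * (H * Δ k)) := fun k => by
    have h2 := mdp.value_sub_optimisticValue_le (hf k) hnorm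
    have h3 := mdp.optimisticValue_le_optValue hnorm
    have h4 : √(H * Δ k * V k) = √H * (√(V k) * √(Δ k)) := by
      rw [Real.sqrt_mul (by have := hΔ k; positivity), Real.sqrt_mul (by positivity)]; ring
    change _ ≤ 4 * √(H * Δ k * V k) + 4 * (H * Δ k) at h2
    rw [h4] at h2
    linarith [hopt k]
  have h5 : ∑ k, √(V k) * √(Δ k) ≤ √(∑ k, V k) * √(H * Λ) :=
    (sum_sqrt_mul_le univ hV hΔ).trans (by gcongr)
  have h6 : mdp.mixtureValue (fun k => greedyPolicy (f k)) - mdp.optValue =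
      1 / K * ∑ k, (mdp.value (greedyPolicy (f k)) - mdp.optValue) := by
    rw [Finset.sum_sub_distrib, mul_sub, MDP.mixtureValue]
    simp
    field_simp
  have h7 : ∑ k, (mdp.value (greedyPolicy (f k)) - mdp.optValue) ≤
      1 + (4 * (√H * (√(∑ k, V k) * √(H * Λ))) + 4 * (H * (H * Λ))) := by
    refine (Finset.sum_le_sum fun k _ => h1 k).trans ?_
    rw [Finset.sum_add_distrib, Finset.sum_add_distrib]
    simp only [← Finset.mul_sum]
    refine add_le_add (by simp [hK0.ne']) (add_le_add ?_ ?_) <;> gcongr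
  have hΛ0 : 0 ≤ Λ := by rw [hΛ]; positivity
  -- One factor `√H` comes from the chain of hybrids, the other from summing the errors over the `H`
  -- steps.
  have h8 : √H * (√(∑ k, V k) * √(H * Λ)) = H * (√(∑ k, V k) * √Λ) := by
    rw [Real.sqrt_mul (by positivity)]
    have := Real.mul_self_sqrt (Nat.cast_nonneg (α := ℝ) H)
    linear_combination (√(∑ k, V k) * √Λ) * this
  have h9 : √(mdp.avgVar (fun k => greedyPolicy (f k)) * Λ / K) =
      1 / K * (√(∑ k, V k) * √Λ) := by
    have e : mdp.avgVar (fun k => greedyPolicy (f k)) * Λ / K = (∑ k, V k) * Λ / (K : ℝ) ^ 2 := by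
      unfold MDP.avgVar; field_simp; exact mul_comm _ _
    rw [e, Real.sqrt_div (mul_nonneg (Finset.sum_nonneg fun k _ => hV k) hΛ0),
      Real.sqrt_sq hK0.le, Real.sqrt_mul (Finset.sum_nonneg fun k _ => hV k)]
    ring
  rw [h6, h9]
  rw [h8] at h7
  calc _ ≤ 1 / K * (1 + (4 * (H * (√(∑ k, V k) * √Λ)) + 4 * (H * (H * Λ)))) := by gcongr
    _ = _ := by ring

end Assembly

end

end DistRL

namespace DistRL

noncomputable section

/-! ### Integrals and joint laws along an adapted process with prescribed conditional laws. -/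

section ConditionalLaw

variable {Ω S : Type*} [MeasurableSpace S] {m mΩ : MeasurableSpace Ω} {P : Measure Ω}

/-- If `κ ω` is the conditional law of `s` given `m`, then the conditional expectation of `F ∘ s` is
`ω ↦ ∫⁻ x, F x ∂κ ω`, for every nonnegative measurable `F`. -/
theorem exists_condLaw_lintegral [IsProbabilityMeasure P] (hm : m ≤ mΩ) {s : Ω → S}
    (hs : Measurable s) {κ : Ω → Measure S} (hκ : ∀ᵐ ω ∂P, IsFiniteMeasure (κ ω))
    (law : ∀ A, MeasurableSet A → P⟦s ⁻¹' A | m⟧ =ᵐ[P] fun ω => (κ ω).real A)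
    {F : S → ℝ≥0∞} (hF : Measurable F) :
    ∃ G : Ω → ℝ≥0∞, Measurable[m] G ∧ (G =ᵐ[P] fun ω => ∫⁻ x, F x ∂κ ω) ∧
      ∀ W : Ω → ℝ≥0∞, Measurable[m] W → ∫⁻ ω, F (s ω) * W ω ∂P = ∫⁻ ω, G ω * W ω ∂P := by
  -- `κ` is not assumed measurable in `ω`, so the induction carries an `m`-measurable version `G` of
  -- the integrals.
  refine Measurable.ennreal_induction (motive := fun F : S → ℝ≥0∞ =>
    ∃ G : Ω → ℝ≥0∞, Measurable[m] G ∧ (G =ᵐ[P] fun ω => ∫⁻ x, F x ∂κ ω) ∧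
      ∀ W : Ω → ℝ≥0∞, Measurable[m] W → ∫⁻ ω, F (s ω) * W ω ∂P = ∫⁻ ω, G ω * W ω ∂P)
    (fun c A hA => ?_) (fun f g _ hf hg ihf ihg => ?_) (fun f hf hmono ih => ?_) hF
  · let g : Ω → ℝ := P⟦s ⁻¹' A | m⟧
    have hlaw : g =ᵐ[P] fun ω => (κ ω).real A := law A hA
    have hgm : Measurable[m] g := stronglyMeasurable_condExp.measurable
    have hg0 : 0 ≤ᵐ[P] g := by
      filter_upwards [hlaw] with ω hω
      rw [Pi.zero_apply, hω]; exact measureReal_nonneg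
    have hgm' : Measurable g := hgm.mono hm le_rfl
    have hpre : MeasurableSet (s ⁻¹' A) := hs hA
    have key : ∀ E, MeasurableSet[m] E → P (s ⁻¹' A ∩ E) = ∫⁻ ω in E, ENNReal.ofReal (g ω) ∂P := by
      intro E hE
      have h1 : ∫ ω in E, g ω ∂P = ∫ ω in E, (s ⁻¹' A).indicator (fun _ => (1 : ℝ)) ω ∂P :=
        setIntegral_condExp hm ((integrable_const (1 : ℝ)).indicator hpre) hE
      rw [integral_indicator_const _ hpre, smul_eq_mul, mul_one] at h1
      rw [← ofReal_integral_eq_lintegral_ofReal integrable_condExp.integrableOn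
        (ae_restrict_of_ae hg0), h1, Measure.real, ENNReal.ofReal_toReal (measure_ne_top _ _),
        Measure.restrict_apply hpre]
    -- To test against arbitrary `m`-measurable `W`, both sides are read as measures on the
    -- sub-σ-algebra `m`, where they agree by the defining property of conditional expectation.
    have hμ : (P.restrict (s ⁻¹' A)).trim hm =
        (P.withDensity fun ω => ENNReal.ofReal (g ω)).trim hm := by
      refine @Measure.ext _ m _ _ fun E hE => ?_
      rw [trim_measurableSet_eq hm hE, trim_measurableSet_eq hm hE,
        Measure.restrict_apply (hm _ hE), withDensity_apply _ (hm _ hE), Set.inter_comm, key E hE]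
    refine ⟨fun ω => c * ENNReal.ofReal (g ω), measurable_const.mul hgm.ennreal_ofReal, ?_,
      fun W hW => ?_⟩
    · filter_upwards [hlaw, hκ] with ω hω hfin
      rw [lintegral_indicator hA, setLIntegral_const, hω, Measure.real,
        ENNReal.ofReal_toReal (measure_ne_top _ _)]
    · have hW' : Measurable W := hW.mono hm le_rfl
      have h2 : ∫⁻ ω, W ω ∂((P.restrict (s ⁻¹' A)).trim hm) = ∫⁻ ω, W ω ∂((P.withDensity
          fun ω => ENNReal.ofReal (g ω)).trim hm) := by rw [hμ]
      rw [lintegral_trim hm hW, lintegral_trim hm hW,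
        lintegral_withDensity_eq_lintegral_mul _ hgm'.ennreal_ofReal hW'] at h2
      calc ∫⁻ ω, A.indicator (fun _ => c) (s ω) * W ω ∂P
          = ∫⁻ ω, c * (s ⁻¹' A).indicator W ω ∂P := by
            refine lintegral_congr fun ω => ?_
            by_cases hω : s ω ∈ A <;> simp [hω]
        _ = c * ∫⁻ ω in s ⁻¹' A, W ω ∂P := by
            rw [lintegral_const_mul _ (hW'.indicator hpre), lintegral_indicator hpre]
        _ = ∫⁻ ω, c * ENNReal.ofReal (g ω) * W ω ∂P := by
            rw [h2, ← lintegral_const_mul _ (hgm'.ennreal_ofReal.mul hW')]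
            simp [mul_assoc]
  · obtain ⟨G₁, h1, h2, h3⟩ := ihf
    obtain ⟨G₂, k1, k2, k3⟩ := ihg
    refine ⟨fun ω => G₁ ω + G₂ ω, h1.add k1, ?_, fun W hW => ?_⟩
    · filter_upwards [h2, k2] with ω e1 e2
      rw [e1, e2]
      exact (lintegral_add_left hf _).symm
    · have hW' : Measurable W := hW.mono hm le_rfl
      simp only [Pi.add_apply, add_mul]
      rw [lintegral_add_left (f := fun ω => f (s ω) * W ω) ((hf.comp hs).mul hW'),
        lintegral_add_left (f := fun ω => G₁ ω * W ω) ((h1.mono hm le_rfl).mul hW'), h3 W hW, k3 W hW]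
  · choose G h1 h2 h3 using ih
    refine ⟨fun ω => ⨆ n, G n ω, Measurable.iSup h1, ?_, fun W hW => ?_⟩
    · filter_upwards [ae_all_iff.2 h2] with ω e
      rw [show (⨆ n, G n ω) = ⨆ n, ∫⁻ x, f n x ∂κ ω from iSup_congr e]
      exact (lintegral_iSup hf hmono).symm
    · have hW' : Measurable W := hW.mono hm le_rfl
      simp only [ENNReal.iSup_mul]
      rw [lintegral_iSup (f := fun n ω => f n (s ω) * W ω) (fun n => ((hf n).comp hs).mul hW')
        (fun i j hij ω => mul_le_mul_left (hmono hij (s ω)) _),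
        lintegral_iSup' (f := fun n ω => G n ω * W ω) (fun n => (((h1 n).mono hm le_rfl).mul hW').aemeasurable) ?_]
      · exact iSup_congr fun n => h3 n W hW
      · filter_upwards [ae_all_iff.2 h2] with ω e i j hij
        simp only [e]
        exact mul_le_mul_left (lintegral_mono (hmono hij)) _

variable {K : ℕ} {ℱ : Filtration (Fin K) mΩ} {s : Fin K → Ω → S} {κ : Fin K → Ω → Measure S}

/-- The conditional law of the adapted process `s` at time `k`, given the past, is `κ k`. -/
structure IsCondLaw (P : Measure Ω) (ℱ : Filtration (Fin K) mΩ) (s : Fin K → Ω → S)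
    (κ : Fin K → Ω → Measure S) : Prop where
  measurable : ∀ k, Measurable (s k)
  adapted : ∀ i k, i < k → Measurable[ℱ k] (s i)
  finite : ∀ k, ∀ᵐ ω ∂P, IsFiniteMeasure (κ k ω)
  law : ∀ k A, MeasurableSet A → P⟦s k ⁻¹' A | ℱ k⟧ =ᵐ[P] fun ω => (κ k ω).real A

theorem IsCondLaw.exists_lintegral [IsProbabilityMeasure P] (hs : IsCondLaw P ℱ s κ) (k : Fin K)
    {F : S → ℝ≥0∞} (hF : Measurable F) :
    ∃ G : Ω → ℝ≥0∞, Measurable[ℱ k] G ∧ (G =ᵐ[P] fun ω => ∫⁻ x, F x ∂κ k ω) ∧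
      ∀ W : Ω → ℝ≥0∞, Measurable[ℱ k] W → ∫⁻ ω, F (s k ω) * W ω ∂P = ∫⁻ ω, G ω * W ω ∂P :=
  exists_condLaw_lintegral (ℱ.le k) (hs.measurable k) (hs.finite k) (hs.law k) hF

/-- Products of conditionally bounded factors along an adapted process. -/
theorem lintegral_prod_le [IsProbabilityMeasure P]
    (hs : ∀ k, Measurable (s k)) (had : ∀ i k, i < k → Measurable[ℱ k] (s i))
    {F : Fin K → S → ℝ≥0∞} (hF : ∀ k, Measurable (F k)) {G W : Fin K → Ω → ℝ≥0∞}
    (hW : ∀ k, Measurable[ℱ k] (W k))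
    (hG : ∀ k (V : Ω → ℝ≥0∞), Measurable[ℱ k] V →
      ∫⁻ ω, F k (s k ω) * V ω ∂P = ∫⁻ ω, G k ω * V ω ∂P)
    {C : Fin K → ℝ≥0∞} (hC : ∀ k, ∀ᵐ ω ∂P, G k ω * W k ω ≤ C k) (J : Finset (Fin K)) :
    ∫⁻ ω, ∏ i ∈ J, (F i (s i ω) * W i ω) ∂P ≤ ∏ i ∈ J, C i := by
  -- The latest index is integrated first: all other factors belong to its past.
  induction J using Finset.induction_on_max with
  | empty => simp
  | insert k J hk ih =>
    have hkJ : k ∉ J := fun h => lt_irrefl _ (hk k h)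
    have hV : Measurable[ℱ k] fun ω => W k ω * ∏ i ∈ J, (F i (s i ω) * W i ω) :=
      (hW k).mul (Finset.measurable_fun_prod _ fun i hi => (((hF i).comp (had i k (hk i hi))).mul
        ((hW i).mono (ℱ.mono (hk i hi).le) le_rfl)))
    have hm : Measurable fun ω => ∏ i ∈ J, (F i (s i ω) * W i ω) :=
      Finset.measurable_fun_prod _ fun i _ => ((hF i).comp (hs i)).mul
        ((hW i).mono (ℱ.le i) le_rfl)
    rw [Finset.prod_insert hkJ]
    calc ∫⁻ ω, ∏ i ∈ insert k J, (F i (s i ω) * W i ω) ∂P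
        = ∫⁻ ω, G k ω * (W k ω * ∏ i ∈ J, (F i (s i ω) * W i ω)) ∂P := by
          rw [← hG k _ hV]
          exact lintegral_congr fun ω => by rw [Finset.prod_insert hkJ, mul_assoc]
      _ ≤ ∫⁻ ω, C k * ∏ i ∈ J, (F i (s i ω) * W i ω) ∂P := by
          refine lintegral_mono_ae ?_
          filter_upwards [hC k] with ω hω
          rw [← mul_assoc]
          exact mul_le_mul_left hω _
      _ ≤ C k * ∏ i ∈ J, C i := by
          rw [lintegral_const_mul _ hm]
          exact mul_le_mul_right ih _

/-- The joint law of points of an adapted process whose conditional laws are dominated by `c • ν`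
is dominated by the corresponding product measure. -/
theorem IsCondLaw.measure_le_pi [IsProbabilityMeasure P] (hs : IsCondLaw P ℱ s κ) {Q : Type*}
    [MeasurableSpace Q] {g : S → Q} (hg : Measurable g) {ν : Measure Q} [IsFiniteMeasure ν]
    {c : ℝ≥0∞} (hc : ∀ k, ∀ᵐ ω ∂P, (κ k ω).map g ≤ c • ν)
    {m : ℕ} {e : Fin m → Fin K} (he : Function.Injective e) (hc0 : c ≠ 0) (hct : c ≠ ∞)
    {B : Set (Fin m → Q)} (hB : MeasurableSet B) :
    P {ω | (fun j => g (s (e j) ω)) ∈ B} ≤ c ^ m * (Measure.pi fun _ : Fin m => ν) B := by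
  classical
  have hT : Measurable fun ω j => g (s (e j) ω) :=
    measurable_pi_lambda _ fun j => hg.comp (hs.measurable _)
  have hbox : ∀ A : Fin m → Set Q, (∀ j, MeasurableSet (A j)) →
      P {ω | ∀ j, g (s (e j) ω) ∈ A j} ≤ c ^ m * ∏ j, ν (A j) := by
    intro A hA
    -- The box is reindexed by time, with no constraint at times outside the range of `e`, so that
    -- the product bound in time order applies whatever the order of `e`.
    let A' : Fin K → Set Q := fun k => {q | ∀ j, e j = k → q ∈ A j}
    have hA'e : ∀ j, A' (e j) = A j := fun j => by
      ext q
      exact ⟨fun h => h j rfl, fun h i hi => he hi ▸ h⟩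
    have hA' : ∀ k, MeasurableSet (A' k) := fun k => by
      simp only [A', Set.ofPred_forall]
      exact MeasurableSet.iInter fun j => MeasurableSet.iInter fun _ => hA j
    have hF : ∀ k, Measurable fun x => (A' k).indicator (fun _ => (1 : ℝ≥0∞)) (g x) := fun k =>
      (measurable_const.indicator (hA' k)).comp hg
    choose G h1 h2 h3 using fun k => hs.exists_lintegral k (hF k)
    have h4 := lintegral_prod_le hs.measurable hs.adapted hF (G := G) (W := fun _ _ => 1)
      (fun k => measurable_const) h3 (C := fun k => c * ν (A' k)) (fun k => by
        filter_upwards [h2 k, hc k] with ω e1 e2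
        rw [mul_one, e1]
        have : ∀ x, (A' k).indicator (fun _ => (1 : ℝ≥0∞)) (g x) =
            (g ⁻¹' A' k).indicator (fun _ => 1) x := fun x => rfl
        simp only [this]
        rw [lintegral_indicator_const (hg (hA' k)), one_mul, ← Measure.map_apply hg (hA' k)]
        exact e2 _) (univ.image e)
    rw [Finset.prod_image fun i _ j _ hij => he hij, Finset.prod_mul_distrib] at h4
    simp only [hA'e, Finset.prod_const, Finset.card_univ, Fintype.card_fin] at h4
    refine le_trans ?_ h4
    have hms : MeasurableSet {ω | ∀ j, g (s (e j) ω) ∈ A j} := by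
      simp only [Set.ofPred_forall]
      exact MeasurableSet.iInter fun j => (hg.comp (hs.measurable _)) (hA j)
    rw [← lintegral_indicator_one hms]
    refine lintegral_mono fun ω => ?_
    by_cases hω : ω ∈ {ω | ∀ j, g (s (e j) ω) ∈ A j}
    · rw [Set.indicator_of_mem hω, Finset.prod_image fun i _ j _ hij => he hij]
      rw [Finset.prod_eq_one fun j _ => ?_]
      · rfl
      · rw [mul_one, Set.indicator_of_mem]
        rw [hA'e]; exact hω j
    · rw [Set.indicator_of_notMem hω]; exact zero_le
  -- Domination on boxes extends to all measurable sets because the product measure comes from the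
  -- largest outer measure below the box function. That criterion tests boxes with arbitrary sides,
  -- which are replaced by their measurable hulls.
  have hle : ((c ^ m)⁻¹ • P.map fun ω j => g (s (e j) ω)).toOuterMeasure ≤
      OuterMeasure.pi fun _ : Fin m => ν.toOuterMeasure := by
    rw [OuterMeasure.le_pi]
    intro A _
    have hsub : Set.univ.pi A ⊆ Set.univ.pi fun j => toMeasurable ν (A j) :=
      Set.pi_mono fun j _ => subset_toMeasurable _ _
    have h5 := hbox (fun j => toMeasurable ν (A j)) fun j => measurableSet_toMeasurable _ _
    simp only [measure_toMeasurable] at h5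
    have h6 : (P.map fun ω j => g (s (e j) ω)) (Set.univ.pi fun j => toMeasurable ν (A j)) ≤
        c ^ m * ∏ j, ν (A j) := by
      rw [Measure.map_apply hT (MeasurableSet.univ_pi fun j => measurableSet_toMeasurable _ _)]
      refine le_trans (measure_mono fun ω hω => ?_) h5
      exact fun j => hω j (Set.mem_univ j)
    calc ((c ^ m)⁻¹ • P.map fun ω j => g (s (e j) ω)) (Set.univ.pi A)
        ≤ (c ^ m)⁻¹ * (c ^ m * ∏ j, ν (A j)) := by
          rw [Measure.smul_apply, smul_eq_mul]
          exact mul_le_mul_right ((measure_mono hsub).trans h6) _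
      _ = ∏ j, ν (A j) := by
          rw [← mul_assoc, ENNReal.inv_mul_cancel (pow_ne_zero _ hc0) (ENNReal.pow_ne_top hct),
            one_mul]
  have h7 := hle B
  have h8 : (OuterMeasure.pi fun _ : Fin m => ν.toOuterMeasure) B =
      (Measure.pi fun _ : Fin m => ν) B := by
    rw [Measure.pi, toMeasure_apply _ _ hB]
  rw [h8] at h7
  change (c ^ m)⁻¹ * (P.map fun ω j => g (s (e j) ω)) B ≤ _ at h7
  rw [Measure.map_apply hT hB] at h7
  calc P {ω | (fun j => g (s (e j) ω)) ∈ B}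
      = c ^ m * ((c ^ m)⁻¹ * P {ω | (fun j => g (s (e j) ω)) ∈ B}) := by
        rw [← mul_assoc, ENNReal.mul_inv_cancel (pow_ne_zero _ hc0) (ENNReal.pow_ne_top hct),
          one_mul]
    _ ≤ _ := mul_le_mul_right h7 _

end ConditionalLaw

end

end DistRL

namespace DistRL

noncomputable section

/-! ### Counting sign patterns of linear forms. -/

section SignPatterns

open Matrix

variable {α ι : Type*} [Fintype α] [Fintype ι]

open Classical in
/-- The set of linear forms in the family `a` that are positive at `v`. -/
def signSet (a : α → ι → ℝ) (v : ι → ℝ) : Finset α := {x | 0 < a x ⬝ᵥ v}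

theorem mem_signSet {a : α → ι → ℝ} {v : ι → ℝ} {x : α} : x ∈ signSet a v ↔ 0 < a x ⬝ᵥ v := by
  simp [signSet]

open Classical in
theorem card_le_of_shatters {a : α → ι → ℝ} {𝒮 : Finset (Finset α)}
    (h𝒮 : ∀ s ∈ 𝒮, ∃ v, signSet a v = s) {s : Finset α} (hs : 𝒮.Shatters s) :
    #s ≤ Fintype.card ι := by
  by_contra! hlt
  have hdep : ¬ LinearIndependent ℝ fun x : s => a x := fun hli => by
    have := hli.fintype_card_le_finrank
    simp at this
    omega
  rw [Fintype.not_linearIndependent_iff] at hdep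
  obtain ⟨c, hc, x₀, hx₀⟩ := hdep
  obtain ⟨c, hc, x₀, hx₀⟩ : ∃ c : s → ℝ, ∑ x, c x • a x = 0 ∧ ∃ x, 0 < c x := by
    rcases lt_or_gt_of_ne hx₀ with h | h
    · refine ⟨-c, ?_, x₀, by simpa using h⟩
      simp only [Pi.neg_apply, neg_smul, Finset.sum_neg_distrib, hc, neg_zero]
    · exact ⟨c, hc, x₀, h⟩
  obtain ⟨u, hu, hsu⟩ := hs (t := s.filter fun x => ∃ hx : x ∈ s, 0 < c ⟨x, hx⟩)
    (Finset.filter_subset _ _)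
  obtain ⟨v, rfl⟩ := h𝒮 u hu
  have hiff : ∀ x : s, 0 < a x ⬝ᵥ v ↔ 0 < c x := fun x => by
    have := Finset.ext_iff.1 hsu x
    simp only [Finset.mem_inter, mem_signSet, Finset.mem_filter, x.2, true_and,
      exists_true_left, Subtype.coe_eta] at this
    exact this
  have h0 : ∑ x, c x * (a x ⬝ᵥ v) = 0 := by
    have := congrArg (fun w => w ⬝ᵥ v) hc
    simpa [sum_dotProduct, smul_dotProduct] using this
  have hnn : ∀ x, 0 ≤ c x * (a x ⬝ᵥ v) := fun x => by
    rcases lt_or_ge 0 (c x) with h | h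
    · exact mul_nonneg h.le ((hiff x).2 h).le
    · exact mul_nonneg_of_nonpos_of_nonpos h (not_lt.1 fun h' => (not_lt.2 h) ((hiff x).1 h'))
  have hpos : 0 < c x₀ * (a x₀ ⬝ᵥ v) := mul_pos hx₀ ((hiff x₀).2 hx₀)
  exact absurd h0 (Finset.sum_pos' (fun x _ => hnn x) ⟨x₀, mem_univ _, hpos⟩).ne'

theorem sum_choose_le_pow (n d : ℕ) : ∑ k ∈ Iic d, n.choose k ≤ (n + 1) ^ d := by
  have : Iic d = range (d + 1) := by ext; simp
  rw [this, add_pow]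
  refine Finset.sum_le_sum fun k hk => ?_
  have hk' : k ≤ d := Nat.lt_succ_iff.1 (Finset.mem_range.1 hk)
  rw [one_pow, mul_one]
  exact (Nat.choose_le_pow n k).trans (Nat.le_mul_of_pos_right _ (Nat.choose_pos hk'))

/-- Sauer's bound on the number of sign patterns of a family of linear forms. -/
theorem card_signSets_le {a : α → ι → ℝ} {𝒮 : Finset (Finset α)}
    (h𝒮 : ∀ s ∈ 𝒮, ∃ v, signSet a v = s) : #𝒮 ≤ (Fintype.card α + 1) ^ Fintype.card ι := by
  classical
  have hvc : 𝒮.vcDim ≤ Fintype.card ι := Finset.sup_le fun s hs =>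
    card_le_of_shatters h𝒮 (Finset.mem_shatterer.1 hs)
  calc #𝒮 ≤ #𝒮.shatterer := Finset.card_le_card_shatterer 𝒮
    _ ≤ ∑ k ∈ Iic 𝒮.vcDim, (Fintype.card α).choose k := Finset.card_shatterer_le_sum_vcDim
    _ ≤ ∑ k ∈ Iic (Fintype.card ι), (Fintype.card α).choose k :=
        Finset.sum_le_sum_of_subset (Finset.Iic_subset_Iic.2 hvc)
    _ ≤ _ := sum_choose_le_pow _ _

/-- A set of parameters has few representatives up to equality of sign patterns. -/
theorem exists_representatives (a : α → ι → ℝ) (V : Set (ι → ℝ)) :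
    ∃ R : Finset (ι → ℝ), (R : Set (ι → ℝ)) ⊆ V ∧
      #R ≤ (Fintype.card α + 1) ^ Fintype.card ι ∧
      ∀ v ∈ V, ∃ v₀ ∈ R, ∀ x, 0 < a x ⬝ᵥ v ↔ 0 < a x ⬝ᵥ v₀ := by
  classical
  let 𝒮 : Finset (Finset α) := {s | ∃ v ∈ V, signSet a v = s}
  have h𝒮 : ∀ s ∈ 𝒮, ∃ v ∈ V, signSet a v = s := fun s hs => by simpa [𝒮] using hs
  choose! r hrV hr using h𝒮
  refine ⟨𝒮.image r, fun v hv => ?_, Finset.card_image_le.trans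
    (card_signSets_le fun s hs => ⟨r s, hr s hs⟩), fun v hv => ?_⟩
  · obtain ⟨s, hs, rfl⟩ := Finset.mem_image.1 (Finset.mem_coe.1 hv)
    exact hrV s hs
  · have hs : signSet a v ∈ 𝒮 := by
      simp only [𝒮, Finset.mem_filter, Finset.mem_univ, true_and]
      exact ⟨v, hv, rfl⟩
    refine ⟨_, Finset.mem_image_of_mem r hs, fun x => ?_⟩
    rw [← mem_signSet, ← mem_signSet (v := r _), hr _ hs]

end SignPatterns

/-! ### Ghost samples for two-parameter disagreement. -/

section Ghost

open Matrix

variable {J T ι Q : Type*} [Fintype J] [Fintype T] [Fintype ι]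

/-- `v` and `v₀` have the same sign pattern with respect to the linear forms `ℓ`. -/
def SameSigns (ℓ : T → ι → ℝ) (v v₀ : ι → ℝ) : Prop := ∀ t, 0 < ℓ t ⬝ᵥ v ↔ 0 < ℓ t ⬝ᵥ v₀

/-- The samples on which some two parameters agree exactly at the indices of `S`. -/
def agreeSet (ℓ : Q → T → ι → ℝ) (S : Set J) : Set (J → Q) :=
  {q | ∃ v v₀, ∀ j, SameSigns (ℓ (q j)) v v₀ ↔ j ∈ S}

/-- The existential over parameters is a projection. Strict positivity of finitely many forms is a
union over `N` of closed conditions `ε N ≤ ·`; closed sets in finite dimension are σ-compact, and so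
are their images under the projection. -/
theorem measurableSet_agreeSet_aux (S : Set J) :
    MeasurableSet {a : J → T → ι → ℝ | ∃ v v₀, ∀ j, SameSigns (a j) v v₀ ↔ j ∈ S} := by
  let ε : ℕ → ℝ := fun N => 1 / ((N : ℝ) + 1)
  have hε : ∀ N, 0 < ε N := fun N => by positivity
  let p : ((J → T → ι → ℝ) × (ι → ℝ) × (ι → ℝ)) → J → T → ℝ := fun y j t => y.1 j t ⬝ᵥ y.2.1
  let p₀ : ((J → T → ι → ℝ) × (ι → ℝ) × (ι → ℝ)) → J → T → ℝ := fun y j t => y.1 j t ⬝ᵥ y.2.2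
  have hp : ∀ j t, Continuous fun y => p y j t := fun j t => by
    simp only [p, dotProduct]; fun_prop
  have hp₀ : ∀ j t, Continuous fun y => p₀ y j t := fun j t => by
    simp only [p₀, dotProduct]; fun_prop
  let C : ℕ → Set ((J → T → ι → ℝ) × (ι → ℝ) × (ι → ℝ)) := fun N =>
    (⋂ j ∈ S, ⋂ t, ({y | ε N ≤ p y j t} ∩ {y | ε N ≤ p₀ y j t}) ∪
      ({y | p y j t ≤ 0} ∩ {y | p₀ y j t ≤ 0})) ∩
    ⋂ j ∈ Sᶜ, ⋃ t, ({y | ε N ≤ p y j t} ∩ {y | p₀ y j t ≤ 0}) ∪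
      ({y | p y j t ≤ 0} ∩ {y | ε N ≤ p₀ y j t})
  have h1 : ∀ N j t, IsClosed {y | ε N ≤ p y j t} := fun N j t =>
    isClosed_le continuous_const (hp j t)
  have h2 : ∀ N j t, IsClosed {y | ε N ≤ p₀ y j t} := fun N j t =>
    isClosed_le continuous_const (hp₀ j t)
  have h3 : ∀ j t, IsClosed {y | p y j t ≤ 0} := fun j t => isClosed_le (hp j t) continuous_const
  have h4 : ∀ j t, IsClosed {y | p₀ y j t ≤ 0} := fun j t => isClosed_le (hp₀ j t) continuous_const
  have hC : ∀ N, IsClosed (C N) := fun N => by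
    refine IsClosed.inter ?_ ?_
    · exact isClosed_biInter fun j _ => isClosed_iInter fun t =>
        ((h1 N j t).inter (h2 N j t)).union ((h3 j t).inter (h4 j t))
    · exact isClosed_biInter fun j _ => isClosed_iUnion_of_finite fun t =>
        ((h1 N j t).inter (h4 j t)).union ((h3 j t).inter (h2 N j t))
  have hσ : IsSigmaCompact (⋃ N, Prod.fst '' C N) :=
    isSigmaCompact_iUnion _ fun N => ((isSigmaCompact_univ.of_isClosed_subset (hC N)
      (Set.subset_univ _)).image continuous_fst)
  have heq : {a : J → T → ι → ℝ | ∃ v v₀, ∀ j, SameSigns (a j) v v₀ ↔ j ∈ S} =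
      ⋃ N, Prod.fst '' C N := by
    ext a
    simp only [Set.mem_ofPred_eq, Set.mem_iUnion, Set.mem_image]
    constructor
    · rintro ⟨v, v₀, h⟩
      have hev : ∀ x : ℝ, ∀ᶠ N in Filter.atTop, 0 < x → ε N ≤ x := fun x => by
        by_cases hx : 0 < x
        · filter_upwards [(tendsto_one_div_add_atTop_nhds_zero_nat (𝕜 := ℝ)).eventually_lt_const hx]
            with N hN _ using hN.le
        · exact Filter.Eventually.of_forall fun N h => absurd h hx
      obtain ⟨N, hN⟩ := (Filter.eventually_all.2 fun j => Filter.eventually_all.2 fun t =>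
        (hev (a j t ⬝ᵥ v)).and (hev (a j t ⬝ᵥ v₀))).exists
      refine ⟨N, ⟨a, v, v₀⟩, ⟨?_, ?_⟩, rfl⟩
      · simp only [Set.mem_iInter]
        intro j hj t
        have := (h j).2 hj t
        by_cases hv : 0 < a j t ⬝ᵥ v
        · exact Or.inl ⟨(hN j t).1 hv, (hN j t).2 (this.1 hv)⟩
        · exact Or.inr ⟨not_lt.1 hv, not_lt.1 (mt this.2 hv)⟩
      · simp only [Set.mem_iInter, Set.mem_iUnion]
        intro j hj
        have := mt (h j).1 hj
        simp only [SameSigns, not_forall] at this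
        obtain ⟨t, ht⟩ := this
        refine ⟨t, ?_⟩
        by_cases hv : 0 < a j t ⬝ᵥ v
        · exact Or.inl ⟨(hN j t).1 hv, not_lt.1 fun h' => ht ⟨fun _ => h', fun _ => hv⟩⟩
        · refine Or.inr ⟨not_lt.1 hv, (hN j t).2 ?_⟩
          by_contra h'
          exact ht ⟨fun h => absurd h hv, fun h => absurd h h'⟩
    · rintro ⟨N, ⟨a', v, v₀⟩, ⟨hA, hB⟩, rfl⟩
      simp only [Set.mem_iInter, Set.mem_iUnion] at hA hB
      refine ⟨v, v₀, fun j => ⟨fun h => ?_, fun hj t => ?_⟩⟩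
      · by_contra hj
        obtain ⟨t, ⟨h5, h6⟩ | ⟨h5, h6⟩⟩ := hB j hj
        · exact absurd ((h t).1 ((hε N).trans_le h5)) (not_lt.2 h6)
        · exact absurd ((h t).2 ((hε N).trans_le h6)) (not_lt.2 h5)
      · rcases hA j hj t with ⟨h5, h6⟩ | ⟨h5, h6⟩
        · exact ⟨fun _ => (hε N).trans_le h6, fun _ => (hε N).trans_le h5⟩
        · exact ⟨fun h => absurd h (not_lt.2 h5), fun h => absurd h (not_lt.2 h6)⟩
  rw [heq]
  obtain ⟨Kc, hKc, hU⟩ := hσ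
  rw [← hU]
  exact MeasurableSet.iUnion fun n => (hKc n).measurableSet

theorem measurableSet_agreeSet [MeasurableSpace Q] {ℓ : Q → T → ι → ℝ} (hℓ : ∀ t i, Measurable fun q => ℓ q t i)
    (S : Set J) : MeasurableSet (agreeSet ℓ S) := by
  have h : Measurable fun (q : J → Q) j => ℓ (q j) :=
    measurable_pi_lambda _ fun j => measurable_pi_lambda _ fun t => measurable_pi_lambda _ fun i =>
      (hℓ t i).comp (measurable_pi_apply j)
  exact h (measurableSet_agreeSet_aux S)

/-- A disagreement set is determined by the two sign patterns on the pooled family of `card J * card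
T` forms, and Sauer bounds each pattern; hence the exponent `2 * card ι`. -/
theorem card_agree_le [DecidableEq J] (ℓ : Q → T → ι → ℝ) (q : J → Q) (𝒰 : Finset (Finset J))
    (h𝒰 : ∀ S ∈ 𝒰, ∃ v v₀, ∀ j, SameSigns (ℓ (q j)) v v₀ ↔ j ∉ S) :
    #𝒰 ≤ (Fintype.card J * Fintype.card T + 1) ^ (2 * Fintype.card ι) := by
  classical
  let a : J × T → ι → ℝ := fun x => ℓ (q x.1) x.2
  choose! v v₀ h using h𝒰
  let g : Finset J → Finset (J × T) × Finset (J × T) := fun S => (signSet a (v S), signSet a (v₀ S))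
  have hinj : Set.InjOn g 𝒰 := by
    intro S hS S' hS' hg
    obtain ⟨g1, g2⟩ := Prod.ext_iff.1 hg
    have e1 : ∀ j t, 0 < ℓ (q j) t ⬝ᵥ v S ↔ 0 < ℓ (q j) t ⬝ᵥ v S' := fun j t => by
      have := Finset.ext_iff.1 g1 (j, t)
      simpa only [g, mem_signSet] using this
    have e2 : ∀ j t, 0 < ℓ (q j) t ⬝ᵥ v₀ S ↔ 0 < ℓ (q j) t ⬝ᵥ v₀ S' := fun j t => by
      have := Finset.ext_iff.1 g2 (j, t)
      simpa only [g, mem_signSet] using this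
    ext j
    rw [← not_iff_not, ← h S hS j, ← h S' hS' j]
    exact forall_congr' fun t => by rw [e1, e2]
  rw [← Finset.card_image_of_injOn hinj]
  refine (Finset.card_le_card (t := (𝒰.image fun S => signSet a (v S)) ×ˢ
    (𝒰.image fun S => signSet a (v₀ S))) fun x hx => ?_).trans ?_
  · obtain ⟨S, hS, rfl⟩ := Finset.mem_image.1 hx
    exact Finset.mem_product.2 ⟨Finset.mem_image_of_mem _ hS, Finset.mem_image_of_mem _ hS⟩
  · rw [Finset.card_product, two_mul, pow_add]
    have hc : Fintype.card J * Fintype.card T = Fintype.card (J × T) :=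
      (Fintype.card_prod J T).symm
    rw [hc]
    refine Nat.mul_le_mul (card_signSets_le (a := a) fun s hs => ?_)
      (card_signSets_le (a := a) fun s hs => ?_) <;>
    · obtain ⟨S, _, rfl⟩ := Finset.mem_image.1 hs
      exact ⟨_, rfl⟩

variable [MeasurableSpace Q]

theorem measurePreserving_comp_perm {ν : Measure Q} [IsProbabilityMeasure ν] (σ : Equiv.Perm J) :
    MeasurePreserving (fun q : J → Q => q ∘ σ) (Measure.pi fun _ => ν) (Measure.pi fun _ => ν) := by
  have h := measurePreserving_piCongrLeft (α := fun _ : J => Q) (fun _ => ν) σ.symm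
  have e : ⇑(MeasurableEquiv.piCongrLeft (fun _ : J => Q) σ.symm) = fun q : J → Q => q ∘ σ := by
    ext q j
    have := Equiv.piCongrLeft_apply_apply (fun _ : J => Q) σ.symm q (σ j)
    rw [Equiv.symm_apply_apply] at this
    exact this
  rwa [e] at h

/-- A ghost sample `p` such that two parameters that agree on `p` are unlikely to disagree on all of
`m` fresh points. -/
theorem exists_ghost {ν : Measure Q} [IsProbabilityMeasure ν] {ℓ : Q → T → ι → ℝ}
    (hℓ : ∀ t i, Measurable fun q => ℓ q t i) (n m : ℕ) :
    ∃ p : Fin n → Q, MeasurableSet {q : Fin m → Q | ∃ v v₀, (∀ i, SameSigns (ℓ (p i)) v v₀) ∧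
        ∀ j, ¬ SameSigns (ℓ (q j)) v v₀} ∧
      (Measure.pi fun _ : Fin m => ν) {q : Fin m → Q | ∃ v v₀,
        (∀ i, SameSigns (ℓ (p i)) v v₀) ∧ ∀ j, ¬ SameSigns (ℓ (q j)) v v₀} * (n + m).choose m ≤
        (((n + m) * Fintype.card T + 1) ^ (2 * Fintype.card ι) : ℕ) := by
  classical
  let J := Fin n ⊕ Fin m
  let μ : Measure (J → Q) := Measure.pi fun _ => ν
  let B : Set (J → Q) := agreeSet ℓ (Set.range Sum.inl)
  have hB : MeasurableSet B := measurableSet_agreeSet hℓ _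
  have hcardJ : Fintype.card J = n + m := by simp [J]
  -- By exchangeability every choice of the `m` positions of disagreement is equally likely, while
  -- for a fixed pooled sample only the Sauer number of choices can occur. Summing over all `(n +
  -- m).choose m` choices bounds the probability.
  have hσ : ∀ S ∈ powersetCard m (univ : Finset J), ∃ σ : Equiv.Perm J,
      ∀ j, σ j ∈ S ↔ j ∉ Set.range (Sum.inl : Fin n → J) := by
    intro S hS
    rw [Finset.mem_powersetCard_univ] at hS
    have e1 : Fintype.card (Fin m) = Fintype.card {x // x ∈ S} := by simp [hS]
    have e2 : Fintype.card (Fin n) = Fintype.card {x // ¬ x ∈ S} := by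
      rw [Fintype.card_subtype_compl, hcardJ]; simp [hS]
    let E : J ≃ J := (Equiv.sumCongr (Fintype.equivOfCardEq e2) (Fintype.equivOfCardEq e1)).trans
      ((Equiv.sumComm _ _).trans (Equiv.sumCompl fun x => x ∈ S))
    refine ⟨E, fun j => ?_⟩
    rcases j with i | i
    · have : E (Sum.inl i) = ((Fintype.equivOfCardEq e2) i : J) := rfl
      rw [this]
      simp [((Fintype.equivOfCardEq e2) i).2]
    · have : E (Sum.inr i) = ((Fintype.equivOfCardEq e1) i : J) := rfl
      rw [this]
      simp [((Fintype.equivOfCardEq e1) i).2]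
  choose! σ hσ using hσ
  have hsum : ∀ q : J → Q, ∑ S ∈ powersetCard m (univ : Finset J),
      B.indicator (fun _ => (1 : ℝ≥0∞)) (q ∘ σ S) ≤
        (((n + m) * Fintype.card T + 1) ^ (2 * Fintype.card ι) : ℕ) := by
    intro q
    simp only [Set.indicator_apply]
    rw [Finset.sum_ite, Finset.sum_const_zero, add_zero, Finset.sum_const, nsmul_one, ← hcardJ]
    refine Nat.cast_le.2 (card_agree_le ℓ q _ fun S hS => ?_)
    obtain ⟨h1, v, v₀, h2⟩ := Finset.mem_filter.1 hS
    refine ⟨v, v₀, fun j => ?_⟩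
    have h3 := h2 ((σ S).symm j)
    have h4 := hσ S h1 ((σ S).symm j)
    simp only [Function.comp_apply, Equiv.apply_symm_apply] at h3 h4
    rw [h3, h4, not_not]
  have hμ : μ B * (n + m).choose m ≤
      (((n + m) * Fintype.card T + 1) ^ (2 * Fintype.card ι) : ℕ) := by
    calc μ B * (n + m).choose m = ∑ S ∈ powersetCard m (univ : Finset J), μ B := by
          rw [Finset.sum_const, Finset.card_powersetCard, Finset.card_univ, hcardJ, nsmul_eq_mul,
            mul_comm]
      _ = ∑ S ∈ powersetCard m (univ : Finset J),
          ∫⁻ q, B.indicator (fun _ => (1 : ℝ≥0∞)) (q ∘ σ S) ∂μ := Finset.sum_congr rfl fun S _ => by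
          rw [(measurePreserving_comp_perm (σ S)).lintegral_comp
            (measurable_const.indicator hB), lintegral_indicator_const hB, one_mul]
      _ = ∫⁻ q, ∑ S ∈ powersetCard m (univ : Finset J),
          B.indicator (fun _ => (1 : ℝ≥0∞)) (q ∘ σ S) ∂μ :=
          (lintegral_finsetSum _ fun S _ => (measurable_const.indicator hB).comp
            (measurePreserving_comp_perm (ν := ν) (σ S)).measurable).symm
      _ ≤ ∫⁻ _, (((n + m) * Fintype.card T + 1) ^ (2 * Fintype.card ι) : ℕ) ∂μ :=
          lintegral_mono hsum
      _ = _ := by simp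
  let e := (MeasurableEquiv.sumPiEquivProdPi fun _ : J => Q).symm
  have he := measurePreserving_sumPiEquivProdPi_symm (fun _ : J => ν)
  have hBe : ∀ p : Fin n → Q, {q : Fin m → Q | ∃ v v₀, (∀ i, SameSigns (ℓ (p i)) v v₀) ∧
      ∀ j, ¬ SameSigns (ℓ (q j)) v v₀} = Prod.mk p ⁻¹' (e ⁻¹' B) := fun p => by
    ext q
    refine exists_congr fun v => exists_congr fun v₀ => ⟨fun h j => ?_, fun h => ⟨fun i => ?_,
      fun j => ?_⟩⟩
    · rcases j with i | j
      · exact ⟨fun _ => ⟨i, rfl⟩, fun _ => h.1 i⟩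
      · exact ⟨fun h' => absurd h' (h.2 j), fun ⟨_, h'⟩ => by simp at h'⟩
    · exact (h (Sum.inl i)).2 ⟨i, rfl⟩
    · exact fun h' => by simpa using (h (Sum.inr j)).1 h'
  have hBm : MeasurableSet (e ⁻¹' B) := e.measurable hB
  have hint : μ B = ∫⁻ p : Fin n → Q, (Measure.pi fun _ : Fin m => ν) (Prod.mk p ⁻¹' (e ⁻¹' B))
      ∂(Measure.pi fun _ => ν) := by
    rw [← he.measure_preimage hB.nullMeasurableSet, Measure.prod_apply hBm]
  -- Some `p` does no worse than the average. It is fixed once and for all, so the cover built on it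
  -- is not random.
  obtain ⟨p, hp⟩ := exists_le_lintegral (μ := Measure.pi fun _ : Fin n => ν)
    (measurable_measure_prodMk_left (ν := Measure.pi fun _ : Fin m => ν) hBm).aemeasurable
  refine ⟨p, by rw [hBe]; exact measurable_prodMk_left hBm, ?_⟩
  rw [hBe]
  rw [← hint] at hp
  exact (mul_le_mul_left hp _).trans hμ

end Ghost

end

end DistRL

namespace DistRL

noncomputable section

/-! ### Spanners, upper brackets and the dominating measure. -/

section Spanner

open Module

/-- A bounded set in dimension at most `d` has a spanning family of `d` of its elements (or zeros)
with respect to which all its elements have coefficients at most `2`. -/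
theorem exists_spanner {E : Type*} [NormedAddCommGroup E] [NormedSpace ℝ E] [FiniteDimensional ℝ E]
    {d : ℕ} (hd : finrank ℝ E ≤ d) {W : Set E} {B : ℝ} (hW : ∀ y ∈ W, ‖y‖ ≤ B) :
    ∃ w : Fin d → E, (∀ i, w i ∈ W ∨ w i = 0) ∧
      ∀ y ∈ W, ∃ c : Fin d → ℝ, (∀ i, |c i| ≤ 2) ∧ y = ∑ i, c i • w i := by
  classical
  set U := Submodule.span ℝ W with hU
  set r := finrank ℝ U with hr
  have hrd : r ≤ d := (Submodule.finrank_le U).trans hd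
  let b : Basis (Fin r) ℝ U := finBasis ℝ U
  let L : U →L[ℝ] (Fin r → ℝ) := LinearMap.toContinuousLinearMap b.equivFun.toLinearMap
  have hL : ∀ u j, b.repr u j = L u j := fun u j => rfl
  let D : Set ℝ := {t | ∃ v : Fin r → U, (∀ i, (v i : E) ∈ W) ∧ t = |b.det v|}
  have hbdd : BddAbove D := by
    refine ⟨((Fintype.card (Fin r)).factorial • (‖L‖ * B) ^ Fintype.card (Fin r)), ?_⟩
    rintro t ⟨v, hv, rfl⟩
    rw [b.det_apply]
    refine Matrix.det_le (abv := AbsoluteValue.abs) fun i j => ?_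
    change |b.repr (v j) i| ≤ _
    rw [hL]
    calc |L (v j) i| ≤ ‖L (v j)‖ := norm_le_pi_norm (L (v j)) i
      _ ≤ ‖L‖ * ‖v j‖ := L.le_opNorm _
      _ ≤ ‖L‖ * B := mul_le_mul_of_nonneg_left (hW _ (hv j)) (norm_nonneg L)
  obtain ⟨f, hfW, hfs, hfi⟩ := Submodule.exists_fun_fin_finrank_span_eq ℝ W
  have hmem : ∀ y ∈ W, y ∈ U := fun y hy => Submodule.subset_span hy
  let f' : Fin r → U := fun i => ⟨f i, hmem _ (hfW i)⟩
  have hf'i : LinearIndependent ℝ f' := LinearIndependent.of_comp U.subtype hfi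
  have hsp : ∀ v : Fin r → U, LinearIndependent ℝ v → Submodule.span ℝ (Set.range v) = ⊤ :=
    fun v hv => hv.span_eq_top_of_card_eq_finrank' (by simp [hr])
  have hpos : 0 < |b.det f'| := abs_pos.2 ((b.is_basis_iff_det.1 ⟨hf'i, hsp f' hf'i⟩).ne_zero)
  have hle : ∀ v : Fin r → U, (∀ i, (v i : E) ∈ W) → |b.det v| ≤ sSup D :=
    fun v hv => le_csSup hbdd ⟨v, hv, rfl⟩
  have hS : 0 < sSup D := hpos.trans_le (hle f' hfW)
  -- The supremum of the volumes need not be attained. More than half of it suffices, and Cramer's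
  -- rule then bounds the coefficients by 2.
  obtain ⟨t, ⟨v, hv, rfl⟩, ht⟩ := exists_lt_of_lt_csSup (s := D) ⟨_, f', hfW, rfl⟩
    (half_lt_self hS)
  have hdet : b.det v ≠ 0 := abs_pos.1 ((half_pos hS).trans ht)
  obtain ⟨hli, hspan⟩ := b.is_basis_iff_det.2 (isUnit_iff_ne_zero.2 hdet)
  let bv : Basis (Fin r) ℝ U := Basis.mk hli hspan.ge
  have hcoord : ∀ y (hy : y ∈ W) i, |bv.repr ⟨y, hmem y hy⟩ i| ≤ 2 := fun y hy i => by
    have h1 := LinearMap.congr_fun (b.det_smul_mk_coord_eq_det_update hli hspan.ge i)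
      ⟨y, hmem y hy⟩
    have h2 : b.det v * bv.repr ⟨y, hmem y hy⟩ i =
      b.det (Function.update v i ⟨y, hmem y hy⟩) := h1
    have h3 := hle (Function.update v i ⟨y, hmem y hy⟩) fun j => by
      by_cases hj : j = i
      · subst hj; simpa using hy
      · simpa [hj] using hv j
    rw [← h2, abs_mul] at h3
    by_contra! hcon
    nlinarith [abs_nonneg (b.det v)]
  refine ⟨fun i => if hi : (i : ℕ) < r then v ⟨i, hi⟩ else 0, fun i => ?_, fun y hy =>
    ⟨fun i => if hi : (i : ℕ) < r then bv.repr ⟨y, hmem y hy⟩ ⟨i, hi⟩ else 0, fun i => ?_, ?_⟩⟩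
  · by_cases hi : (i : ℕ) < r
    · simp only [hi, dite_true]; exact Or.inl (hv _)
    · simp [hi]
  · by_cases hi : (i : ℕ) < r
    · simp only [hi, dite_true]; exact hcoord y hy _
    · simp [hi]
  · have h1 := congrArg (U.subtype) (bv.sum_repr ⟨y, hmem y hy⟩)
    simp only [map_sum, map_smul, Submodule.subtype_apply] at h1
    refine h1.symm.trans ?_
    refine Finset.sum_of_injOn (Fin.castLE hrd) (Fin.castLE_injective hrd).injOn
      (by simp) (fun i _ hi => ?_) fun i _ => ?_
    · have : ¬ (i : ℕ) < r := fun h => hi ⟨⟨i, h⟩, by simp, rfl⟩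
      simp [this]
    · simp [bv]

end Spanner

section Net

variable {𝒳 𝒜 : Type*} {M d : ℕ}

/-- A finite family of upper brackets for the linear class, in the uniform norm. -/
theorem exists_upper_net [MeasurableSpace 𝒳] [MeasurableSpace 𝒜]
    {Φ : Finset (𝒳 → 𝒜 → EuclideanSpace ℝ (Fin d))}
    (hΦ : ∀ φ ∈ Φ, Measurable fun y : 𝒳 × 𝒜 => φ y.1 y.2) {N : ℕ} (hN : 0 < N) :
    ∃ 𝒩 : Finset (𝒳 → 𝒜 → Fin M → ℝ), #𝒩 ≤ #Φ * (4 * N + 1) ^ (d * M) ∧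
      (∀ g ∈ 𝒩, (∀ z, Measurable fun y : 𝒳 × 𝒜 => g y.1 y.2 z) ∧ (∀ x a z, (d : ℝ) / N ≤ g x a z) ∧
        ∃ f ∈ linClass Φ M, ∀ x a z, g x a z ≤ f x a z + 2 * (d / N)) ∧
      ∀ f ∈ linClass Φ M, ∃ g ∈ 𝒩, ∀ x a z, f x a z ≤ g x a z ∧ g x a z ≤ f x a z + 2 * (d / N) := by
  classical
  have hN0 : (0 : ℝ) < N := by exact_mod_cast hN
  -- The elements of `Φ` are not assumed bounded, so closeness of weights would not give closeness
  -- of predictions. A spanner of the weights whose predictions lie in `[-1, 1]` has such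
  -- predictions itself, and rounding its coefficients to multiples of `1 / N` moves predictions by
  -- at most `d / N`.
  let W : (𝒳 → 𝒜 → EuclideanSpace ℝ (Fin d)) → Set (EuclideanSpace ℝ (Fin d)) := fun φ =>
    {w | ‖w‖ ≤ √d ∧ ∀ x a, |inner ℝ (φ x a) w| ≤ 1}
  choose w hwW hw using fun φ => exists_spanner (E := EuclideanSpace ℝ (Fin d)) (d := d) (by simp)
    (W := W φ) (B := √d) fun y hy => hy.1
  have hw1 : ∀ φ i x a, |inner ℝ (φ x a) (w φ i)| ≤ 1 := fun φ i x a => by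
    rcases hwW φ i with h | h
    · exact h.2 x a
    · rw [h]; simp
  let I := Fin M → Fin d → Finset.Icc (-(2 * N : ℤ)) (2 * N)
  -- Adding `d / N` makes the rounded function an upper bracket; the maximum supplies the positive
  -- floor that pays for wrong labels.
  let F : (𝒳 → 𝒜 → EuclideanSpace ℝ (Fin d)) × I → 𝒳 → 𝒜 → Fin M → ℝ := fun p x a z =>
    max (∑ i, ((p.2 z i : ℤ) / N : ℝ) * inner ℝ (p.1 x a) (w p.1 i) + d / N) (d / N)
  have hcard : Fintype.card I = (4 * N + 1) ^ (d * M) := by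
    simp only [I, Fintype.card_fun, Fintype.card_fin, Fintype.card_coe, Int.card_Icc]
    rw [← pow_mul]
    congr 1
    omega
  -- Only grid elements close to a member of the class are kept, so that every bracket has total
  -- mass at most `1 + 2 * M * (d / N)`.
  let 𝒩 := ((Φ ×ˢ (univ : Finset I)).image F).filter fun g =>
    ∃ f ∈ linClass Φ M, ∀ x a z, g x a z ≤ f x a z + 2 * (d / N)
  refine ⟨𝒩, ?_, fun g hg => ?_, fun f hf => ?_⟩
  · refine (Finset.card_filter_le _ _).trans (Finset.card_image_le.trans ?_)
    rw [Finset.card_product, Finset.card_univ, hcard]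
  · obtain ⟨hg1, hg2⟩ := Finset.mem_filter.1 hg
    obtain ⟨⟨φ, k⟩, hk, rfl⟩ := Finset.mem_image.1 hg1
    have hφ := (Finset.mem_product.1 hk).1
    refine ⟨fun z => Measurable.max (Measurable.add_const (Finset.measurable_fun_sum _ fun i _ =>
      Measurable.const_mul ?_ _) _) measurable_const, fun x a z => le_max_right _ _, hg2⟩
    exact (hΦ φ hφ).inner measurable_const
  · obtain ⟨hf1, φ, hφ, v, hv, hfv⟩ := hf
    have hvW : ∀ z, v z ∈ W φ := fun z => ⟨hv z, fun x a => by
      rw [← hfv]; exact abs_le_one_of_mem (hf1 x a) z⟩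
    choose c hc hcv using fun z => hw φ (v z) (hvW z)
    have hkmem : ∀ z i, ⌊c z i * N⌋ ∈ Finset.Icc (-(2 * N : ℤ)) (2 * N) := fun z i => by
      have h1 := abs_le.1 (hc z i)
      rw [Finset.mem_Icc]
      constructor
      · rw [Int.le_floor]; push_cast; nlinarith
      · have : (⌊c z i * N⌋ : ℝ) ≤ ((2 * N : ℤ) : ℝ) :=
          (Int.floor_le _).trans (by push_cast; nlinarith)
        exact_mod_cast this
    let k : I := fun z i => ⟨⌊c z i * N⌋, hkmem z i⟩
    have happ : ∀ x a z, |f x a z - ∑ i, ((k z i : ℤ) / N : ℝ) * inner ℝ (φ x a) (w φ i)| ≤ d / N := by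
      intro x a z
      have h1 : f x a z = ∑ i, c z i * inner ℝ (φ x a) (w φ i) := by
        rw [hfv, hcv z, inner_sum]
        exact Finset.sum_congr rfl fun i _ => inner_smul_right _ _ _
      rw [h1, ← Finset.sum_sub_distrib]
      refine (Finset.abs_sum_le_sum_abs _ _).trans ?_
      calc ∑ i, |c z i * inner ℝ (φ x a) (w φ i) - ((k z i : ℤ) / N : ℝ) * inner ℝ (φ x a) (w φ i)|
          ≤ ∑ _i : Fin d, (1 / N : ℝ) := Finset.sum_le_sum fun i _ => by
            rw [← sub_mul, abs_mul]
            have h2 : |c z i - ((k z i : ℤ) / N : ℝ)| ≤ 1 / N := by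
              have h3 := Int.floor_le (c z i * N)
              have h4 := Int.lt_floor_add_one (c z i * N)
              have h5 : c z i - ((k z i : ℤ) / N : ℝ) = (c z i * N - ⌊c z i * N⌋) / N := by
                simp only [k]; field_simp
              rw [h5, abs_of_nonneg (div_nonneg (by linarith) hN0.le)]
              exact div_le_div_of_nonneg_right (by linarith) hN0.le
            calc _ ≤ (1 / N : ℝ) * 1 := mul_le_mul h2 (hw1 φ i x a) (abs_nonneg _) (by positivity)
              _ = _ := mul_one _
        _ = d / N := by simp [div_eq_mul_inv]
    have hb : ∀ x a z, f x a z ≤ F (φ, k) x a z ∧ F (φ, k) x a z ≤ f x a z + 2 * (d / N) := by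
      intro x a z
      have h1 := abs_le.1 (happ x a z)
      have h2 := (hf1 x a).1 z
      have h3 : (0 : ℝ) ≤ d / N := by positivity
      exact ⟨le_max_of_le_left (by simp only; linarith),
        max_le (by simp only; linarith) (by linarith)⟩
    refine ⟨F (φ, k), Finset.mem_filter.2 ⟨Finset.mem_image_of_mem _ (Finset.mem_product.2
      ⟨hφ, mem_univ _⟩), f, ⟨hf1, φ, hφ, v, hv, hfv⟩, fun x a z => (hb x a z).2⟩, hb⟩

end Net

section Domination

variable {𝒳 𝒜 : Type*} [MeasurableSpace 𝒳] [MeasurableSpace 𝒜] [Nonempty 𝒜] {H M d : ℕ}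
  {mdp : MDP 𝒳 𝒜 H M} {φs : Fin H → 𝒳 → 𝒜 → EuclideanSpace ℝ (Fin d)}

/-- The one-step laws of a low-rank MDP are dominated by a single probability measure. -/
theorem MDP.IsLowRank.exists_dominating (hr : mdp.IsLowRank φs) (hd : 0 < d) (h : Fin H) :
    ∃ ν : Measure (Fin M × 𝒳), IsProbabilityMeasure ν ∧
      ∀ x a, mdp.step h (x, a) ≤ (2 * d : ℝ≥0∞) • ν := by
  classical
  have hst := mdp.markov h
  obtain ⟨a₀⟩ := ‹Nonempty 𝒜›
  obtain ⟨h1, μs, h2, -⟩ := hr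
  obtain ⟨w, hw, hspan⟩ := exists_spanner (E := EuclideanSpace ℝ (Fin d)) (d := d) (by simp)
    (W := Set.range fun y : 𝒳 × 𝒜 => φs h y.1 y.2) (B := 1) (by rintro _ ⟨y, rfl⟩; exact h1 h _ _)
  have hpt : ∀ i, ∃ y : 𝒳 × 𝒜, w i = φs h y.1 y.2 ∨ w i = 0 := fun i => by
    rcases hw i with ⟨y, hy⟩ | h0
    · exact ⟨y, Or.inl hy.symm⟩
    · exact ⟨(mdp.x₁, a₀), Or.inr h0⟩
  choose y hy using hpt
  have hd0 : (d : ℝ≥0∞) ≠ 0 := by exact_mod_cast hd.ne'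
  refine ⟨(d : ℝ≥0∞)⁻¹ • ∑ i, mdp.step h (y i), ⟨?_⟩, fun x a => ?_⟩
  · rw [Measure.smul_apply, Measure.finsetSum_apply]
    simp [ENNReal.inv_mul_cancel hd0]
  · refine Measure.le_iff.2 fun S hS => ?_
    obtain ⟨c, hc, hcw⟩ := hspan _ ⟨(x, a), rfl⟩
    replace hcw : φs h x a = ∑ i, c i • w i := hcw
    -- Coefficients of the feature on the spanner express the law at `(x, a)` as a signed
    -- combination of at most `d` of the one-step laws, with coefficients at most 2; their average
    -- is the dominating measure.
    have hreal : (mdp.step h (x, a)).real S ≤ 2 * ∑ i, (mdp.step h (y i)).real S := by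
      rw [h2 h x a S hS, hcw, sum_inner, Finset.mul_sum]
      refine Finset.sum_le_sum fun i _ => ?_
      rw [real_inner_smul_left]
      rcases hy i with e | e
      · rw [e, ← h2 h _ _ S hS]
        exact mul_le_mul_of_nonneg_right ((le_abs_self _).trans (hc i)) measureReal_nonneg
      · rw [e, inner_zero_left, mul_zero]
        positivity
    rw [smul_smul, mul_assoc, ENNReal.mul_inv_cancel hd0 (by simp), mul_one, Measure.smul_apply,
      Measure.finsetSum_apply, smul_eq_mul]
    rw [← ENNReal.ofReal_toReal (measure_ne_top (mdp.step h (x, a)) S)]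
    refine (ENNReal.ofReal_le_ofReal hreal).trans_eq ?_
    rw [ENNReal.ofReal_mul (by norm_num), ENNReal.ofReal_sum_of_nonneg fun _ _ => measureReal_nonneg]
    simp

end Domination

end

end DistRL

namespace DistRL

noncomputable section

set_option linter.unusedSectionVars false

/-! ### Sampling by quantiles and the law of the targets. -/

section Quantile

variable {M : ℕ}

/-- The quantile of a uniform seed is a sample from the distribution. -/
theorem lintegral_quantile {p : Fin M → ℝ} (hp : p ∈ stdSimplex ℝ (Fin M)) (G : ℕ → ℝ≥0∞) :
    ∫⁻ u in Set.Icc (0 : ℝ) 1, G (quantile p u) = ∑ y, ENNReal.ofReal (p y) * G y := by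
  let s : ℕ → ℝ := fun n => ∑ i : Fin M, if (i : ℕ) < n then p i else 0
  have hmono : Monotone s := fun m n hmn => Finset.sum_le_sum fun i _ => by
    by_cases h : (i : ℕ) < m
    · simp [h, h.trans_le hmn]
    · simp only [h, if_false]; split_ifs <;> simp [hp.1 i]
  have hIic : ∀ j : Fin M, ∑ i ∈ Iic j, p i = s (j + 1) := fun j => by
    simp only [s]
    rw [← Finset.sum_filter]
    refine Finset.sum_congr ?_ fun _ _ => rfl
    ext i
    simp only [Finset.mem_Iic, Finset.mem_filter, Finset.mem_univ, true_and, Fin.le_def]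
    omega
  have hs0 : s 0 = 0 := by simp [s]
  have hsM : s M = 1 := by simp [s, hp.2]
  have hquant : ∀ n < M, ∀ u ∈ Set.Ioc (s n) (s (n + 1)), quantile p u = n := by
    intro n hn u hu
    have : ({j : Fin M | ∑ i ∈ Iic j, p i < u} : Finset (Fin M)) =
        univ.filter fun j : Fin M => (j : ℕ) < n := by
      ext j
      simp only [Finset.mem_filter, Finset.mem_univ, true_and, hIic]
      constructor
      · intro h
        by_contra! hj
        exact absurd (hu.2.trans (hmono (by omega : n + 1 ≤ j + 1))) (not_le.2 h)
      · intro h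
        exact (hmono (by omega : (j : ℕ) + 1 ≤ n)).trans_lt hu.1
    unfold quantile
    rw [this, Fin.card_filter_val_lt, min_eq_right hn.le]
  have key : ∀ n ≤ M, ∫⁻ u in Set.Ioc 0 (s n), G (quantile p u) =
      ∑ i : Fin M, if (i : ℕ) < n then ENNReal.ofReal (p i) * G i else 0 := by
    intro n
    induction n with
    | zero => simp [hs0]
    | succ n ih =>
      intro hn
      have h0 : 0 ≤ s n := hs0 ▸ hmono (Nat.zero_le n)
      have hstep : s (n + 1) = s n + p ⟨n, hn⟩ := by
        simp only [s]
        have : ∀ i : Fin M, (if (i : ℕ) < n + 1 then p i else 0) =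
            (if (i : ℕ) < n then p i else 0) + if i = ⟨n, hn⟩ then p i else 0 := fun i => by
          rcases lt_trichotomy (i : ℕ) n with h | h | h
          · simp [h, Nat.lt_succ_of_lt h, Fin.ext_iff, h.ne]
          · simp [h, Fin.ext_iff]
          · have h1 : ¬ (i : ℕ) < n + 1 := by omega
            have h2 : ¬ (i : ℕ) < n := by omega
            simp [h1, h2, Fin.ext_iff, h.ne']
        simp only [this, Finset.sum_add_distrib]
        simp
      rw [← Set.Ioc_union_Ioc_eq_Ioc h0 (hmono n.le_succ),
        lintegral_union measurableSet_Ioc (Set.Ioc_disjoint_Ioc_of_le le_rfl), ih (by omega),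
        setLIntegral_congr_fun measurableSet_Ioc fun u hu => by rw [hquant n hn u hu],
        setLIntegral_const, Real.volume_Ioc, hstep, add_sub_cancel_left]
      have : ∀ i : Fin M, (if (i : ℕ) < n + 1 then ENNReal.ofReal (p i) * G i else 0) =
          (if (i : ℕ) < n then ENNReal.ofReal (p i) * G i else 0) +
            if i = ⟨n, hn⟩ then ENNReal.ofReal (p i) * G i else 0 := fun i => by
        rcases lt_trichotomy (i : ℕ) n with h | h | h
        · simp [h, Nat.lt_succ_of_lt h, Fin.ext_iff, h.ne]
        · simp [h, Fin.ext_iff]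
        · have h1 : ¬ (i : ℕ) < n + 1 := by omega
          have h2 : ¬ (i : ℕ) < n := by omega
          simp [h1, h2, Fin.ext_iff, h.ne']
      simp only [this, Finset.sum_add_distrib]
      simp [mul_comm]
  have h := key M le_rfl
  rw [hsM] at h
  rw [← setLIntegral_congr Ioc_ae_eq_Icc, h]
  simp

theorem measurable_quantile {Ω : Type*} [MeasurableSpace Ω] {p : Ω → Fin M → ℝ} {u : Ω → ℝ}
    (hp : ∀ z, Measurable fun ω => p ω z) (hu : Measurable u) :
    Measurable fun ω => quantile (p ω) (u ω) := by
  simp only [quantile, Finset.card_filter]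
  exact Finset.measurable_fun_sum _ fun j _ => Measurable.ite
    (measurableSet_lt (Finset.measurable_fun_sum _ fun i _ => hp i) hu) measurable_const
    measurable_const

end Quantile

section Target

variable {𝒳 𝒜 : Type*} [MeasurableSpace 𝒳] [MeasurableSpace 𝒜] {M : ℕ}

/-- The capped sum of the observed cost and a sample of `q` at the next state. -/
def nextTarget (q : 𝒳 → Fin M → ℝ) (s : Sample 𝒳 𝒜 M) : Fin M :=
  cappedAdd s.1.2.1 (quantile (q s.1.2.2) s.2)

theorem measurable_nextTarget {q : 𝒳 → Fin M → ℝ} (hq : IsNextDist q) :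
    Measurable (nextTarget (𝒜 := 𝒜) q) := by
  have h1 : Measurable fun s : Sample 𝒳 𝒜 M => (s.1.2.1, quantile (q s.1.2.2) s.2) :=
    Measurable.prodMk (by fun_prop) (measurable_quantile
      (fun z => (hq.measurable z).comp (by fun_prop)) (by fun_prop))
  exact (measurable_of_countable fun y : Fin M × ℕ => cappedAdd y.1 y.2).comp h1

theorem measurable_comp_nextTarget {E : Type*} [MeasurableSpace E] {q : 𝒳 → Fin M → ℝ}
    (hq : IsNextDist q) {G : 𝒳 → 𝒜 → Fin M → E}
    (hG : ∀ z, Measurable fun y : 𝒳 × 𝒜 => G y.1 y.2 z) :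
    Measurable fun s : Sample 𝒳 𝒜 M => G s.1.1.1 s.1.1.2 (nextTarget q s) := by
  have hGm : Measurable fun y : (𝒳 × 𝒜) × Fin M => G y.1.1 y.1.2 y.2 :=
    measurable_from_prod_countable_left hG
  exact hGm.comp (Measurable.prodMk (by fun_prop : Measurable fun s : Sample 𝒳 𝒜 M => s.1.1)
    (measurable_nextTarget hq))

theorem lintegral_nextTarget (κ : Kernel (𝒳 × 𝒜) (Fin M × 𝒳)) [IsMarkovKernel κ]
    {q : 𝒳 → Fin M → ℝ} (hq : IsNextDist q) (x : 𝒳) (a : 𝒜) (G : Fin M → ℝ≥0∞) :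
    ∫⁻ cx, (∫⁻ u in Set.Icc (0 : ℝ) 1, G (cappedAdd cx.1 (quantile (q cx.2) u))) ∂(κ (x, a)) =
      ∑ z, ENNReal.ofReal (backup κ q x a z) * G z := by
  have h1 : ∀ cx : Fin M × 𝒳, ∫⁻ u in Set.Icc (0 : ℝ) 1, G (cappedAdd cx.1 (quantile (q cx.2) u)) =
      ∑ z, ENNReal.ofReal (shift cx.1 (q cx.2) z) * G z := fun cx => by
    rw [lintegral_quantile (hq.mem cx.2) fun n => G (cappedAdd cx.1 n)]
    have h2 : ∀ z, ENNReal.ofReal (shift cx.1 (q cx.2) z) =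
        ∑ y, if cappedAdd y cx.1 = z then ENNReal.ofReal (q cx.2 y) else 0 := fun z => by
      unfold shift
      rw [ENNReal.ofReal_sum_of_nonneg fun y _ => by split_ifs <;> simp [(hq.mem cx.2).1 y]]
      exact Finset.sum_congr rfl fun y _ => by split_ifs <;> simp
    simp only [h2, Finset.sum_mul, ite_mul, zero_mul]
    rw [Finset.sum_comm]
    simp [cappedAdd_comm]
  simp only [h1]
  rw [lintegral_finsetSum _ fun z _ =>
    ((measurable_shift_step hq.measurable z).ennreal_ofReal.mul_const _)]
  refine Finset.sum_congr rfl fun z _ => ?_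
  rw [lintegral_mul_const _ (measurable_shift_step hq.measurable z).ennreal_ofReal, backup,
    ofReal_integral_eq_lintegral_ofReal (integrable_shift_step κ hq _ z)
      (Filter.Eventually.of_forall fun cx => (shift_mem (hq.mem _)).1 z)]

variable [MeasurableSingletonClass 𝒜] [Fintype 𝒜] [LinearOrder 𝒜] [Nonempty 𝒜] {H : ℕ}

theorem lintegral_uniform (F : 𝒜 → ℝ≥0∞) : ∫⁻ a, F a ∂(PMF.uniformOfFintype 𝒜).toMeasure =
    (Fintype.card 𝒜 : ℝ≥0∞)⁻¹ * ∑ a, F a := by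
  rw [lintegral_fintype, Finset.mul_sum]
  refine Finset.sum_congr rfl fun a _ => ?_
  rw [PMF.toMeasure_apply_singleton _ _ (measurableSet_singleton a), PMF.uniformOfFintype_apply,
    mul_comm]

theorem MDP.lintegral_uaeLaw (mdp : MDP 𝒳 𝒜 H M) {π : Policy 𝒳 𝒜 H} (hπ : π.IsMeasurable)
    (h : Fin H) {F : Sample 𝒳 𝒜 M → ℝ≥0∞} (hF : Measurable F) :
    ∫⁻ s, F s ∂(mdp.uaeLaw π h) = ∫⁻ x, (Fintype.card 𝒜 : ℝ≥0∞)⁻¹ * ∑ a,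
      ∫⁻ cx, (∫⁻ u in Set.Icc (0 : ℝ) 1, F (((x, a), cx), u)) ∂(mdp.step h (x, a))
        ∂(mdp.stateLaw π h) := by
  have := mdp.markov h
  have := mdp.isProbabilityMeasure_stateLaw hπ h
  unfold MDP.uaeLaw
  rw [lintegral_prod _ hF.aemeasurable, Measure.lintegral_compProd hF.lintegral_prod_right',
    lintegral_prod _ (Measurable.lintegral_kernel_prod_right' hF.lintegral_prod_right').aemeasurable]
  refine lintegral_congr fun x => ?_
  rw [lintegral_uniform]

theorem MDP.isProbabilityMeasure_uaeLaw (mdp : MDP 𝒳 𝒜 H M) {π : Policy 𝒳 𝒜 H}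
    (hπ : π.IsMeasurable) (h : Fin H) : IsProbabilityMeasure (mdp.uaeLaw π h) := by
  have := mdp.markov h
  have := mdp.isProbabilityMeasure_stateLaw hπ h
  have : IsProbabilityMeasure (volume.restrict (Set.Icc (0 : ℝ) 1)) := ⟨by simp⟩
  unfold MDP.uaeLaw
  infer_instance

theorem MDP.lintegral_uaeLaw_nextTarget (mdp : MDP 𝒳 𝒜 H M) {π : Policy 𝒳 𝒜 H}
    (hπ : π.IsMeasurable) (h : Fin H) {q : 𝒳 → Fin M → ℝ} (hq : IsNextDist q)
    {G : 𝒳 → 𝒜 → Fin M → ℝ≥0∞} (hG : ∀ z, Measurable fun y : 𝒳 × 𝒜 => G y.1 y.2 z) :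
    ∫⁻ s : Sample 𝒳 𝒜 M, G s.1.1.1 s.1.1.2 (nextTarget q s) ∂(mdp.uaeLaw π h) =
      ∫⁻ x, (Fintype.card 𝒜 : ℝ≥0∞)⁻¹ * ∑ a, ∑ z,
        ENNReal.ofReal (backup (mdp.step h) q x a z) * G x a z ∂(mdp.stateLaw π h) := by
  have := mdp.markov h
  have hF := measurable_comp_nextTarget hq hG
  rw [mdp.lintegral_uaeLaw hπ h hF]
  refine lintegral_congr fun x => ?_
  congr 1
  refine Finset.sum_congr rfl fun a _ => ?_
  exact lintegral_nextTarget (mdp.step h) hq x a (G x a)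

theorem MDP.map_uaeLaw_le (mdp : MDP 𝒳 𝒜 H M) {π : Policy 𝒳 𝒜 H} (hπ : π.IsMeasurable)
    (h : Fin H) {ν : Measure (Fin M × 𝒳)} [IsProbabilityMeasure ν] {c : ℝ≥0∞}
    (hν : ∀ x a, mdp.step h (x, a) ≤ c • ν) :
    (mdp.uaeLaw π h).map (fun s => (s.1.2.2, s.2)) ≤
      c • (ν.map Prod.snd).prod (volume.restrict (Set.Icc (0 : ℝ) 1)) := by
  have := mdp.isProbabilityMeasure_stateLaw hπ h
  have hg : Measurable fun s : Sample 𝒳 𝒜 M => (s.1.2.2, s.2) := by fun_prop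
  refine Measure.le_iff.2 fun S hS => ?_
  rw [Measure.map_apply hg hS, ← lintegral_indicator_one (hg hS),
    mdp.lintegral_uaeLaw hπ h (measurable_one.indicator (hg hS)), Measure.smul_apply,
    Measure.prod_apply hS, lintegral_map (measurable_measure_prodMk_left hS) measurable_snd]
  have h1 : ∀ x a, ∫⁻ cx, (∫⁻ u in Set.Icc (0 : ℝ) 1,
      ((fun s : Sample 𝒳 𝒜 M => (s.1.2.2, s.2)) ⁻¹' S).indicator (1 : Sample 𝒳 𝒜 M → ℝ≥0∞)
        (((x, a), cx), u)) ∂(mdp.step h (x, a)) ≤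
      c * ∫⁻ cx, (volume.restrict (Set.Icc (0 : ℝ) 1)) (Prod.mk cx.2 ⁻¹' S) ∂ν := fun x a => by
    have h2 : ∀ cx : Fin M × 𝒳, ∫⁻ u in Set.Icc (0 : ℝ) 1,
        ((fun s : Sample 𝒳 𝒜 M => (s.1.2.2, s.2)) ⁻¹' S).indicator (1 : Sample 𝒳 𝒜 M → ℝ≥0∞)
          (((x, a), cx), u) = (volume.restrict (Set.Icc (0 : ℝ) 1)) (Prod.mk cx.2 ⁻¹' S) :=
      fun cx => by
        rw [← lintegral_indicator_one (measurable_prodMk_left hS)]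
        rfl
    simp only [h2]
    refine (lintegral_mono' (hν x a) le_rfl).trans_eq ?_
    rw [lintegral_smul_measure, smul_eq_mul]
  calc _ ≤ ∫⁻ _x, (c * ∫⁻ cx, (volume.restrict (Set.Icc (0 : ℝ) 1)) (Prod.mk cx.2 ⁻¹' S) ∂ν)
        ∂(mdp.stateLaw π h) := by
        refine lintegral_mono fun x => ?_
        refine (mul_le_mul_right (Finset.sum_le_sum fun a _ => h1 x a) _).trans_eq ?_
        rw [Finset.sum_const, Finset.card_univ, nsmul_eq_mul, ← mul_assoc,
          ENNReal.inv_mul_cancel (by simp) (by simp), one_mul]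
    _ = _ := by simp

end Target

/-! ### Labels as functions of signs of linear forms. -/

section Labels

variable {𝒳 𝒜 : Type*} [Fintype 𝒜] [LinearOrder 𝒜] [Nonempty 𝒜] {M d : ℕ}

open Matrix

theorem argmin_congr {p q : 𝒜 → ℝ} (h : ∀ a b, p a ≤ p b ↔ q a ≤ q b) : argmin p = argmin q := by
  rw [argmin_eq_iff]
  have := (argmin_eq_iff q (argmin q)).1 rfl
  simpa only [h] using this

/-- The linear forms whose signs determine the greedy action and the quantile at `(x', u)` of the
linear function with features `φ`. -/
def labelForm (M : ℕ) (φ : 𝒳 → 𝒜 → EuclideanSpace ℝ (Fin d)) (y : 𝒳 × ℝ) :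
    (𝒜 × 𝒜) ⊕ (𝒜 × Fin M) → (Fin M × Fin d) ⊕ Unit → ℝ
  | .inl (a, b) => Sum.elim (fun zl => gridVal zl.1 * (φ y.1 a zl.2 - φ y.1 b zl.2)) fun _ => 0
  | .inr (a, j) => Sum.elim (fun zl => if zl.1 ≤ j then -φ y.1 a zl.2 else 0) fun _ => y.2

/-- The parameter of the linear function with weights `w`. -/
def labelParam (w : Fin M → EuclideanSpace ℝ (Fin d)) : (Fin M × Fin d) ⊕ Unit → ℝ :=
  Sum.elim (fun zl => w zl.1 zl.2) fun _ => 1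

theorem labelForm_inl (φ : 𝒳 → 𝒜 → EuclideanSpace ℝ (Fin d)) (y : 𝒳 × ℝ) (a b : 𝒜)
    (w : Fin M → EuclideanSpace ℝ (Fin d)) : labelForm M φ y (.inl (a, b)) ⬝ᵥ labelParam w =
      mean (fun z => inner ℝ (φ y.1 a) (w z)) - mean fun z => inner ℝ (φ y.1 b) (w z) := by
  simp only [labelForm, labelParam, dotProduct, Fintype.sum_sum_type, Sum.elim_inl, Sum.elim_inr,
    Fintype.sum_prod_type, mean, PiLp.inner_apply, RCLike.inner_apply, conj_trivial]
  simp only [zero_mul, Finset.sum_const_zero, add_zero, Finset.sum_mul,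
    ← Finset.sum_sub_distrib]
  exact Finset.sum_congr rfl fun z _ => Finset.sum_congr rfl fun l _ => by ring

theorem labelForm_inr (φ : 𝒳 → 𝒜 → EuclideanSpace ℝ (Fin d)) (y : 𝒳 × ℝ) (a : 𝒜) (j : Fin M)
    (w : Fin M → EuclideanSpace ℝ (Fin d)) : labelForm M φ y (.inr (a, j)) ⬝ᵥ labelParam w =
      y.2 - ∑ z ∈ Iic j, inner ℝ (φ y.1 a) (w z) := by
  have : ∀ z, (∑ l, (if z ≤ j then -φ y.1 a l else 0) * w z l) =
      if z ≤ j then -inner ℝ (φ y.1 a) (w z) else 0 := fun z => by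
    split_ifs
    · simp [PiLp.inner_apply, mul_comm]
    · simp
  simp only [labelForm, labelParam, dotProduct, Fintype.sum_sum_type, Sum.elim_inl, Sum.elim_inr,
    Fintype.sum_prod_type, this]
  rw [← Finset.sum_filter, Finset.sum_neg_distrib]
  have h2 : univ.filter (fun z => z ≤ j) = Iic j := by ext; simp
  rw [h2]
  simp
  ring

/-- Equal comparisons of means give the same greedy action, and equal comparisons of the seed with
the partial sums at that action give the same quantile. The weights themselves may be far apart. -/
theorem quantile_greedyDist_congr {φ : 𝒳 → 𝒜 → EuclideanSpace ℝ (Fin d)} {f f' : 𝒳 → 𝒜 → Fin M → ℝ}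
    {w w' : Fin M → EuclideanSpace ℝ (Fin d)} (hf : ∀ x a z, f x a z = inner ℝ (φ x a) (w z))
    (hf' : ∀ x a z, f' x a z = inner ℝ (φ x a) (w' z)) {y : 𝒳 × ℝ}
    (h : SameSigns (labelForm M φ y) (labelParam w) (labelParam w')) :
    quantile (greedyDist f y.1) y.2 = quantile (greedyDist f' y.1) y.2 := by
  have hg : greedyAction f y.1 = greedyAction f' y.1 := by
    refine argmin_congr fun a b => ?_
    have := h (.inl (a, b))
    rw [labelForm_inl, labelForm_inl, sub_pos, sub_pos] at this
    rw [← not_lt, ← not_lt, not_iff_not]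
    simp only [← hf, ← hf'] at this
    exact this
  unfold quantile greedyDist
  rw [hg]
  congr 1
  ext j
  have := h (.inr (greedyAction f' y.1, j))
  rw [labelForm_inr, labelForm_inr, sub_pos, sub_pos] at this
  simpa [hf, hf'] using this

theorem measurable_labelForm [MeasurableSpace 𝒳] [MeasurableSpace 𝒜]
    {φ : 𝒳 → 𝒜 → EuclideanSpace ℝ (Fin d)} (hφ : Measurable fun y : 𝒳 × 𝒜 => φ y.1 y.2)
    (t : (𝒜 × 𝒜) ⊕ (𝒜 × Fin M)) (i : (Fin M × Fin d) ⊕ Unit) :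
    Measurable fun y : 𝒳 × ℝ => labelForm M φ y t i := by
  have h1 : ∀ a l, Measurable fun y : 𝒳 × ℝ => φ y.1 a l := fun a l =>
    (EuclideanSpace.proj (𝕜 := ℝ) l).continuous.measurable.comp
      (hφ.comp (by fun_prop : Measurable fun y : 𝒳 × ℝ => (y.1, a)))
  rcases t with ⟨a, b⟩ | ⟨a, j⟩ <;> rcases i with ⟨z, l⟩ | u
  · exact ((h1 a l).sub (h1 b l)).const_mul _
  · exact measurable_const
  · simp only [labelForm, Sum.elim_inl]
    split_ifs
    · exact (h1 a l).neg
    · exact measurable_const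
  · exact measurable_snd

end Labels

end

end DistRL

namespace DistRL

noncomputable section

set_option linter.unusedSectionVars false

/-! ### Likelihood ratios and optimism of the confidence sets. -/

section Likelihood

variable {𝒳 𝒜 : Type*} [Fintype 𝒜] [LinearOrder 𝒜] [Nonempty 𝒜] {H M : ℕ} {ι : Type*}

theorem logLik_eq_log_prod (f : Fin H → 𝒳 → 𝒜 → Fin M → ℝ) (g : 𝒳 → 𝒜 → Fin M → ℝ) (h : Fin H)
    (I : Finset ι) (D : ι → Fin H → Sample 𝒳 𝒜 M) : logLik f g h I D = ENNReal.log
      (∏ i ∈ I, ENNReal.ofReal (g (D i h).1.1.1 (D i h).1.1.2 (nextTarget (nextDist f h) (D i h)))) := by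
  classical
  unfold logLik
  induction I using Finset.induction_on with
  | empty => simp
  | insert i I hi ih =>
    rw [Finset.sum_insert hi, Finset.prod_insert hi, ENNReal.log_mul_add, ih]
    rfl

/-- Exponentiation replaces log-likelihoods, which may be `-∞`, by products in `ℝ≥0∞`, the form in
which supermartingales are handled. -/
theorem mem_confSet_iff {F : Set (𝒳 → 𝒜 → Fin M → ℝ)} {τ : ℝ} {I : Finset ι}
    {D : ι → Fin H → Sample 𝒳 𝒜 M} {f : Fin H → 𝒳 → 𝒜 → Fin M → ℝ} :
    f ∈ confSet H F τ I D ↔ (∀ h, f h ∈ F) ∧ ∀ h, ∀ g ∈ F,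
      ∏ i ∈ I, ENNReal.ofReal
        (g (D i h).1.1.1 (D i h).1.1.2 (nextTarget (nextDist f h) (D i h))) ≤
      ENNReal.ofReal (Real.exp τ) * ∏ i ∈ I, ENNReal.ofReal
        (f h (D i h).1.1.1 (D i h).1.1.2 (nextTarget (nextDist f h) (D i h))) := by
  unfold confSet
  simp only [Set.mem_ofPred_eq, logLik_eq_log_prod]
  refine and_congr_right fun _ => forall_congr' fun h => forall₂_congr fun g _ => ?_
  rw [EReal.sub_le_iff_le_add (.inl (EReal.coe_ne_bot τ)) (.inl (EReal.coe_ne_top τ)),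
    ← ENNReal.log_le_log_iff, ENNReal.log_mul_add, ENNReal.log_ofReal_of_pos (Real.exp_pos τ),
    Real.log_exp, add_comm]

end Likelihood

section Run

variable {𝒳 𝒜 : Type*} [MeasurableSpace 𝒳] [MeasurableSpace 𝒜] [MeasurableSingletonClass 𝒜]
  [Fintype 𝒜] [LinearOrder 𝒜] [Nonempty 𝒜] {H M d K : ℕ} [NeZero H] {mdp : MDP 𝒳 𝒜 H M}
  {φs : Fin H → 𝒳 → 𝒜 → EuclideanSpace ℝ (Fin d)}
  {Φ : Finset (𝒳 → 𝒜 → EuclideanSpace ℝ (Fin d))} {τ : ℝ}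
  {Ω : Type*} {mΩ : MeasurableSpace Ω} {P : Measure Ω}
  {ℱ : Filtration (Fin K) mΩ} {f : Fin K → Ω → Fin H → 𝒳 → 𝒜 → Fin M → ℝ}
  {D : Fin K → Fin H → Ω → Sample 𝒳 𝒜 M}

theorem IsODiscoRun.ae_isCondDist (hrun : IsODiscoRun mdp (linClass Φ M) τ P ℱ f D)
    (hΦ : ∀ φ ∈ Φ, Measurable fun y : 𝒳 × 𝒜 => φ y.1 y.2) :
    ∀ᵐ ω ∂P, ∀ k h, IsCondDist (f k ω h) :=
  ae_all_iff.2 fun k => (hrun.mem_confSet k).mono fun _ hω h =>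
    isCondDist_of_mem_linClass hΦ (hω.1 h)

theorem IsODiscoRun.isCondLaw (hrun : IsODiscoRun mdp (linClass Φ M) τ P ℱ f D)
    (hΦ : ∀ φ ∈ Φ, Measurable fun y : 𝒳 × 𝒜 => φ y.1 y.2) (h : Fin H) :
    IsCondLaw P ℱ (fun k => D k h) fun k ω => mdp.uaeLaw (greedyPolicy (f k ω)) h where
  measurable k := hrun.measurable_data k h
  adapted i k hik := hrun.adapted_data i k hik h
  finite k := (hrun.ae_isCondDist hΦ).mono fun ω hω => by
    have := mdp.isProbabilityMeasure_uaeLaw (isMeasurable_greedyPolicy (hω k)) h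
    infer_instance
  law k := hrun.law_data k h

variable [IsProbabilityMeasure P]

/-- Likelihood ratios of conditional weights against the Bellman backup are supermartingales. -/
theorem lintegral_prod_nextTarget_le {h : Fin H}
    (hs : IsCondLaw P ℱ (fun k => D k h) fun k ω => mdp.uaeLaw (greedyPolicy (f k ω)) h)
    (hf : ∀ᵐ ω ∂P, ∀ k h, IsCondDist (f k ω h)) {q : 𝒳 → Fin M → ℝ} (hq : IsNextDist q)
    {G : 𝒳 → 𝒜 → Fin M → ℝ≥0∞} (hG : ∀ z, Measurable fun y : 𝒳 × 𝒜 => G y.1 y.2 z) {C : ℝ≥0∞}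
    (hC : ∀ x a, ∑ z, ENNReal.ofReal (backup (mdp.step h) q x a z) * G x a z ≤ C)
    (J : Finset (Fin K)) :
    ∫⁻ ω, ∏ i ∈ J, G (D i h ω).1.1.1 (D i h ω).1.1.2 (nextTarget q (D i h ω)) ∂P ≤ C ^ #J := by
  have hF := measurable_comp_nextTarget hq hG
  choose G' h1 h2 h3 using fun k => hs.exists_lintegral k hF
  have h4 := lintegral_prod_le hs.measurable hs.adapted (fun _ => hF) (G := G')
    (W := fun _ _ => 1) (fun k => measurable_const) h3 (C := fun _ => C) (fun k => by
      filter_upwards [h2 k, hf] with ω e1 e2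
      have hπ := isMeasurable_greedyPolicy (e2 k)
      have := mdp.isProbabilityMeasure_stateLaw hπ h
      rw [mul_one, e1, mdp.lintegral_uaeLaw_nextTarget hπ h hq hG]
      calc _ ≤ ∫⁻ _x, C ∂(mdp.stateLaw (greedyPolicy (f k ω)) h) := by
            refine lintegral_mono fun x => ?_
            refine (mul_le_mul_right (Finset.sum_le_sum fun a _ => hC x a) _).trans_eq ?_
            rw [Finset.sum_const, Finset.card_univ, nsmul_eq_mul, ← mul_assoc,
              ENNReal.inv_mul_cancel (by simp) (by simp), one_mul]
        _ = C := by simp) J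
  simpa using h4

theorem measure_exists_le {ι : Type*} [Fintype ι] {F : ι → Ω → ℝ≥0∞}
    (hF : ∀ i, AEMeasurable (F i) P) {C t : ℝ≥0∞} (hC : ∀ i, ∫⁻ ω, F i ω ∂P ≤ C) (ht : t ≠ 0)
    (ht' : t ≠ ∞) : P {ω | ∃ i, t ≤ F i ω} ≤ Fintype.card ι * (C / t) := by
  have : {ω | ∃ i, t ≤ F i ω} = ⋃ i, {ω | t ≤ F i ω} := by ext; simp
  rw [this]
  refine (measure_iUnion_fintype_le _ _).trans ?_
  calc ∑ i, P {ω | t ≤ F i ω} ≤ ∑ _i : ι, C / t := Finset.sum_le_sum fun i _ =>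
        (meas_ge_le_lintegral_div (hF i) ht ht').trans (ENNReal.div_le_div_right (hC i) t)
    _ = _ := by simp

/-- With high probability the optimal distributional value function is in all confidence sets. -/
theorem IsODiscoRun.measure_optCondDist_notMem_le [NeZero M] (hr : mdp.IsLowRank φs)
    (hreal : ∀ h, φs h ∈ Φ) (hΦ : ∀ φ ∈ Φ, Measurable fun y : 𝒳 × 𝒜 => φ y.1 y.2)
    (hrun : IsODiscoRun mdp (linClass Φ M) τ P ℱ f D) {N : ℕ} (hN : 0 < N) {δ : ℝ}
    (hτ : (H * K * (#Φ * (4 * N + 1) ^ (d * M)) : ℝ) * (1 + 2 * M * (d / N)) ^ K ≤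
      δ * Real.exp τ) :
    P {ω | ∃ k : Fin K, mdp.optCondDist ∉
      confSet H (linClass Φ M) τ (Iio k) (fun i h => D i h ω)} ≤ ENNReal.ofReal δ := by
  classical
  obtain ⟨𝒩, hcard, h𝒩, hnet⟩ := exists_upper_net (M := M) hΦ hN
  have hfm := hrun.ae_isCondDist hΦ
  have hs := fun h => hrun.isCondLaw hΦ h
  have hstep := mdp.markov
  set ε : ℝ := d / N with hε
  have hε0 : 0 ≤ ε := by positivity
  let q : Fin H → 𝒳 → Fin M → ℝ := fun h => nextDist mdp.optCondDist h
  have hq : ∀ h, IsNextDist (q h) := fun h => by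
    simp only [q, nextDist_eq_curDist]; exact isNextDist_curDist mdp.isCondDist_optCondDist _
  have hopt : ∀ h, mdp.optCondDist h = backup (mdp.step h) (q h) := mdp.optCondDist_eq
  have hom : ∀ h z, Measurable fun y : 𝒳 × 𝒜 => mdp.optCondDist h y.1 y.2 z := fun h z => by
    rw [hopt]; exact measurable_backup _ (hq h) z
  have hop : ∀ h x a, mdp.optCondDist h x a ∈ stdSimplex ℝ (Fin M) := fun h x a => by
    rw [hopt]; exact backup_mem _ (hq h) x a
  -- Here the labels come from a fixed function and `optCondDist h` is their conditional law, so the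
  -- ratio of a bracket to it has conditional mean at most the mass of the bracket.
  let G : Fin H → (𝒳 → 𝒜 → Fin M → ℝ) → 𝒳 → 𝒜 → Fin M → ℝ≥0∞ := fun h g x a z =>
    ENNReal.ofReal (g x a z) / ENNReal.ofReal (mdp.optCondDist h x a z)
  have hGm : ∀ h, ∀ g ∈ 𝒩, ∀ z, Measurable fun y : 𝒳 × 𝒜 => G h g y.1 y.2 z := fun h g hg z =>
    ((h𝒩 g hg).1 z).ennreal_ofReal.div (hom h z).ennreal_ofReal
  have hGC : ∀ h, ∀ g ∈ 𝒩, ∀ x a, ∑ z, ENNReal.ofReal (backup (mdp.step h) (q h) x a z) *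
      G h g x a z ≤ ENNReal.ofReal (1 + 2 * M * ε) := fun h g hg x a => by
    obtain ⟨-, hg0, f', hf', hgf⟩ := h𝒩 g hg
    rw [← hopt]
    calc _ ≤ ∑ z, ENNReal.ofReal (g x a z) := Finset.sum_le_sum fun z _ => ENNReal.mul_div_le
      _ ≤ ∑ z, ENNReal.ofReal (f' x a z + 2 * ε) :=
          Finset.sum_le_sum fun z _ => ENNReal.ofReal_le_ofReal (hgf x a z)
      _ = ENNReal.ofReal (1 + 2 * M * ε) := by
          rw [← ENNReal.ofReal_sum_of_nonneg fun z _ =>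
            add_nonneg ((hf'.1 x a).1 z) (by positivity), Finset.sum_add_distrib, (hf'.1 x a).2]
          congr 1
          simp
          ring
  have hC1 : (1 : ℝ≥0∞) ≤ ENNReal.ofReal (1 + 2 * M * ε) := by
    rw [← ENNReal.ofReal_one]; exact ENNReal.ofReal_le_ofReal (by
      have : 0 ≤ 2 * M * ε := by positivity
      linarith)
  let Pr : Fin H × Fin K × 𝒩 → Ω → ℝ≥0∞ := fun j ω => ∏ i ∈ Iio j.2.1,
    G j.1 j.2.2 (D i j.1 ω).1.1.1 (D i j.1 ω).1.1.2 (nextTarget (q j.1) (D i j.1 ω))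
  have hPr : ∀ j, ∫⁻ ω, Pr j ω ∂P ≤ ENNReal.ofReal (1 + 2 * M * ε) ^ K := fun j => by
    refine (lintegral_prod_nextTarget_le (hs j.1) hfm (hq j.1) (hGm j.1 _ j.2.2.2)
      (hGC j.1 _ j.2.2.2) _).trans (pow_le_pow_right₀ hC1 ?_)
    simp [j.2.1.isLt.le]
  have hPrm : ∀ j, Measurable (Pr j) := fun j => Finset.measurable_fun_prod _ fun i _ =>
    (measurable_comp_nextTarget (hq j.1) (hGm j.1 _ j.2.2.2)).comp (hrun.measurable_data i j.1)
  have hbad := measure_exists_le (fun j => (hPrm j).aemeasurable) hPr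
    (t := ENNReal.ofReal (Real.exp τ)) (by simp [Real.exp_pos]) ENNReal.ofReal_ne_top
  -- Almost surely no label has probability zero under the true law, so the denominators can be
  -- multiplied back.
  have hpos : ∀ᵐ ω ∂P, ∀ h k, mdp.optCondDist h (D k h ω).1.1.1 (D k h ω).1.1.2
      (nextTarget (q h) (D k h ω)) ≠ 0 := by
    refine ae_all_iff.2 fun h => ae_all_iff.2 fun k => ?_
    let Z : 𝒳 → 𝒜 → Fin M → ℝ≥0∞ := fun x a z => if mdp.optCondDist h x a z = 0 then 1 else 0
    have hZm : ∀ z, Measurable fun y : 𝒳 × 𝒜 => Z y.1 y.2 z := fun z =>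
      Measurable.ite (hom h z (measurableSet_singleton 0)) measurable_const measurable_const
    have hZ := lintegral_prod_nextTarget_le (hs h) hfm (hq h) hZm (C := 0) (fun x a => by
      rw [← hopt]
      refine (Finset.sum_eq_zero fun z _ => ?_).le
      by_cases h0 : mdp.optCondDist h x a z = 0 <;> simp [Z, h0]) {k}
    have hZm2 : Measurable fun ω => Z (D k h ω).1.1.1 (D k h ω).1.1.2 (nextTarget (q h) (D k h ω)) :=
      (measurable_comp_nextTarget (hq h) hZm).comp (hrun.measurable_data k h)
    simp only [Finset.prod_singleton, Finset.card_singleton, pow_one, nonpos_iff_eq_zero] at hZ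
    rw [lintegral_eq_zero_iff hZm2] at hZ
    filter_upwards [hZ] with ω hω h0
    simp [Z, h0] at hω
  have hsub : ∀ᵐ ω ∂P, ω ∈ {ω | ∃ k : Fin K, mdp.optCondDist ∉
      confSet H (linClass Φ M) τ (Iio k) (fun i h => D i h ω)} →
      ω ∈ {ω | ∃ j, ENNReal.ofReal (Real.exp τ) ≤ Pr j ω} := by
    filter_upwards [hpos] with ω hω
    rintro ⟨k, hk⟩
    by_contra hcon
    simp only [not_exists, not_le] at hcon
    refine hk (mem_confSet_iff.2 ⟨fun h => ?_, fun h g hg => ?_⟩)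
    · have := hr.backup_mem_linClass hreal h (hq h) (η := 0) (by simp)
      rw [hopt]
      simpa using this
    · obtain ⟨g', hg', hgg'⟩ := hnet g hg
      have h1 := (hcon (h, k, ⟨g', hg'⟩)).le
      refine le_trans ?_ (mul_le_mul_left h1 _)
      simp only [Pr, G]
      rw [← Finset.prod_mul_distrib]
      refine Finset.prod_le_prod' fun i _ => ?_
      rw [ENNReal.div_mul_cancel]
      · exact ENNReal.ofReal_le_ofReal (hgg' _ _ _).1
      · have := lt_of_le_of_ne ((hop h _ _).1 _) (hω h i).symm
        simpa using this
      · exact ENNReal.ofReal_ne_top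
  refine (measure_mono_ae hsub).trans (hbad.trans ?_)
  rw [← ENNReal.ofReal_pow (by positivity), ← ENNReal.ofReal_div_of_pos (Real.exp_pos τ),
    ← ENNReal.ofReal_natCast, ← ENNReal.ofReal_mul (by positivity)]
  refine ENNReal.ofReal_le_ofReal ?_
  rw [← mul_div_assoc, div_le_iff₀ (Real.exp_pos τ)]
  refine le_trans ?_ hτ
  gcongr
  simp only [Fintype.card_prod, Fintype.card_fin, Fintype.card_coe]
  rw [mul_assoc]
  push_cast
  have : (#𝒩 : ℝ) ≤ #Φ * (4 * N + 1) ^ (d * M) := by exact_mod_cast hcard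
  gcongr

end Run

end

end DistRL

namespace DistRL

noncomputable section

set_option linter.unusedSectionVars false

/-! ### A finite cover of the label functions, valid on the adaptive data. -/

section Stability

variable {𝒳 𝒜 : Type*} [MeasurableSpace 𝒳] [MeasurableSpace 𝒜] {M : ℕ}

/-- Backups of next-state distributions whose quantiles rarely differ are close. -/
theorem sum_abs_backup_sub_le (κ : Kernel (𝒳 × 𝒜) (Fin M × 𝒳)) [IsMarkovKernel κ]
    {q q₀ : 𝒳 → Fin M → ℝ} (hq : IsNextDist q) (hq₀ : IsNextDist q₀) {E : Set (𝒳 × ℝ)}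
    (hE : MeasurableSet E) (h : ∀ y ∉ E, quantile (q y.1) y.2 = quantile (q₀ y.1) y.2)
    {ν : Measure (Fin M × 𝒳)} [IsProbabilityMeasure ν] {c : ℝ≥0∞} (hc : c ≠ ∞) {x : 𝒳} {a : 𝒜}
    (hν : κ (x, a) ≤ c • ν) :
    ∑ z, |backup κ q x a z - backup κ q₀ x a z| ≤
      2 * (c.toReal * ((ν.map Prod.snd).prod (volume.restrict (Set.Icc (0 : ℝ) 1))).real E) := by
  have hU : IsProbabilityMeasure (volume.restrict (Set.Icc (0 : ℝ) 1)) := ⟨by simp⟩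
  have hν' : IsProbabilityMeasure (ν.map Prod.snd) :=
    Measure.isProbabilityMeasure_map (by fun_prop)
  -- Both backups are laws of targets built from the same transition and the same seed. Under this
  -- coupling they coincide off `E`.
  set μ := (κ (x, a)).prod (volume.restrict (Set.Icc (0 : ℝ) 1)) with hμ
  let t : (𝒳 → Fin M → ℝ) → (Fin M × 𝒳) × ℝ → Fin M := fun q y =>
    cappedAdd y.1.1 (quantile (q y.1.2) y.2)
  have htm : ∀ {q}, IsNextDist q → Measurable (t q) := fun {q} hq => by
    have h1 : Measurable fun y : (Fin M × 𝒳) × ℝ => (y.1.1, quantile (q y.1.2) y.2) :=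
      Measurable.prodMk (by fun_prop) (measurable_quantile
        (fun z => (hq.measurable z).comp (by fun_prop)) (by fun_prop))
    exact (measurable_of_countable fun y : Fin M × ℕ => cappedAdd y.1 y.2).comp h1
  have hb : ∀ {q}, IsNextDist q → ∀ z, backup κ q x a z = μ.real (t q ⁻¹' {z}) := fun {q} hq z => by
    have h1 := lintegral_nextTarget κ hq x a (Pi.single z 1)
    have h2 : ∑ z', ENNReal.ofReal (backup κ q x a z') * (Pi.single z 1 : Fin M → ℝ≥0∞) z' =
        ENNReal.ofReal (backup κ q x a z) := by
      rw [Finset.sum_eq_single z] <;> simp +contextual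
    have hmz := htm hq (measurableSet_singleton z)
    have h3 : μ (t q ⁻¹' {z}) = ENNReal.ofReal (backup κ q x a z) := by
      rw [← h2, ← h1, ← lintegral_indicator_one hmz, hμ,
        lintegral_prod _ (measurable_one.indicator hmz).aemeasurable]
      refine lintegral_congr fun cx => lintegral_congr fun u => ?_
      by_cases hz : t q (cx, u) = z
      · rw [Set.indicator_of_mem (by exact hz)]
        simp only [t] at hz
        rw [hz]; simp
      · rw [Set.indicator_of_notMem (by exact hz)]
        simp only [t] at hz
        rw [Pi.single_eq_of_ne hz]
    rw [Measure.real, h3, ENNReal.toReal_ofReal ((backup_mem κ hq x a).1 z)]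
  let E' : Set ((Fin M × 𝒳) × ℝ) := (fun y => (y.1.2, y.2)) ⁻¹' E
  have hE' : MeasurableSet E' := hE.preimage (by fun_prop)
  have hsum : ∀ {q}, IsNextDist q → ∑ z, μ.real (t q ⁻¹' {z} ∩ E') = μ.real E' := fun {q} hq => by
    have h1 := sum_measureReal_preimage_singleton (μ := μ.restrict E') (univ : Finset (Fin M))
      (f := t q) fun z _ => htm hq (measurableSet_singleton z)
    simp only [Finset.coe_univ, Set.preimage_univ, measureReal_restrict_apply_univ] at h1
    rw [← h1]
    exact Finset.sum_congr rfl fun z _ =>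
      (measureReal_restrict_apply (htm hq (measurableSet_singleton z))).symm
  have hdiff : ∀ z, t q ⁻¹' {z} \ E' = t q₀ ⁻¹' {z} \ E' := fun z => by
    ext y
    refine and_congr_left fun hy => ?_
    have := h (y.1.2, y.2) hy
    simp only [Set.mem_preimage, Set.mem_singleton_iff, t]
    rw [this]
  have h1 : ∑ z, |backup κ q x a z - backup κ q₀ x a z| ≤ 2 * μ.real E' := by
    calc _ ≤ ∑ z, (μ.real (t q ⁻¹' {z} ∩ E') + μ.real (t q₀ ⁻¹' {z} ∩ E')) := by
          refine Finset.sum_le_sum fun z _ => ?_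
          rw [hb hq, hb hq₀, ← measureReal_inter_add_sdiff (s := t q ⁻¹' {z}) hE',
            ← measureReal_inter_add_sdiff (s := t q₀ ⁻¹' {z}) hE', hdiff, add_sub_add_right_eq_sub]
          have h2 : 0 ≤ μ.real (t q ⁻¹' {z} ∩ E') := measureReal_nonneg
          have h3 : 0 ≤ μ.real (t q₀ ⁻¹' {z} ∩ E') := measureReal_nonneg
          exact abs_sub_le_iff.2 ⟨by linarith, by linarith⟩
      _ = 2 * μ.real E' := by rw [Finset.sum_add_distrib, hsum hq, hsum hq₀, two_mul]
  refine h1.trans (mul_le_mul_of_nonneg_left ?_ (by norm_num))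
  have h2 : μ E' ≤ c * ((ν.map Prod.snd).prod (volume.restrict (Set.Icc (0 : ℝ) 1))) E := by
    rw [hμ, Measure.prod_apply hE', Measure.prod_apply hE,
      lintegral_map (measurable_measure_prodMk_left hE) measurable_snd]
    refine (lintegral_mono' hν le_rfl).trans_eq ?_
    rw [lintegral_smul_measure, smul_eq_mul]
    rfl
  rw [Measure.real, Measure.real, ← ENNReal.toReal_mul]
  exact ENNReal.toReal_mono (ENNReal.mul_ne_top hc (measure_ne_top _ _)) h2

end Stability

section Cover

variable {𝒳 𝒜 : Type*} [MeasurableSpace 𝒳] [MeasurableSpace 𝒜] [MeasurableSingletonClass 𝒜]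
  [Fintype 𝒜] [LinearOrder 𝒜] [Nonempty 𝒜] {H M d K : ℕ} [NeZero H] [NeZero M] {mdp : MDP 𝒳 𝒜 H M}
  {φs : Fin H → 𝒳 → 𝒜 → EuclideanSpace ℝ (Fin d)}
  {Φ : Finset (𝒳 → 𝒜 → EuclideanSpace ℝ (Fin d))} {τ : ℝ}
  {Ω : Type*} {mΩ : MeasurableSpace Ω} {P : Measure Ω} [IsProbabilityMeasure P]
  {ℱ : Filtration (Fin K) mΩ} {f : Fin K → Ω → Fin H → 𝒳 → 𝒜 → Fin M → ℝ}
  {D : Fin K → Fin H → Ω → Sample 𝒳 𝒜 M}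

/-- `q` is approximated by `q₀`: their backups are close, and their samples differ for few of the
tuples `s`. -/
def IsApprox (κ : Kernel (𝒳 × 𝒜) (Fin M × 𝒳)) (s : Fin K → Sample 𝒳 𝒜 M) (y : ℝ) (m : ℕ)
    (q q₀ : 𝒳 → Fin M → ℝ) : Prop :=
  (∀ x a, ∑ z, |backup κ q x a z - backup κ q₀ x a z| ≤ y) ∧
    #{i | nextTarget q (s i) ≠ nextTarget q₀ (s i)} ≤ m

/-- The bound `b` on the probability that two parameters that agree on the ghost sample disagree
on `m` fresh points. -/
def ghostBound (n m T I : ℕ) : ℝ := (((n + m) * T + 1) ^ (2 * I) : ℕ) / ((n + m).choose m : ℕ)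

open Classical in
/-- A finite cover of the greedy next-state distributions of the linear class, with high probability
valid for all of them simultaneously. -/
theorem IsODiscoRun.exists_cover (hr : mdp.IsLowRank φs) (hd : 0 < d)
    (hreal : ∀ h, φs h ∈ Φ) (hΦ : ∀ φ ∈ Φ, Measurable fun y : 𝒳 × 𝒜 => φ y.1 y.2)
    (hrun : IsODiscoRun mdp (linClass Φ M) τ P ℱ f D) (h : Fin H) {n m T I : ℕ}
    (hT : T = Fintype.card ((𝒜 × 𝒜) ⊕ (𝒜 × Fin M))) (hI : I = d * M + 1) {ρ δ : ℝ} (hm : m ≠ 0)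
    (hρ0 : 0 ≤ ρ) (hρ : ghostBound n m T I ≤ ρ ^ m)
    (hδ : #Φ * (K * (2 * d)) ^ m * ghostBound n m T I ≤ δ) :
    ∃ 𝒬 : Finset (𝒳 → Fin M → ℝ), (∀ q ∈ 𝒬, IsNextDist q) ∧ #𝒬 ≤ #Φ * (n * T + 1) ^ I ∧
      P {ω | ∃ f : Fin H → 𝒳 → 𝒜 → Fin M → ℝ, (∀ h, f h ∈ linClass Φ M) ∧ ∀ q₀ ∈ 𝒬,
        ¬ IsApprox (mdp.step h) (fun i => D i h ω) (4 * d * ρ) m (nextDist f h) q₀} ≤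
        ENNReal.ofReal δ := by
  have hstep := mdp.markov h
  have hne : Nonempty 𝒳 := ⟨mdp.x₁⟩
  have hb0 : 0 ≤ ghostBound n m T I := by unfold ghostBound; positivity
  by_cases hh : (h : ℕ) + 1 < H
  swap
  -- At the last step the targets do not depend on the candidate, and one element covers.
  · refine ⟨{fun _ => diracZero M}, by simpa using isNextDist_diracZero, ?_, ?_⟩
    · rw [Finset.card_singleton]
      exact Nat.mul_pos (Finset.card_pos.2 ⟨_, hreal h⟩) (by positivity)
    · refine (measure_mono_null (fun ω hω => ?_) (measure_empty (μ := P))).trans_le zero_le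
      obtain ⟨f, -, hf⟩ := hω
      exfalso
      refine hf _ (Finset.mem_singleton_self _) ?_
      have : nextDist f h = fun _ => diracZero M := by
        funext x; unfold nextDist; simp only [hh, dite_false]; rfl
      rw [this]
      exact ⟨fun x a => by simp; positivity, by simp⟩
  obtain ⟨ν, hνp, hν⟩ := hr.exists_dominating hd h
  set U := volume.restrict (Set.Icc (0 : ℝ) 1) with hUdef
  have hU : IsProbabilityMeasure U := ⟨by simp [hUdef]⟩
  have hν1 : IsProbabilityMeasure (ν.map Prod.snd) :=
    Measure.isProbabilityMeasure_map (by fun_prop)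
  set ν' := (ν.map Prod.snd).prod U with hν'
  have hcardI : Fintype.card ((Fin M × Fin d) ⊕ Unit) = I := by
    simp [hI, mul_comm]
  choose! p hpm hp using fun φ (hφ : φ ∈ Φ) => exists_ghost (ν := ν')
    (ℓ := labelForm M φ) (measurable_labelForm (hΦ φ hφ)) n m
  -- Representatives are sought among parameters that define genuine distributions, so that their
  -- backups are distributions too.
  let V : (𝒳 → 𝒜 → EuclideanSpace ℝ (Fin d)) → Set ((Fin M × Fin d) ⊕ Unit → ℝ) := fun φ =>
    {v | ∃ w : Fin M → EuclideanSpace ℝ (Fin d), v = labelParam w ∧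
      ∀ x a, (fun z => inner ℝ (φ x a) (w z)) ∈ stdSimplex ℝ (Fin M)}
  choose R hRV hRc hR using fun φ => exists_representatives
    (fun x : Fin n × ((𝒜 × 𝒜) ⊕ (𝒜 × Fin M)) => labelForm M φ (p φ x.1) x.2) (V φ)
  let L : (𝒳 → 𝒜 → EuclideanSpace ℝ (Fin d)) → ((Fin M × Fin d) ⊕ Unit → ℝ) →
      𝒳 → 𝒜 → Fin M → ℝ := fun φ v x a z => ∑ l, φ x a l * v (.inl (z, l))
  have hL : ∀ φ w x a z, L φ (labelParam w) x a z = inner ℝ (φ x a) (w z) := fun φ w x a z => by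
    simp [L, labelParam, PiLp.inner_apply, mul_comm]
  have hLc : ∀ φ ∈ Φ, ∀ v ∈ V φ, IsCondDist (L φ v) := by
    rintro φ hφ v ⟨w, rfl, hw⟩
    refine ⟨fun x a => ?_, fun a z => ?_⟩
    · have : L φ (labelParam w) x a = fun z => inner ℝ (φ x a) (w z) := funext fun z => hL _ _ _ _ _
      rw [this]; exact hw x a
    · simp only [hL]
      exact ((hΦ φ hφ).comp (by fun_prop : Measurable fun x : 𝒳 => (x, a))).inner measurable_const
  let 𝒬 : Finset (𝒳 → Fin M → ℝ) := Φ.biUnion fun φ => (R φ).image fun v => greedyDist (L φ v)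
  let Y : Fin K → Ω → 𝒳 × ℝ := fun i ω => ((D i h ω).1.2.2, (D i h ω).2)
  let B : (𝒳 → 𝒜 → EuclideanSpace ℝ (Fin d)) → Set (Fin m → 𝒳 × ℝ) := fun φ =>
    {q | ∃ v v₀, (∀ i, SameSigns (labelForm M φ (p φ i)) v v₀) ∧
      ∀ j, ¬ SameSigns (labelForm M φ (q j)) v v₀}
  have hBb : ∀ φ ∈ Φ, (Measure.pi fun _ : Fin m => ν') (B φ) ≤
      ENNReal.ofReal (ghostBound n m T I) := fun φ hφ => by
    have h1 := hp φ hφ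
    rw [hcardI, ← hT] at h1
    have hch : 0 < (n + m).choose m := Nat.choose_pos (Nat.le_add_left _ _)
    unfold ghostBound
    rw [ENNReal.ofReal_div_of_pos (by exact_mod_cast hch), ENNReal.ofReal_natCast,
      ENNReal.ofReal_natCast]
    rwa [ENNReal.le_div_iff_mul_le (Or.inl (by exact_mod_cast hch.ne')) (Or.inl (by simp))]
  have hs := hrun.isCondLaw hΦ h
  have hfm := hrun.ae_isCondDist hΦ
  have hdom : ∀ k, ∀ᵐ ω ∂P, (mdp.uaeLaw (greedyPolicy (f k ω)) h).map
      (fun s => (s.1.2.2, s.2)) ≤ (2 * d : ℝ≥0∞) • ν' := fun k => by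
    filter_upwards [hfm] with ω hω
    exact mdp.map_uaeLaw_le (isMeasurable_greedyPolicy (hω k)) h hν
  have hd0 : (2 * d : ℝ≥0∞) ≠ 0 := by simp [hd.ne']
  have hdt : (2 * d : ℝ≥0∞) ≠ ∞ := by finiteness
  -- Some `m` distinct tuples at all of which two parameters disagree although they agree on the
  -- ghost sample. The union is over feature maps and positions only; the parameters are inside the
  -- event.
  let bad : Set Ω := ⋃ φ ∈ Φ, ⋃ e : Fin m ↪ Fin K, {ω | (fun j => Y (e j) ω) ∈ B φ}
  have hbad : P bad ≤ ENNReal.ofReal δ := by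
    refine (measure_biUnion_finset_le _ _).trans ?_
    calc ∑ φ ∈ Φ, P (⋃ e : Fin m ↪ Fin K, {ω | (fun j => Y (e j) ω) ∈ B φ})
        ≤ ∑ φ ∈ Φ, ∑ _e : Fin m ↪ Fin K, (2 * d : ℝ≥0∞) ^ m *
          ENNReal.ofReal (ghostBound n m T I) := Finset.sum_le_sum fun φ hφ => by
          refine (measure_iUnion_fintype_le _ _).trans (Finset.sum_le_sum fun e _ => ?_)
          refine (hs.measure_le_pi (g := fun s => (s.1.2.2, s.2)) (by fun_prop) hdom e.injective
            hd0 hdt (hpm φ hφ)).trans ?_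
          exact mul_le_mul_right (hBb φ hφ) _
      _ ≤ ENNReal.ofReal (#Φ * (K * (2 * d)) ^ m * ghostBound n m T I) := by
          rw [Finset.sum_const, Finset.sum_const, Finset.card_univ, Fintype.card_embedding_eq,
            Fintype.card_fin, Fintype.card_fin, nsmul_eq_mul, nsmul_eq_mul]
          have e1 : (2 * d : ℝ≥0∞) ^ m * ENNReal.ofReal (ghostBound n m T I) =
              ENNReal.ofReal ((2 * d) ^ m * ghostBound n m T I) := by
            rw [ENNReal.ofReal_mul (by positivity), ENNReal.ofReal_pow (by positivity),
              ENNReal.ofReal_mul (by norm_num), ENNReal.ofReal_natCast, ENNReal.ofReal_ofNat]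
          rw [e1, ← ENNReal.ofReal_natCast (n := K.descFactorial m), ← ENNReal.ofReal_natCast (n := #Φ),
            ← ENNReal.ofReal_mul (by positivity), ← ENNReal.ofReal_mul (by positivity)]
          refine ENNReal.ofReal_le_ofReal ?_
          have e2 : (K.descFactorial m : ℝ) ≤ K ^ m := by
            exact_mod_cast Nat.descFactorial_le_pow K m
          have e3 : #Φ * (K * (2 * d)) ^ m * ghostBound n m T I =
              #Φ * (K ^ m * ((2 * d) ^ m * ghostBound n m T I)) := by
            rw [mul_pow (K : ℝ)]; ring
          rw [e3]
          gcongr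
      _ ≤ ENNReal.ofReal δ := ENNReal.ofReal_le_ofReal hδ
  refine ⟨𝒬, fun q hq => ?_, ?_, (measure_mono fun ω hω => ?_).trans hbad⟩
  · obtain ⟨φ, hφ, hq⟩ := Finset.mem_biUnion.1 hq
    obtain ⟨v, hv, rfl⟩ := Finset.mem_image.1 hq
    exact isNextDist_greedyDist (hLc φ hφ v (hRV φ hv))
  · refine Finset.card_biUnion_le.trans ?_
    rw [← smul_eq_mul]
    refine Finset.sum_le_card_nsmul _ _ _ fun φ hφ => Finset.card_image_le.trans ?_
    have := hRc φ
    rwa [hcardI, Fintype.card_prod, Fintype.card_fin, ← hT] at this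
  · by_contra hgood
    obtain ⟨f, hf, hq⟩ := hω
    obtain ⟨hf1, φ, hφ, w, hw, hfw⟩ := hf ⟨h + 1, hh⟩
    have hnext : nextDist f h = greedyDist (f ⟨h + 1, hh⟩) := by
      funext x; unfold nextDist; simp only [hh, dite_true]; rfl
    have hvV : labelParam w ∈ V φ := ⟨w, rfl, fun x a => by
      have := hf1 x a
      have e : f ⟨h + 1, hh⟩ x a = fun z => inner ℝ (φ x a) (w z) := funext fun z => hfw x a z
      rwa [e] at this⟩
    obtain ⟨v₀, hv₀, hsame⟩ := hR φ _ hvV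
    obtain ⟨w₀, rfl, -⟩ := hRV φ hv₀
    refine hq (greedyDist (L φ (labelParam w₀))) (Finset.mem_biUnion.2
      ⟨φ, hφ, Finset.mem_image_of_mem _ hv₀⟩) ?_
    have hghost : ∀ i, SameSigns (labelForm M φ (p φ i)) (labelParam w) (labelParam w₀) :=
      fun i t => hsame (i, t)
    let E : Set (𝒳 × ℝ) := {y | ¬ SameSigns (labelForm M φ y) (labelParam w) (labelParam w₀)}
    have hE : MeasurableSet E := by
      have hlm : ∀ t v, MeasurableSet {y | 0 < labelForm M φ y t ⬝ᵥ v} := fun t v =>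
        measurableSet_lt measurable_const (Finset.measurable_fun_sum _ fun i _ =>
          (measurable_labelForm (hΦ φ hφ) t i).mul_const _)
      have : E = (⋂ t, {y | 0 < labelForm M φ y t ⬝ᵥ labelParam w ↔
          0 < labelForm M φ y t ⬝ᵥ labelParam w₀})ᶜ := by
        ext y
        rw [Set.mem_compl_iff, Set.mem_iInter]
        rfl
      rw [this]
      exact (MeasurableSet.iInter fun t => (hlm t _).iff (hlm t _)).compl
    have hlab : ∀ y ∉ E, quantile (greedyDist (f ⟨h + 1, hh⟩) y.1) y.2 =
        quantile (greedyDist (L φ (labelParam w₀)) y.1) y.2 := fun y hy =>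
      quantile_greedyDist_congr hfw (hL φ w₀) (not_not.1 hy)
    rw [hnext]
    refine ⟨fun x a => ?_, ?_⟩
    · refine (sum_abs_backup_sub_le (mdp.step h) (isNextDist_greedyDist
        (isCondDist_of_mem_linClass hΦ (hf _))) (isNextDist_greedyDist (hLc φ hφ _ (hRV φ hv₀)))
        hE hlab hdt (hν x a)).trans ?_
      -- All `m`-tuples of points of the disagreement region `E` lie in `B φ`, so the ghost bound
      -- also limits the measure of `E`, with no randomness involved.
      have h1 : ν'.real E ^ m ≤ ρ ^ m := by
        refine le_trans ?_ hρ
        have h2 : (Measure.pi fun _ : Fin m => ν') (Set.univ.pi fun _ => E) ≤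
            (Measure.pi fun _ : Fin m => ν') (B φ) :=
          measure_mono fun q hq => ⟨_, _, hghost, fun j => hq j (Set.mem_univ _)⟩
        rw [Measure.pi_pi, Finset.prod_const, Finset.card_univ, Fintype.card_fin] at h2
        have h3 := ENNReal.toReal_mono ENNReal.ofReal_ne_top (h2.trans (hBb φ hφ))
        rwa [ENNReal.toReal_pow, ENNReal.toReal_ofReal hb0] at h3
      have h2 := le_of_pow_le_pow_left₀ hm hρ0 h1
      have h3 : (2 * d : ℝ≥0∞).toReal = 2 * d := by simp
      rw [h3]
      have h4 : (0 : ℝ) ≤ d := by positivity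
      change 2 * (2 * d * ν'.real E) ≤ _
      nlinarith
    · by_contra! hcard
      have hsub : univ.filter (fun i => nextTarget (greedyDist (f ⟨h + 1, hh⟩)) (D i h ω) ≠
          nextTarget (greedyDist (L φ (labelParam w₀))) (D i h ω)) ⊆
          univ.filter fun i => Y i ω ∈ E := fun i hi => by
        simp only [Finset.mem_filter, Finset.mem_univ, true_and] at hi ⊢
        by_contra hY
        exact hi (by unfold nextTarget; rw [hlab (Y i ω) hY])
      obtain ⟨S, hS, hSm⟩ := Finset.exists_subset_card_eq
        (hcard.le.trans (Finset.card_le_card hsub))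
      refine hgood ?_
      simp only [bad, Set.mem_iUnion]
      refine ⟨φ, hφ, (S.orderEmbOfFin hSm).toEmbedding, ?_⟩
      refine ⟨_, _, hghost, fun j => ?_⟩
      have := hS (Finset.orderEmbOfFin_mem S hSm j)
      exact (Finset.mem_filter.1 this).2

end Cover

end

end DistRL

namespace DistRL

noncomputable section

set_option linter.unusedSectionVars false

/-! ### Supermartingale tail bound and the moment of square-root likelihood ratios. -/

section Tail

variable {Ω S : Type*} [MeasurableSpace S] {mΩ : MeasurableSpace Ω} {P : Measure Ω}
  {K : ℕ} {ℱ : Filtration (Fin K) mΩ} {s : Fin K → Ω → S} {κ : Fin K → Ω → Measure S}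

/-- A nonnegative factor of conditional mean `g`, multiplied by `exp (1 - g)`, has conditional mean
at most 1. -/
theorem mul_exp_one_sub_le (g : ℝ) : g * Real.exp (1 - g) ≤ 1 := by
  have h1 : g ≤ Real.exp (g - 1) := by linarith [Real.add_one_le_exp (g - 1)]
  calc g * Real.exp (1 - g) ≤ Real.exp (g - 1) * Real.exp (1 - g) := by gcongr
    _ = 1 := by rw [← Real.exp_add]; simp

/-- The multiplicative supermartingale tail bound for a finite family of weights. -/
theorem IsCondLaw.measure_exists_prod_ge_le [IsProbabilityMeasure P] (hs : IsCondLaw P ℱ s κ)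
    {ι : Type*} [Fintype ι] {F : ι → S → ℝ} (hF : ∀ i, Measurable (F i)) {B : ℝ}
    (hB : ∀ i x, F i x ∈ Set.Icc 0 B) {t : ℝ} (ht : 0 < t) :
    P {ω | ∃ (i : ι) (k : Fin K),
      t ≤ ∏ j ∈ Iio k, (F i (s j ω) * Real.exp (1 - ∫ x, F i x ∂(κ j ω)))} ≤
      ENNReal.ofReal (Fintype.card ι * K / t) := by
  choose G h1 h2 h3 using fun i k => hs.exists_lintegral k (hF i).ennreal_ofReal
  -- The compensator must be `ℱ k`-measurable, so it is built from the version `G`, which matches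
  -- the integral under `κ` only almost surely.
  let W : ι → Fin K → Ω → ℝ≥0∞ := fun i k ω => ENNReal.ofReal (Real.exp (1 - (G i k ω).toReal))
  have hW : ∀ i k, Measurable[ℱ k] (W i k) := fun i k =>
    (Real.measurable_exp.comp (measurable_const.sub (h1 i k).ennreal_toReal)).ennreal_ofReal
  have hint : ∀ i k, ∀ᵐ ω ∂P, (G i k ω).toReal = ∫ x, F i x ∂(κ k ω) := fun i k => by
    filter_upwards [h2 i k] with ω e
    rw [e, integral_eq_lintegral_of_nonneg_ae (Filter.Eventually.of_forall fun x => (hB i x).1)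
      (hF i).aestronglyMeasurable]
  have hfin : ∀ i k, ∀ᵐ ω ∂P, G i k ω ≠ ∞ := fun i k => by
    filter_upwards [h2 i k, hs.finite k] with ω e hf
    rw [e]
    refine ne_top_of_le_ne_top ?_ (lintegral_mono fun x => ENNReal.ofReal_le_ofReal (hB i x).2)
    rw [lintegral_const]
    exact ENNReal.mul_ne_top ENNReal.ofReal_ne_top (measure_ne_top _ _)
  have hC : ∀ i k, ∀ᵐ ω ∂P, G i k ω * W i k ω ≤ 1 := fun i k => by
    filter_upwards [hfin i k] with ω hω
    rw [← ENNReal.ofReal_toReal hω]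
    simp only [W]
    rw [← ENNReal.ofReal_mul ENNReal.toReal_nonneg, ← ENNReal.ofReal_one]
    exact ENNReal.ofReal_le_ofReal (mul_exp_one_sub_le _)
  let Z : ι × Fin K → Ω → ℝ≥0∞ := fun p ω =>
    ∏ j ∈ Iio p.2, (ENNReal.ofReal (F p.1 (s j ω)) * W p.1 j ω)
  have hZm : ∀ p, Measurable (Z p) := fun p => Finset.measurable_fun_prod _ fun j _ =>
    ((hF p.1).ennreal_ofReal.comp (hs.measurable j)).mul ((hW p.1 j).mono (ℱ.le j) le_rfl)
  have hZ : ∀ p, ∫⁻ ω, Z p ω ∂P ≤ 1 := fun p => by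
    refine (lintegral_prod_le hs.measurable hs.adapted (fun _ => (hF p.1).ennreal_ofReal)
      (hW p.1) (h3 p.1) (hC p.1) _).trans ?_
    simp
  have hmain := measure_exists_le (fun p => (hZm p).aemeasurable) hZ (t := ENNReal.ofReal t)
    (by simpa using ht) ENNReal.ofReal_ne_top
  have hsub : ∀ᵐ ω ∂P, ω ∈ {ω | ∃ (i : ι) (k : Fin K),
      t ≤ ∏ j ∈ Iio k, (F i (s j ω) * Real.exp (1 - ∫ x, F i x ∂(κ j ω)))} →
      ω ∈ {ω | ∃ p, ENNReal.ofReal t ≤ Z p ω} := by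
    filter_upwards [ae_all_iff.2 fun i => ae_all_iff.2 (hint i)] with ω hω
    rintro ⟨i, k, hk⟩
    refine ⟨(i, k), (ENNReal.ofReal_le_ofReal hk).trans_eq ?_⟩
    rw [ENNReal.ofReal_prod_of_nonneg fun j _ => mul_nonneg (hB i _).1 (Real.exp_pos _).le]
    refine Finset.prod_congr rfl fun j _ => ?_
    rw [ENNReal.ofReal_mul (hB i _).1]
    simp only [W, hω]
  refine (measure_mono_ae hsub).trans (hmain.trans_eq ?_)
  rw [Fintype.card_prod, Fintype.card_fin, ENNReal.ofReal_div_of_pos ht, mul_div_assoc']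
  simp [ENNReal.ofReal_mul]

end Tail

section Moment

variable {M : ℕ}

/-- Mixing with the uniform law costs a factor `1 + η`, because `(1 + η) ^ 2 * (1 - η) ≥ 1` for `0 <
η ≤ 1 / 2`. What remains is the Bhattacharyya coefficient of the bracket and `b₀`, moved to that of
`p` and `b` at a cost `√(2 * ε)` per grid point and `√y` in total, up to that factor. -/
theorem sum_mul_sqrt_div_le {p b b₀ u : Fin M → ℝ} (hp : p ∈ stdSimplex ℝ (Fin M))
    (hb : b ∈ stdSimplex ℝ (Fin M)) (hb₀ : b₀ ∈ stdSimplex ℝ (Fin M)) {ε η y : ℝ} (hε : 0 ≤ ε)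
    (hη : 0 < η) (hη' : η ≤ 1 / 2) (hu0 : ∀ z, 0 ≤ u z) (hu : ∀ z, u z ≤ p z + 2 * ε)
    (hy : ∑ z, |b z - b₀ z| ≤ y) :
    ∑ z, b₀ z * √(u z / ((1 - η) * b₀ z + η / M)) ≤
      bhatt p b + (η + 2 * (M * √(2 * ε) + √y)) := by
  have hterm : ∀ z, b₀ z * √(u z / ((1 - η) * b₀ z + η / M)) ≤
      (1 + η) * (√(p z) * √(b₀ z) + √(2 * ε)) := fun z => by
    have hM : (0 : ℝ) < M := by
      have := z.isLt
      exact_mod_cast (by omega : 0 < M)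
    have h0 := hb₀.1 z
    have h1 : b₀ z ≤ 1 := (le_abs_self _).trans (abs_le_one_of_mem hb₀ z)
    have hg : 0 < (1 - η) * b₀ z + η / M := by
      have : 0 < η / M := by positivity
      nlinarith
    have hg' : b₀ z ≤ (1 + η) ^ 2 * ((1 - η) * b₀ z + η / M) := by
      have e1 : 0 ≤ η / M := by positivity
      have e2 : 1 ≤ (1 + η) ^ 2 * (1 - η) := by
        have : 0 ≤ 1 - η - η ^ 2 := by nlinarith
        nlinarith [mul_nonneg hη.le this]
      nlinarith [mul_le_mul_of_nonneg_right e2 h0, mul_nonneg (sq_nonneg (1 + η)) e1]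
    have h2 : √(b₀ z) * √(u z / ((1 - η) * b₀ z + η / M)) ≤ (1 + η) * √(u z) := by
      rw [← Real.sqrt_mul h0]
      calc √(b₀ z * (u z / ((1 - η) * b₀ z + η / M))) ≤ √((1 + η) ^ 2 * u z) := by
            refine Real.sqrt_le_sqrt ?_
            rw [← mul_div_assoc, div_le_iff₀ hg]
            nlinarith [mul_le_mul_of_nonneg_right hg' (hu0 z)]
        _ = (1 + η) * √(u z) := by rw [Real.sqrt_mul (by positivity), Real.sqrt_sq (by linarith)]
    have h3 : √(u z) ≤ √(p z) + √(2 * ε) := by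
      refine (Real.sqrt_le_sqrt (hu z)).trans ?_
      rw [Real.sqrt_le_left (by positivity)]
      nlinarith [Real.sq_sqrt (hp.1 z), Real.sq_sqrt (by positivity : 0 ≤ 2 * ε),
        mul_nonneg (Real.sqrt_nonneg (p z)) (Real.sqrt_nonneg (2 * ε))]
    have h4 : √(b₀ z) ≤ 1 := Real.sqrt_le_one.2 h1
    have h5 : b₀ z = √(b₀ z) * √(b₀ z) := (Real.mul_self_sqrt h0).symm
    calc b₀ z * √(u z / ((1 - η) * b₀ z + η / M))
        = √(b₀ z) * (√(b₀ z) * √(u z / ((1 - η) * b₀ z + η / M))) := by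
          rw [← mul_assoc, ← h5]
      _ ≤ √(b₀ z) * ((1 + η) * (√(p z) + √(2 * ε))) :=
          mul_le_mul_of_nonneg_left (h2.trans (mul_le_mul_of_nonneg_left h3 (by linarith)))
            (Real.sqrt_nonneg _)
      _ = (1 + η) * (√(p z) * √(b₀ z) + √(b₀ z) * √(2 * ε)) := by ring
      _ ≤ (1 + η) * (√(p z) * √(b₀ z) + 1 * √(2 * ε)) := by gcongr
      _ = _ := by rw [one_mul]
  have h1 : bhatt p b₀ ≤ bhatt p b + √y := by
    refine (bhatt_le_add hp (p := b₀) (q := b)).trans ?_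
    gcongr
    refine le_trans (le_of_eq (Finset.sum_congr rfl fun z _ => ?_)) hy
    exact abs_sub_comm _ _
  calc _ ≤ ∑ z, (1 + η) * (√(p z) * √(b₀ z) + √(2 * ε)) := Finset.sum_le_sum fun z _ => hterm z
    _ = (1 + η) * (bhatt p b₀ + M * √(2 * ε)) := by
        rw [← Finset.mul_sum, Finset.sum_add_distrib, bhatt]; simp
    _ ≤ (1 + η) * (bhatt p b + √y + M * √(2 * ε)) := by gcongr
    _ ≤ _ := by
        have h2 := bhatt_le_one hp hb
        have h3 : 0 ≤ M * √(2 * ε) + √y := by positivity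
        nlinarith

end Moment

section Concentration

variable {𝒳 𝒜 : Type*} [MeasurableSpace 𝒳] [MeasurableSpace 𝒜] [MeasurableSingletonClass 𝒜]
  [Fintype 𝒜] [LinearOrder 𝒜] [Nonempty 𝒜] {H M d K : ℕ} [NeZero H] [NeZero M] {mdp : MDP 𝒳 𝒜 H M}

/-- The square root of the likelihood ratio of `u` against the smoothed backup of `q₀`. -/
def sqrtRatio (b₀ u : 𝒳 → 𝒜 → Fin M → ℝ) (η : ℝ) (x : 𝒳) (a : 𝒜) (z : Fin M) : ℝ :=
  √(u x a z / ((1 - η) * b₀ x a z + η / M))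

/-- Averaged over visited states and uniform actions, the Bhattacharyya coefficient is one minus the
exploration error. Bracketing, smoothing and passing to the representative only add the error term.
-/
theorem MDP.integral_sqrtRatio_le {f f' : Fin H → 𝒳 → 𝒜 → Fin M → ℝ} (hf : ∀ h, IsCondDist (f h))
    (hf' : ∀ h, IsCondDist (f' h)) (h : Fin H) {q₀ : 𝒳 → Fin M → ℝ} (hq₀ : IsNextDist q₀)
    {u : 𝒳 → 𝒜 → Fin M → ℝ} (hum : ∀ z, Measurable fun y : 𝒳 × 𝒜 => u y.1 y.2 z)
    {ε η y : ℝ} (hε : 0 ≤ ε) (hη : 0 < η) (hη' : η ≤ 1 / 2) (hu0 : ∀ x a z, 0 ≤ u x a z)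
    (hu : ∀ x a z, u x a z ≤ f h x a z + 2 * ε)
    (hy : ∀ x a, ∑ z, |backup (mdp.step h) (nextDist f h) x a z - backup (mdp.step h) q₀ x a z| ≤ y) :
    ∫ s : Sample 𝒳 𝒜 M, sqrtRatio (backup (mdp.step h) q₀) u η s.1.1.1 s.1.1.2 (nextTarget q₀ s)
        ∂(mdp.uaeLaw (greedyPolicy f') h) ≤
      1 - mdp.exploreErr f' f h + (η + 2 * (M * √(2 * ε) + √y)) := by
  have hstep := mdp.markov h
  have hπ := isMeasurable_greedyPolicy hf'
  have hP := mdp.isProbabilityMeasure_stateLaw hπ h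
  set E : ℝ := η + 2 * (M * √(2 * ε) + √y) with hE
  have hE0 : 0 ≤ E := by positivity
  have hq : IsNextDist (nextDist f h) := by
    rw [nextDist_eq_curDist]; exact isNextDist_curDist hf (h + 1)
  have hbm := measurable_backup (mdp.step h) hq₀
  have hRm : ∀ z, Measurable fun y : 𝒳 × 𝒜 =>
      sqrtRatio (backup (mdp.step h) q₀) u η y.1 y.2 z := fun z =>
    Real.continuous_sqrt.measurable.comp ((hum z).div (((hbm z).const_mul _).add_const _))
  have hR0 : ∀ x a z, 0 ≤ sqrtRatio (backup (mdp.step h) q₀) u η x a z := fun x a z =>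
    Real.sqrt_nonneg _
  have hA : (0 : ℝ) < Fintype.card 𝒜 := by exact_mod_cast Fintype.card_pos
  let T : 𝒳 → ℝ := fun x => (Fintype.card 𝒜 : ℝ)⁻¹ * ∑ a, hellSq (f h x a)
    (backup (mdp.step h) (nextDist f h) x a)
  have hb : ∀ x a, backup (mdp.step h) (nextDist f h) x a ∈ stdSimplex ℝ (Fin M) :=
    backup_mem _ hq
  have hTm : Measurable T := (Finset.measurable_fun_sum _ fun a _ => measurable_hellSq_comp hf
    ((hf h).measurable a) ((isCondDist_backup (mdp.step h) hq).measurable a)).const_mul _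
  have hcard : (Fintype.card 𝒜 : ℝ)⁻¹ * ∑ _a : 𝒜, (1 : ℝ) = 1 := by
    simp [hA.ne']
  have hT1 : ∀ x, T x ≤ 1 := fun x => by
    rw [← hcard]
    exact mul_le_mul_of_nonneg_left (Finset.sum_le_sum fun a _ => hellSq_le_one _ _) (by positivity)
  have hT0 : ∀ x, 0 ≤ T x := fun x => mul_nonneg (by positivity)
    (Finset.sum_nonneg fun a _ => hellSq_nonneg ((hf h).mem x a) (hb x a))
  have hTi : Integrable T (mdp.stateLaw (greedyPolicy f') h) :=
    Integrable.of_bound hTm.aestronglyMeasurable 1 (Filter.Eventually.of_forall fun x => by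
      rw [Real.norm_eq_abs, abs_of_nonneg (hT0 x)]; exact hT1 x)
  have hTi' : Integrable (fun x => 1 - T x) (mdp.stateLaw (greedyPolicy f') h) :=
    (integrable_const _).sub hTi
  have hTE : Integrable (fun x => 1 - T x + E) (mdp.stateLaw (greedyPolicy f') h) :=
    hTi'.add (integrable_const _)
  have hpt : ∀ x, (Fintype.card 𝒜 : ℝ≥0∞)⁻¹ * ∑ a, ∑ z,
      ENNReal.ofReal (backup (mdp.step h) q₀ x a z) *
        ENNReal.ofReal (sqrtRatio (backup (mdp.step h) q₀) u η x a z) ≤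
      ENNReal.ofReal (1 - T x + E) := fun x => by
    have e1 : ∀ a, ∑ z, ENNReal.ofReal (backup (mdp.step h) q₀ x a z) *
        ENNReal.ofReal (sqrtRatio (backup (mdp.step h) q₀) u η x a z) =
        ENNReal.ofReal (∑ z, backup (mdp.step h) q₀ x a z *
          sqrtRatio (backup (mdp.step h) q₀) u η x a z) := fun a => by
      have h0 := (backup_mem (mdp.step h) hq₀ x a).1
      rw [ENNReal.ofReal_sum_of_nonneg fun z _ => mul_nonneg (h0 z) (hR0 x a z)]
      exact Finset.sum_congr rfl fun z _ => (ENNReal.ofReal_mul (h0 z)).symm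
    have e2 : ∀ a, ∑ z, backup (mdp.step h) q₀ x a z *
        sqrtRatio (backup (mdp.step h) q₀) u η x a z ≤
        1 - hellSq (f h x a) (backup (mdp.step h) (nextDist f h) x a) + E := fun a => by
      have := sum_mul_sqrt_div_le ((hf h).mem x a) (hb x a) (backup_mem (mdp.step h) hq₀ x a) hε hη
        hη' (hu0 x a) (hu x a) (hy x a)
      unfold hellSq
      rw [sub_sub_cancel]
      exact this
    simp only [e1]
    have e3 : (Fintype.card 𝒜 : ℝ≥0∞)⁻¹ = ENNReal.ofReal (Fintype.card 𝒜 : ℝ)⁻¹ := by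
      rw [ENNReal.ofReal_inv_of_pos hA, ENNReal.ofReal_natCast]
    rw [e3, ← ENNReal.ofReal_sum_of_nonneg fun a _ => Finset.sum_nonneg fun z _ =>
      mul_nonneg ((backup_mem (mdp.step h) hq₀ x a).1 z) (hR0 x a z),
      ← ENNReal.ofReal_mul (by positivity)]
    refine ENNReal.ofReal_le_ofReal ((mul_le_mul_of_nonneg_left (Finset.sum_le_sum fun a _ => e2 a)
      (by positivity)).trans_eq ?_)
    rw [Finset.sum_add_distrib, Finset.sum_sub_distrib, mul_add, mul_sub, hcard]
    have : (Fintype.card 𝒜 : ℝ)⁻¹ * ∑ _a : 𝒜, E = E := by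
      rw [Finset.sum_const, Finset.card_univ, nsmul_eq_mul, inv_mul_cancel_left₀ hA.ne']
    rw [this]
  have hFm := measurable_comp_nextTarget hq₀ hRm
  rw [integral_eq_lintegral_of_nonneg_ae (Filter.Eventually.of_forall fun s => hR0 _ _ _)
    hFm.aestronglyMeasurable, mdp.lintegral_uaeLaw_nextTarget hπ h hq₀
    (G := fun x a z => ENNReal.ofReal (sqrtRatio (backup (mdp.step h) q₀) u η x a z))
    fun z => (hRm z).ennreal_ofReal]
  have hI : ∫ x, (1 - T x + E) ∂(mdp.stateLaw (greedyPolicy f') h) =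
      1 - mdp.exploreErr f' f h + E := by
    rw [integral_add hTi' (integrable_const _),
      integral_sub (integrable_const _) hTi]
    simp [T, MDP.exploreErr]
  rw [← hI]
  have hnn : ∀ x, 0 ≤ 1 - T x + E := fun x => by linarith [hT1 x]
  refine ENNReal.toReal_le_of_le_ofReal (integral_nonneg hnn) ?_
  rw [ofReal_integral_eq_lintegral_ofReal hTE
    (Filter.Eventually.of_forall hnn)]
  exact lintegral_mono hpt

end Concentration

end

end DistRL

namespace DistRL

noncomputable section

set_option linter.unusedSectionVars false

/-! ### Small exploration error of all elements of the confidence sets. -/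

section Deterministic

/-- A likelihood-ratio bound with perturbed labels, turned into a bound on a sum of exponents. -/
theorem sum_le_of_prod_lt {ι : Type*} {I : Finset ι} {f g u₀ g₀ r l : ι → ℝ} {τ R t : ℝ}
    (hg : ∀ i ∈ I, 0 < g i) (hf : ∀ i ∈ I, 0 ≤ f i) (hg₀ : ∀ i ∈ I, 0 < g₀ i)
    (hu₀ : ∀ i ∈ I, 0 ≤ u₀ i)
    (hr : ∀ i ∈ I, f i * g₀ i ≤ r i * (u₀ i * g i)) (hR : ∏ i ∈ I, r i ≤ Real.exp R)
    (hτ : ∏ i ∈ I, g i ≤ Real.exp τ * ∏ i ∈ I, f i) (ht : 0 < t)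
    (hlt : ∏ i ∈ I, (√(u₀ i / g₀ i) * Real.exp (l i)) < t) :
    ∑ i ∈ I, l i ≤ Real.log t + (R + τ) / 2 := by
  have hgp : 0 < ∏ i ∈ I, g i := Finset.prod_pos hg
  have hg0p : 0 < ∏ i ∈ I, g₀ i := Finset.prod_pos hg₀
  have hup : 0 ≤ ∏ i ∈ I, u₀ i := Finset.prod_nonneg hu₀
  have hfp : 0 < ∏ i ∈ I, f i := by
    have := hgp.trans_le hτ
    exact pos_of_mul_pos_right this (Real.exp_pos τ).le
  have h1 : (∏ i ∈ I, f i) * ∏ i ∈ I, g₀ i ≤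
      (∏ i ∈ I, r i) * ((∏ i ∈ I, u₀ i) * ∏ i ∈ I, g i) := by
    simp only [← Finset.prod_mul_distrib]
    exact Finset.prod_le_prod (fun i hi => mul_nonneg (hf i hi) (hg₀ i hi).le) hr
  -- The confidence-set inequality is stated with the labels of the candidate; `r` pays for passing
  -- to those of the representative, for which the supermartingale bound is available.
  have h2 : ∏ i ∈ I, g₀ i ≤ Real.exp (R + τ) * ∏ i ∈ I, u₀ i := by
    refine le_of_mul_le_mul_left (h1.trans ?_) hfp
    calc (∏ i ∈ I, r i) * ((∏ i ∈ I, u₀ i) * ∏ i ∈ I, g i)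
        ≤ Real.exp R * ((∏ i ∈ I, u₀ i) * (Real.exp τ * ∏ i ∈ I, f i)) := by gcongr
      _ = _ := by rw [Real.exp_add]; ring
  have h3 : Real.exp (-(R + τ)) ≤ ∏ i ∈ I, u₀ i / g₀ i := by
    rw [Finset.prod_div_distrib, le_div_iff₀ hg0p, Real.exp_neg, inv_mul_le_iff₀ (Real.exp_pos _)]
    exact h2
  have h4 : Real.exp (-(R + τ) / 2) ≤ ∏ i ∈ I, √(u₀ i / g₀ i) := by
    rw [Real.exp_half, ← Real.sqrt_prod _ fun i hi => div_nonneg (hu₀ i hi) (hg₀ i hi).le]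
    exact Real.sqrt_le_sqrt h3
  have h5 : Real.exp (-(R + τ) / 2 + ∑ i ∈ I, l i) < t := by
    refine lt_of_le_of_lt ?_ hlt
    rw [Finset.prod_mul_distrib, Real.exp_add, Real.exp_sum]
    gcongr
  have h6 := (Real.lt_log_iff_exp_lt ht).2 h5
  linarith

end Deterministic

section Concentration

variable {𝒳 𝒜 Ω : Type*} [MeasurableSpace 𝒳] [MeasurableSpace 𝒜] [MeasurableSingletonClass 𝒜]
  [Fintype 𝒜] [LinearOrder 𝒜] [Nonempty 𝒜] {H M d K : ℕ} [NeZero H] [NeZero M] {mdp : MDP 𝒳 𝒜 H M}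
  {φs : Fin H → 𝒳 → 𝒜 → EuclideanSpace ℝ (Fin d)} {Φ : Finset (𝒳 → 𝒜 → EuclideanSpace ℝ (Fin d))}
  {mΩ : MeasurableSpace Ω} {P : Measure Ω} [IsProbabilityMeasure P] {ℱ : Filtration (Fin K) mΩ}
  {f : Fin K → Ω → Fin H → 𝒳 → 𝒜 → Fin M → ℝ} {D : Fin K → Fin H → Ω → Sample 𝒳 𝒜 M} {τ : ℝ}

/-- Elements of the confidence sets have small error along the played policies. -/
theorem IsODiscoRun.measure_sum_exploreErr_gt_le (hr : mdp.IsLowRank φs) (hd : 0 < d)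
    (hreal : ∀ h, φs h ∈ Φ) (hΦ : ∀ φ ∈ Φ, Measurable fun y : 𝒳 × 𝒜 => φ y.1 y.2)
    (hrun : IsODiscoRun mdp (linClass Φ M) τ P ℱ f D) (h : Fin H) {n m T I N : ℕ}
    (hT : T = Fintype.card ((𝒜 × 𝒜) ⊕ (𝒜 × Fin M))) (hI : I = d * M + 1) {ρ δ η t : ℝ} (hm : m ≠ 0)
    (hρ0 : 0 ≤ ρ) (hρ : ghostBound n m T I ≤ ρ ^ m) (hδ0 : 0 ≤ δ)
    (hδ : #Φ * (K * (2 * d)) ^ m * ghostBound n m T I ≤ δ)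
    (hN : d ≤ N) (hη : 0 < η) (hη' : η ≤ 1 / 2) (ht : 0 < t)
    (htδ : (#Φ * (4 * N + 1) ^ (d * M)) * (#Φ * (n * T + 1) ^ I) * K / t ≤ δ) :
    P {ω | ∃ k, K * (η + 2 * (M * √(2 * (d / N)) + √(4 * d * ρ))) + (Real.log t +
        (m * Real.log (M / η * (N / d)) + τ) / 2) <
        ∑ i ∈ Iio k, mdp.exploreErr (f i ω) (f k ω) h} ≤ ENNReal.ofReal (2 * δ) := by
  classical
  have hd0 : (0 : ℝ) < d := by exact_mod_cast hd
  have hM0 : (0 : ℝ) < M := by exact_mod_cast NeZero.pos M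
  have hM1 : (1 : ℝ) ≤ M := by exact_mod_cast NeZero.one_le (n := M)
  have hNd : (d : ℝ) ≤ N := by exact_mod_cast hN
  have hN0 : (0 : ℝ) < N := hd0.trans_le hNd
  obtain ⟨𝒩, hcard, h𝒩, hnet⟩ := exists_upper_net (M := M) hΦ (hd.trans_le hN)
  obtain ⟨𝒬, h𝒬, hcard', hcov⟩ := hrun.exists_cover hr hd hreal hΦ h hT hI hm hρ0 hρ hδ
  have hstep := mdp.markov h
  have hfm := hrun.ae_isCondDist hΦ
  set ε : ℝ := d / N with hε
  have hε0 : 0 < ε := by positivity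
  -- The price of one wrong label: the densities `f` and `g` are at most 1, the smoothed backup is
  -- at least `η / M` and the bracket at least `d / N`.
  set R : ℝ := M / η * (N / d) with hRdef
  have hR1 : 1 ≤ R := one_le_mul_of_one_le_of_one_le ((one_le_div hη).2 (by linarith))
    ((one_le_div hd0).2 hNd)
  set E : ℝ := η + 2 * (M * √(2 * ε) + √(4 * d * ρ)) with hE
  have hE0 : 0 ≤ E := by positivity
  let F : 𝒩 × 𝒬 → Sample 𝒳 𝒜 M → ℝ := fun p s =>
    sqrtRatio (backup (mdp.step h) p.2.1) p.1.1 η s.1.1.1 s.1.1.2 (nextTarget p.2.1 s)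
  have hbm := fun p : 𝒩 × 𝒬 => measurable_backup (mdp.step h) (h𝒬 _ p.2.2)
  have hF : ∀ p, Measurable (F p) := fun p => measurable_comp_nextTarget (h𝒬 _ p.2.2) fun z =>
    Real.continuous_sqrt.measurable.comp
      (((h𝒩 _ p.1.2).1 z).div (((hbm p z).const_mul _).add_const _))
  have hg : ∀ q₀ ∈ 𝒬, ∀ x a z, η / M ≤ (1 - η) * backup (mdp.step h) q₀ x a z + η / M :=
    fun q₀ hq x a z => by
      have := mul_nonneg (by linarith : 0 ≤ 1 - η) ((backup_mem (mdp.step h) (h𝒬 _ hq) x a).1 z)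
      linarith
  have hlin : ∀ g ∈ linClass Φ M, ∀ x a z, g x a z ≤ 1 := fun g hg x a z =>
    (le_abs_self _).trans (abs_le_one_of_mem (hg.1 x a) z)
  have hηM : 0 < η / M := by positivity
  have hFB : ∀ p x, F p x ∈ Set.Icc 0 √((1 + 2 * ε) / (η / M)) := fun p s => by
    refine ⟨Real.sqrt_nonneg _, Real.sqrt_le_sqrt ?_⟩
    obtain ⟨-, -, g, hgl, hgu⟩ := h𝒩 _ p.1.2
    exact div_le_div₀ (by positivity) ((hgu _ _ _).trans (by
      have := hlin g hgl s.1.1.1 s.1.1.2 (nextTarget p.2.1 s); linarith)) hηM (hg _ p.2.2 _ _ _)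
  have htail := (hrun.isCondLaw hΦ h).measure_exists_prod_ge_le hF hFB ht
  have htδ' : (Fintype.card (𝒩 × 𝒬) * K / t : ℝ) ≤ δ := by
    refine le_trans ?_ htδ
    rw [Fintype.card_prod, Fintype.card_coe, Fintype.card_coe]
    have h1 : (#𝒩 : ℝ) ≤ #Φ * (4 * N + 1) ^ (d * M) := by exact_mod_cast hcard
    have h2 : (#𝒬 : ℝ) ≤ #Φ * (n * T + 1) ^ I := by exact_mod_cast hcard'
    push_cast
    gcongr
  have hsub : ∀ᵐ ω ∂P, ω ∈ {ω | ∃ k, K * E + (Real.log t + (m * Real.log R + τ) / 2) <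
        ∑ i ∈ Iio k, mdp.exploreErr (f i ω) (f k ω) h} → ω ∈
      {ω | ∃ f : Fin H → 𝒳 → 𝒜 → Fin M → ℝ, (∀ h, f h ∈ linClass Φ M) ∧ ∀ q₀ ∈ 𝒬,
        ¬ IsApprox (mdp.step h) (fun i => D i h ω) (4 * d * ρ) m (nextDist f h) q₀} ∪
      {ω | ∃ (p : 𝒩 × 𝒬) (k : Fin K), t ≤ ∏ j ∈ Iio k, (F p (D j h ω) *
        Real.exp (1 - ∫ x, F p x ∂(mdp.uaeLaw (greedyPolicy (f j ω)) h)))} := by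
    filter_upwards [hfm, ae_all_iff.2 hrun.mem_confSet] with ω hω hconf
    rintro ⟨k, hk⟩
    by_contra hcon
    rw [Set.mem_union, not_or] at hcon
    obtain ⟨hc1, hc2⟩ := hcon
    simp only [Set.mem_ofPred_eq, not_exists, not_and, not_forall, not_not, not_le] at hc1 hc2
    obtain ⟨hmem, hlik⟩ := mem_confSet_iff.1 (hconf k)
    obtain ⟨q₀, hq₀, hy, hmis⟩ := hc1 _ hmem
    obtain ⟨u, hu, hfu⟩ := hnet _ (hmem h)
    have hlt := hc2 (⟨u, hu⟩, ⟨q₀, hq₀⟩) k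
    let x : Fin K → 𝒳 := fun i => (D i h ω).1.1.1
    let a : Fin K → 𝒜 := fun i => (D i h ω).1.1.2
    let z : Fin K → Fin M := fun i => nextTarget (nextDist (f k ω) h) (D i h ω)
    let z₀ : Fin K → Fin M := fun i => nextTarget q₀ (D i h ω)
    -- The competitor is the smoothed backup of the representative, not of the candidate: it ranges
    -- over a finite family, and completeness puts it in the class.
    let g : 𝒳 → 𝒜 → Fin M → ℝ := fun x a z => (1 - η) * backup (mdp.step h) q₀ x a z + η / M
    have hgl : g ∈ linClass Φ M :=
      hr.backup_mem_linClass hreal h (h𝒬 _ hq₀) ⟨hη.le, by linarith⟩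
    have hgp : ∀ x a z, 0 < g x a z := fun x a z => hηM.trans_le (hg _ hq₀ x a z)
    have hf0 : ∀ x a z, 0 ≤ f k ω h x a z := fun x a z => ((hω k h).mem x a).1 z
    have hu0 : ∀ x a z, ε ≤ u x a z := (h𝒩 _ hu).2.1
    have hprod : ∏ i ∈ Iio k, g (x i) (a i) (z i) ≤
        Real.exp τ * ∏ i ∈ Iio k, f k ω h (x i) (a i) (z i) := by
      have := hlik h g hgl
      rw [← ENNReal.ofReal_prod_of_nonneg fun i _ => (hgp _ _ _).le,
        ← ENNReal.ofReal_prod_of_nonneg fun i _ => hf0 _ _ _,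
        ← ENNReal.ofReal_mul (Real.exp_pos τ).le] at this
      exact (ENNReal.ofReal_le_ofReal_iff
        (mul_nonneg (Real.exp_pos τ).le (Finset.prod_nonneg fun i _ => hf0 _ _ _))).1 this
    have hsum := sum_le_of_prod_lt (I := Iio k) (f := fun i => f k ω h (x i) (a i) (z i))
      (g := fun i => g (x i) (a i) (z i)) (u₀ := fun i => u (x i) (a i) (z₀ i))
      (g₀ := fun i => g (x i) (a i) (z₀ i)) (r := fun i => if z i ≠ z₀ i then R else 1)
      (l := fun j => 1 - ∫ x, F (⟨u, hu⟩, ⟨q₀, hq₀⟩) x ∂(mdp.uaeLaw (greedyPolicy (f j ω)) h))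
      (τ := τ) (R := m * Real.log R) (t := t) (fun i _ => hgp _ _ _) (fun i _ => hf0 _ _ _)
      (fun i _ => hgp _ _ _) (fun i _ => hε0.le.trans (hu0 _ _ _)) (fun i _ => ?_) ?_ hprod ht hlt
    rotate_left
    · by_cases hz : z i = z₀ i
      · simp only [hz, ne_eq, not_true_eq_false, if_false, one_mul]
        exact mul_le_mul_of_nonneg_right (hfu _ _ _).1 (hgp _ _ _).le
      · simp only [ne_eq, hz, not_false_eq_true, if_true]
        calc f k ω h (x i) (a i) (z i) * g (x i) (a i) (z₀ i) ≤ 1 * 1 :=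
              mul_le_mul (hlin _ (hmem h) _ _ _) (hlin _ hgl _ _ _) (hgp _ _ _).le zero_le_one
          _ = R * (ε * (η / M)) := by rw [hRdef, hε]; field_simp
          _ ≤ _ := by
              gcongr
              · exact hε0.le.trans (hu0 _ _ _)
              · exact hu0 _ _ _
              · exact hg _ hq₀ _ _ _
    · rw [Finset.prod_ite, Finset.prod_const, Finset.prod_const_one, mul_one, mul_comm,
        Real.exp_mul, Real.exp_log (by linarith), Real.rpow_natCast]
      refine pow_le_pow_right₀ hR1 (le_trans (Finset.card_le_card ?_) hmis)
      intro i hi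
      simp only [Finset.mem_filter] at hi
      simpa using hi.2
    have hterm : ∀ j, mdp.exploreErr (f j ω) (f k ω) h - E ≤
        1 - ∫ x, F (⟨u, hu⟩, ⟨q₀, hq₀⟩) x ∂(mdp.uaeLaw (greedyPolicy (f j ω)) h) := fun j => by
      have := MDP.integral_sqrtRatio_le (mdp := mdp) (hω k) (hω j) h (h𝒬 _ hq₀) (h𝒩 _ hu).1 hε0.le
        hη hη' (fun x a z => hε0.le.trans (hu0 x a z)) (fun x a z => (hfu x a z).2) hy
      simp only [F]
      linarith
    have h7 : ∑ j ∈ Iio k, mdp.exploreErr (f j ω) (f k ω) h ≤ K * E + ∑ j ∈ Iio k,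
        (1 - ∫ x, F (⟨u, hu⟩, ⟨q₀, hq₀⟩) x ∂(mdp.uaeLaw (greedyPolicy (f j ω)) h)) := by
      have h8 := Finset.sum_le_sum fun j (_ : j ∈ Iio k) => hterm j
      rw [Finset.sum_sub_distrib, Finset.sum_const, nsmul_eq_mul] at h8
      have h9 : ((#(Iio k) : ℕ) : ℝ) ≤ K := by
        exact_mod_cast (Finset.card_le_univ _).trans_eq (Fintype.card_fin K)
      have := mul_le_mul_of_nonneg_right h9 hE0
      linarith
    linarith
  refine (measure_mono_ae hsub).trans ((measure_union_le _ _).trans ?_)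
  rw [two_mul, ENNReal.ofReal_add hδ0 hδ0]
  exact add_le_add hcov (htail.trans (ENNReal.ofReal_le_ofReal htδ'))

end Concentration

end

end DistRL

namespace DistRL

noncomputable section

set_option linter.unusedSectionVars false

/-! ### Choice of the discretization parameters. -/

section Numerics

/-- The numerator is at most `(X ^ 13) ^ (2 * I) ≤ X ^ m` and the binomial at least `(X ^ 10) ^ m /
m ! ≥ X ^ (9 * m)`. The remaining `X ^ (-8 m)` beats the factor `(2 d K) ^ m` of the union over
positions. -/
theorem ghostBound_le {X m T I : ℕ} (hX : 2 ≤ X) (hm : m ≤ X) (hT : T ≤ X ^ 2) (hI : 26 * I ≤ m) :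
    ghostBound (X ^ 10) m T I ≤ (((X : ℝ) ^ 8)⁻¹) ^ m := by
  have hX0 : 0 < X := by omega
  have hXr : (0 : ℝ) < X := by exact_mod_cast hX0
  have h1 : ((X ^ 10 + m) * T + 1) ^ (2 * I) ≤ X ^ m := by
    have h2 : (X ^ 10 + m) * T + 1 ≤ X ^ 13 := by
      have h3 : X ^ 1 ≤ X ^ 10 := Nat.pow_le_pow_right hX0 (by norm_num)
      have h3' : X ^ 1 ≤ X ^ 8 := Nat.pow_le_pow_right hX0 (by norm_num)
      have h4 : (X ^ 10 + m) * T ≤ (X ^ 10 + X) * X ^ 2 := by gcongr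
      have h5 : (X ^ 10 + X) * X ^ 2 + 1 ≤ 2 * X ^ 12 := by
        have h6 : 2 ^ 3 ≤ X ^ 3 := Nat.pow_le_pow_left hX 3
        have h7 : 2 ^ 9 ≤ X ^ 9 := Nat.pow_le_pow_left hX 9
        have h8 : X ^ 12 = X ^ 9 * X ^ 3 := by ring
        have h9 : (X ^ 10 + X) * X ^ 2 = X ^ 12 + X ^ 3 := by ring
        nlinarith
      calc _ ≤ 2 * X ^ 12 := by omega
        _ ≤ X * X ^ 12 := by gcongr
        _ = X ^ 13 := by ring
    calc _ ≤ (X ^ 13) ^ (2 * I) := Nat.pow_le_pow_left h2 _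
      _ = X ^ (26 * I) := by rw [← pow_mul]; congr 1; ring
      _ ≤ X ^ m := Nat.pow_le_pow_right hX0 hI
  have h2 : X ^ (9 * m) ≤ (X ^ 10 + m).choose m := by
    have h3 := Nat.pow_sub_le_descFactorial (X ^ 10 + m) m
    rw [Nat.descFactorial_eq_factorial_mul_choose] at h3
    have h4 : m.factorial ≤ X ^ m := (Nat.factorial_le_pow m).trans (Nat.pow_le_pow_left hm m)
    have h5 : X ^ m * X ^ (9 * m) ≤ X ^ m * (X ^ 10 + m).choose m := by
      calc X ^ m * X ^ (9 * m) = (X ^ 10) ^ m := by rw [← pow_add, ← pow_mul]; congr 1; ring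
        _ ≤ (X ^ 10 + m + 1 - m) ^ m := Nat.pow_le_pow_left (by omega) _
        _ ≤ _ := h3
        _ ≤ _ := Nat.mul_le_mul_right _ h4
    exact Nat.le_of_mul_le_mul_left h5 (by positivity)
  unfold ghostBound
  have h1' : (((X ^ 10 + m) * T + 1) ^ (2 * I) : ℕ) ≤ (X : ℝ) ^ m := by exact_mod_cast h1
  have h2' : (X : ℝ) ^ (9 * m) ≤ ((X ^ 10 + m).choose m : ℕ) := by exact_mod_cast h2
  calc _ ≤ (X : ℝ) ^ m / (X : ℝ) ^ (9 * m) := div_le_div₀ (by positivity) h1' (by positivity) h2'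
    _ = _ := by
      rw [div_eq_iff (by positivity), inv_pow, ← pow_mul, eq_comm, inv_mul_eq_iff_eq_mul₀
        (by positivity), ← pow_add]
      congr 1; ring

end Numerics

section Instantiation

variable {𝒳 𝒜 Ω : Type*} [MeasurableSpace 𝒳] [MeasurableSpace 𝒜] [MeasurableSingletonClass 𝒜]
  [Fintype 𝒜] [LinearOrder 𝒜] [Nonempty 𝒜] {H M d K : ℕ} [NeZero H] [NeZero M] {mdp : MDP 𝒳 𝒜 H M}
  {φs : Fin H → 𝒳 → 𝒜 → EuclideanSpace ℝ (Fin d)} {Φ : Finset (𝒳 → 𝒜 → EuclideanSpace ℝ (Fin d))}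
  {mΩ : MeasurableSpace Ω} {P : Measure Ω} [IsProbabilityMeasure P] {ℱ : Filtration (Fin K) mΩ}
  {f : Fin K → Ω → Fin H → 𝒳 → 𝒜 → Fin M → ℝ} {D : Fin K → Fin H → Ω → Sample 𝒳 𝒜 M}
  {δ β L : ℝ}

/-- The problem size, in which all discretization parameters are polynomial. -/
def size (𝒜 : Type*) [Fintype 𝒜] (d M H K : ℕ) : ℕ := 100 * (d * M * H * K * Fintype.card 𝒜)

theorem mul_le_size (hd : 0 < d) (hK : 0 < K) {a : ℕ} (ha : a ∣ d * M * H * K * Fintype.card 𝒜) :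
    100 * a ≤ size 𝒜 d M H K :=
  Nat.mul_le_mul_left _ (Nat.le_of_dvd (by
    have := NeZero.pos H
    have := NeZero.pos M
    have := Fintype.card_pos (α := 𝒜)
    positivity) ha)

theorem log_size_le (hd : 0 < d) (hK : 0 < K)
    (hL : L = 1 + Real.log (d * M * H * K * Fintype.card 𝒜)) :
    1 ≤ L ∧ 4 ≤ Real.log (size 𝒜 d M H K) ∧ Real.log (size 𝒜 d M H K) ≤ 5 * L := by
  have hH := NeZero.pos H
  have hM := NeZero.pos M
  have hA := Fintype.card_pos (α := 𝒜)
  have hY : 0 < d * M * H * K * Fintype.card 𝒜 := by positivity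
  have hY1 : (1 : ℝ) ≤ d * M * H * K * Fintype.card 𝒜 := by exact_mod_cast hY
  have h0 := Real.log_nonneg hY1
  have h1 : Real.log (size 𝒜 d M H K) = Real.log 100 + (L - 1) := by
    rw [hL, size]
    push_cast
    rw [Real.log_mul (by norm_num) (by positivity)]
    ring
  have h2 : Real.log 100 ≤ 5 := by
    rw [Real.log_le_iff_le_exp (by norm_num)]
    have := Real.exp_one_gt_d9
    have h3 : Real.exp 5 = Real.exp 1 ^ 5 := by rw [← Real.exp_nat_mul]; norm_num
    rw [h3]
    calc (100 : ℝ) ≤ 2.7 ^ 5 := by norm_num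
      _ ≤ _ := by gcongr; linarith
  have h3 : 4 ≤ Real.log 100 := by
    rw [Real.le_log_iff_exp_le (by norm_num)]
    have := Real.exp_one_lt_d9
    have h3 : Real.exp 4 = Real.exp 1 ^ 4 := by rw [← Real.exp_nat_mul]; norm_num
    rw [h3]
    calc Real.exp 1 ^ 4 ≤ 2.72 ^ 4 := by gcongr; linarith
      _ ≤ _ := by norm_num
  exact ⟨by linarith, by linarith, by linarith⟩

theorem card_eq_mul_exp (hΦ : Φ.Nonempty) (hδ : 0 < δ)
    (hβ : β = d * M + Real.log (Φ.card / δ)) : (#Φ : ℝ) = δ * Real.exp (β - d * M) := by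
  have hc : (0 : ℝ) < #Φ := by exact_mod_cast hΦ.card_pos
  rw [hβ, add_sub_cancel_left, Real.exp_log (by positivity)]
  field_simp

theorem mul_le_of_eq_add_log (hΦ : Φ.Nonempty) (hδ : 0 < δ) (hδ' : δ < 1)
    (hβ : β = d * M + Real.log (Φ.card / δ)) : (d * M : ℝ) ≤ β := by
  have hc : (1 : ℝ) ≤ #Φ := by exact_mod_cast hΦ.card_pos
  rw [hβ, le_add_iff_nonneg_right]
  exact Real.log_nonneg ((one_le_div hδ).2 (by linarith))

/-- The union over steps, episodes and brackets has a logarithm of order `L * β`, and the fineness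
`X ^ 5` keeps the accumulated excess mass of a bracket below `e`. -/
theorem optimism_threshold (hΦ : Φ.Nonempty) (hd : 0 < d) (hK : 0 < K) (hδ : 0 < δ) (hδ' : δ < 1)
    (hβ : β = d * M + Real.log (Φ.card / δ))
    (hL : L = 1 + Real.log (d * M * H * K * Fintype.card 𝒜)) :
    (H * K * (#Φ * (4 * (size 𝒜 d M H K ^ 5 : ℕ) + 1) ^ (d * M)) : ℝ) *
      (1 + 2 * M * (d / (size 𝒜 d M H K ^ 5 : ℕ))) ^ K ≤ δ / 2 * Real.exp (50 * L * β) := by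
  obtain ⟨hL1, hl4, hl5⟩ := log_size_le (𝒜 := 𝒜) (M := M) (H := H) hd hK hL
  have hdM := mul_le_of_eq_add_log hΦ hδ hδ' hβ
  have hcard := card_eq_mul_exp hΦ hδ hβ
  have hHK : (100 : ℝ) * (H * K) ≤ size 𝒜 d M H K := by
    exact_mod_cast mul_le_size (𝒜 := 𝒜) (M := M) (H := H) hd hK (a := H * K)
      ⟨d * M * Fintype.card 𝒜, by ring⟩
  have hMdK : (100 : ℝ) * (M * d * K) ≤ size 𝒜 d M H K := by
    exact_mod_cast mul_le_size (𝒜 := 𝒜) (M := M) (H := H) hd hK (a := M * d * K)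
      ⟨H * Fintype.card 𝒜, by ring⟩
  have h100 : (100 : ℝ) ≤ size 𝒜 d M H K := by
    exact_mod_cast mul_le_size (𝒜 := 𝒜) (M := M) (H := H) hd hK (a := 1) ⟨_, (one_mul _).symm⟩
  have hdM1 : (1 : ℝ) ≤ d * M := by
    exact_mod_cast Nat.mul_pos hd (NeZero.pos M)
  set X : ℝ := (size 𝒜 d M H K : ℝ) with hX
  have hX0 : 0 < X := by linarith
  set l := Real.log X with hl
  have hXe : X = Real.exp l := (Real.exp_log hX0).symm
  push_cast
  rw [← hX]
  have h1 : (4 * X ^ 5 + 1) ^ (d * M) ≤ Real.exp (6 * l * (d * M)) := by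
    have : (4 * X ^ 5 + 1) ≤ X ^ 6 := by
      have : 1 ≤ X ^ 5 := one_le_pow₀ (by linarith)
      calc 4 * X ^ 5 + 1 ≤ 5 * X ^ 5 := by linarith
        _ ≤ X * X ^ 5 := by gcongr; linarith
        _ = X ^ 6 := by ring
    calc _ ≤ (X ^ 6) ^ (d * M) := by gcongr
      _ = _ := by
        rw [hXe, ← Real.exp_nat_mul, ← Real.exp_nat_mul]; push_cast; congr 1; ring
  have h2 : (1 + 2 * M * (d / X ^ 5)) ^ K ≤ Real.exp 1 := by
    calc _ ≤ Real.exp (2 * M * (d / X ^ 5)) ^ K := by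
          gcongr; linarith [Real.add_one_le_exp (2 * M * (d / X ^ 5))]
      _ = Real.exp (2 * (M * d * K) / X ^ 5) := by rw [← Real.exp_nat_mul]; congr 1; ring
      _ ≤ Real.exp 1 := by
          rw [Real.exp_le_exp, div_le_one (by positivity)]
          have : X ^ 1 ≤ X ^ 5 := pow_le_pow_right₀ (by linarith) (by norm_num)
          have : 0 ≤ (M * d * K : ℝ) := by positivity
          linarith
  have h3 : (H * K : ℝ) ≤ Real.exp l := by
    rw [← hXe]
    have : 0 ≤ (H * K : ℝ) := by positivity
    linarith
  calc _ ≤ Real.exp l * (δ * Real.exp (β - d * M) * Real.exp (6 * l * (d * M))) * Real.exp 1 := by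
        rw [hcard]; gcongr
    _ = δ * Real.exp (l + (β - d * M) + 6 * l * (d * M) + 1) := by simp only [Real.exp_add]; ring
    _ ≤ δ * Real.exp (50 * L * β - 1) := by
        gcongr
        have h4 : 6 * l * (d * M) ≤ 6 * l * β := by gcongr
        have h5 : l * 1 ≤ l * β := by gcongr; linarith
        have h6 : l * β ≤ 5 * L * β := by gcongr; linarith
        have h7 : 4 * β ≤ l * β := by gcongr; linarith
        linarith
    -- The spare factor `exp (-1) ≤ 1 / 2` leaves half of the failure probability for concentration.
    _ ≤ δ / 2 * Real.exp (50 * L * β) := by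
        rw [Real.exp_sub, div_mul_eq_mul_div, ← mul_div_assoc]
        gcongr
        linarith [Real.add_one_le_exp (1 : ℝ)]

theorem MDP.exploreErr_le_one {f' : Fin H → 𝒳 → 𝒜 → Fin M → ℝ} (hf' : ∀ h, IsCondDist (f' h))
    (f : Fin H → 𝒳 → 𝒜 → Fin M → ℝ) (h : Fin H) : mdp.exploreErr f' f h ≤ 1 := by
  have := mdp.isProbabilityMeasure_stateLaw (isMeasurable_greedyPolicy hf') h
  have hA : (0 : ℝ) < Fintype.card 𝒜 := by exact_mod_cast Fintype.card_pos
  unfold MDP.exploreErr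
  set g : 𝒳 → ℝ := fun x => (Fintype.card 𝒜 : ℝ)⁻¹ *
    ∑ a, hellSq (f h x a) (backup (mdp.step h) (nextDist f h) x a)
  by_cases hi : Integrable g (mdp.stateLaw (greedyPolicy f') h)
  · calc ∫ x, g x ∂(mdp.stateLaw (greedyPolicy f') h) ≤
          ∫ _, 1 ∂(mdp.stateLaw (greedyPolicy f') h) :=
          integral_mono hi (integrable_const _) fun x => by
            simp only [g]
            rw [inv_mul_le_iff₀ hA]
            refine (Finset.sum_le_sum fun a _ => hellSq_le_one _ _).trans_eq ?_
            simp
      _ = 1 := by simp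
  · rw [integral_undef hi]; exact zero_le_one

/-- With high probability, all elements of the confidence sets at step `h` have small error. -/
theorem IsODiscoRun.measure_lt_sum_exploreErr_le (hr : mdp.IsLowRank φs) (hd : 0 < d) (hK : 0 < K)
    (hreal : ∀ h, φs h ∈ Φ) (hΦ : ∀ φ ∈ Φ, Measurable fun y : 𝒳 × 𝒜 => φ y.1 y.2)
    (hδ : 0 < δ) (hδ' : δ < 1) (hβ : β = d * M + Real.log (Φ.card / δ))
    (hL : L = 1 + Real.log (d * M * H * K * Fintype.card 𝒜))
    (hrun : IsODiscoRun mdp (linClass Φ M) (50 * L * β) P ℱ f D) (h : Fin H) :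
    P {ω | ∃ k, 1300 * L * β < ∑ i ∈ Iio k, mdp.exploreErr (f i ω) (f k ω) h} ≤
      ENNReal.ofReal (δ / (2 * H)) := by
  have hΦ' : Φ.Nonempty := ⟨_, hreal h⟩
  obtain ⟨hL1, hl4, hl5⟩ := log_size_le (𝒜 := 𝒜) (M := M) (H := H) hd hK hL
  have hdM := mul_le_of_eq_add_log hΦ' hδ hδ' hβ
  have hcard := card_eq_mul_exp hΦ' hδ hβ
  have hdM1 : (1 : ℝ) ≤ d * M := by
    exact_mod_cast Nat.mul_pos hd (NeZero.pos M)
  have hβ1 : 1 ≤ β := hdM1.trans hdM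
  have hLβ : β ≤ L * β := by nlinarith
  have hH0 : (0 : ℝ) < H := by exact_mod_cast NeZero.pos H
  have hM0 : (0 : ℝ) < M := by exact_mod_cast NeZero.pos M
  have hd0 : (0 : ℝ) < d := by exact_mod_cast hd
  have hK0 : (0 : ℝ) < K := by exact_mod_cast hK
  -- For `K < β` the claim is trivial, each error being at most 1. Otherwise `β ≤ K`, which keeps
  -- `m` below the problem size.
  rcases lt_or_ge (K : ℝ) β with hKβ | hKβ
  · refine (measure_eq_zero_iff_ae_notMem.2 ?_).trans_le zero_le
    filter_upwards [hrun.ae_isCondDist hΦ] with ω hω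
    rintro ⟨k, hk⟩
    have h1 : ∑ i ∈ Iio k, mdp.exploreErr (f i ω) (f k ω) h ≤ K := by
      refine (Finset.sum_le_sum fun i _ => MDP.exploreErr_le_one (hω i) _ h).trans ?_
      rw [Finset.sum_const, nsmul_eq_mul, mul_one]
      exact_mod_cast (Finset.card_le_univ _).trans_eq (Fintype.card_fin K)
    linarith
  set Xn : ℕ := size 𝒜 d M H K with hXn
  have hle := fun {a : ℕ} ha => mul_le_size (𝒜 := 𝒜) (M := M) (H := H) hd hK (a := a) ha
  rw [← hXn] at hle
  have h100n : 100 ≤ Xn := hle (a := 1) ⟨_, (one_mul _).symm⟩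
  have hKn : 100 * K ≤ Xn := hle ⟨d * M * H * Fintype.card 𝒜, by ring⟩
  have hAMn : 100 * (Fintype.card 𝒜 * M) ≤ Xn := hle ⟨d * H * K, by ring⟩
  have hdn : 100 * d ≤ Xn := hle ⟨M * H * K * Fintype.card 𝒜, by ring⟩
  have hKd : (100 : ℝ) * (K * d) ≤ Xn := by
    exact_mod_cast hle (a := K * d) ⟨M * H * Fintype.card 𝒜, by ring⟩
  have hHK : (100 : ℝ) * (H * K) ≤ Xn := by
    exact_mod_cast hle (a := H * K) ⟨d * M * Fintype.card 𝒜, by ring⟩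
  have hKM : (100 : ℝ) * (K * M) ≤ Xn := by
    exact_mod_cast hle (a := K * M) ⟨d * H * Fintype.card 𝒜, by ring⟩
  have hKr : (100 : ℝ) * K ≤ Xn := by exact_mod_cast hKn
  have hMr : (100 : ℝ) * M ≤ Xn := by
    exact_mod_cast hle (a := M) ⟨d * H * K * Fintype.card 𝒜, by ring⟩
  have hHr : (100 : ℝ) * H ≤ Xn := by
    exact_mod_cast hle (a := H) ⟨d * M * K * Fintype.card 𝒜, by ring⟩
  have hdr : (100 : ℝ) * d ≤ Xn := by exact_mod_cast hdn
  have h100 : (100 : ℝ) ≤ Xn := by exact_mod_cast h100n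
  set T : ℕ := Fintype.card ((𝒜 × 𝒜) ⊕ (𝒜 × Fin M)) with hT
  have hTX : T ≤ Xn ^ 2 := by
    have h1 : T = Fintype.card 𝒜 * Fintype.card 𝒜 + Fintype.card 𝒜 * M := by
      rw [hT, Fintype.card_sum, Fintype.card_prod, Fintype.card_prod, Fintype.card_fin]
    have h2 : Fintype.card 𝒜 ≤ Fintype.card 𝒜 * M := Nat.le_mul_of_pos_right _ (NeZero.pos M)
    have h3 : Fintype.card 𝒜 ≤ Xn := by omega
    calc T ≤ Fintype.card 𝒜 * Xn + Xn := by
          rw [h1]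
          exact Nat.add_le_add (Nat.mul_le_mul_left _ h3) (by omega)
      _ = (Fintype.card 𝒜 + 1) * Xn := by ring
      _ ≤ Xn * Xn := Nat.mul_le_mul_right _ (by omega)
      _ = Xn ^ 2 := by ring
  -- Since `β ≥ d * M ≥ 1`, this gives `26 * (d * M + 1) ≤ m`, as the ghost bound requires.
  set m : ℕ := ⌈52 * β⌉₊ with hmdef
  have hm1 : 52 * β ≤ m := Nat.le_ceil _
  have hm2 : (m : ℝ) ≤ 53 * β := by
    have := (Nat.ceil_lt_add_one (by linarith : 0 ≤ 52 * β)).le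
    linarith
  have hm0 : m ≠ 0 := by
    rintro h0
    rw [h0] at hm1
    push_cast at hm1
    linarith
  have hmX : m ≤ Xn := by
    have : (m : ℝ) ≤ Xn := by linarith
    exact_mod_cast this
  have hIm : 26 * (d * M + 1) ≤ m := by
    have : (26 * (d * M + 1) : ℝ) ≤ m := by linarith
    exact_mod_cast this
  have hghost := ghostBound_le (by omega) hmX hTX hIm
  set X : ℝ := (Xn : ℝ) with hX
  have hX0 : 0 < X := by linarith
  have hX1 : 1 ≤ X := by linarith
  set l := Real.log X with hl
  have hXe : Real.exp l = X := Real.exp_log hX0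
  have hXp : ∀ n : ℕ, X ^ n = Real.exp (l * n) := fun n => by
    rw [← hXe, ← Real.exp_nat_mul]; ring_nf
  have hlβ : l * β ≤ 5 * L * β := by gcongr
  have hlβ4 : 4 * β ≤ l * β := by gcongr
  have hlβ1 : l ≤ l * β := le_mul_of_one_le_right (by linarith) hβ1
  have hldM : l * (d * M) ≤ l * β := by gcongr
  have hδ1 : #Φ * (K * (2 * d)) ^ m * ghostBound (Xn ^ 10) m T (d * M + 1) ≤ δ / (4 * H) := by
    have h1 : (K * (2 * d) : ℝ) ≤ X := by
      have : (0 : ℝ) ≤ K * d := by positivity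
      linarith
    have h2 : (4 * H : ℝ) ≤ X := by linarith
    have hgn : 0 ≤ ghostBound (Xn ^ 10) m T (d * M + 1) := by unfold ghostBound; positivity
    rw [le_div_iff₀ (by positivity)]
    calc _ ≤ δ * Real.exp (β - d * M) * X ^ m * ((X ^ 8)⁻¹) ^ m * X := by rw [hcard]; gcongr
      _ = δ * Real.exp (β - d * M + l * m - 8 * l * m + l) := by
          rw [inv_pow, ← pow_mul, hXp, hXp, ← Real.exp_neg, mul_assoc, mul_assoc, mul_assoc]
          rw [← hXe, ← Real.exp_add, ← Real.exp_add, ← Real.exp_add]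
          push_cast
          ring_nf
      _ ≤ δ * Real.exp 0 := by
          gcongr
          have h3 : l * (52 * β) ≤ l * m := by gcongr
          linarith
      _ = δ := by simp
  -- `η`, `ρ` and `N` keep the discretization error over `K` episodes below 1. The exponent 34 in
  -- `t` covers the 6 of the brackets, the 26 of the cover, two factors `#Φ` and the factor `4 * H *
  -- K`.
  have hmain := hrun.measure_sum_exploreErr_gt_le hr hd hreal hΦ h (n := Xn ^ 10) (m := m) (T := T)
    (I := d * M + 1) (N := Xn ^ 5) (ρ := (X ^ 8)⁻¹) (δ := δ / (4 * H)) (η := X⁻¹)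
    (t := Real.exp (34 * (l * β))) hT rfl hm0 (by positivity) hghost (by positivity) hδ1
    ((show d ≤ Xn by omega).trans (Nat.le_self_pow (by norm_num) _)) (by positivity)
    (by rw [inv_le_comm₀ hX0 (by norm_num)]; linarith) (Real.exp_pos _) ?_
  rotate_left
  · rw [div_le_iff₀ (Real.exp_pos _), div_mul_eq_mul_div, le_div_iff₀ (by positivity)]
    push_cast
    rw [← hX]
    have h1 : (4 * X ^ 5 + 1) ^ (d * M) ≤ Real.exp (6 * (l * (d * M))) := by
      have : (4 * X ^ 5 + 1) ≤ X ^ 6 := by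
        have : 1 ≤ X ^ 5 := one_le_pow₀ hX1
        calc 4 * X ^ 5 + 1 ≤ 5 * X ^ 5 := by linarith
          _ ≤ X * X ^ 5 := by gcongr; linarith
          _ = X ^ 6 := by ring
      calc _ ≤ (X ^ 6) ^ (d * M) := by gcongr
        _ = _ := by rw [← pow_mul, hXp]; push_cast; ring_nf
    have h2 : (X ^ 10 * T + 1) ^ (d * M + 1) ≤ Real.exp (26 * (l * (d * M))) := by
      have hTr : (T : ℝ) ≤ X ^ 2 := by rw [hX]; exact_mod_cast hTX
      have : X ^ 10 * T + 1 ≤ X ^ 13 := by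
        have : 1 ≤ X ^ 12 := one_le_pow₀ hX1
        calc X ^ 10 * T + 1 ≤ X ^ 10 * X ^ 2 + X ^ 12 := by gcongr
          _ = 2 * X ^ 12 := by ring
          _ ≤ X * X ^ 12 := by gcongr; linarith
          _ = X ^ 13 := by ring
      calc _ ≤ (X ^ 13) ^ (d * M + 1) := by gcongr
        _ = Real.exp (13 * l * (d * M + 1)) := by rw [← pow_mul, hXp]; push_cast; ring_nf
        _ ≤ _ := by
          rw [Real.exp_le_exp]
          have := mul_le_mul_of_nonneg_left hdM1 (by linarith : 0 ≤ l)
          linarith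
    have h3 : (K * (4 * H) : ℝ) ≤ Real.exp l := by
      rw [hXe]
      have : (0 : ℝ) ≤ H * K := by positivity
      linarith
    calc _ = #Φ * (4 * X ^ 5 + 1) ^ (d * M) * (#Φ * (X ^ 10 * T + 1) ^ (d * M + 1)) *
          (K * (4 * H)) := by ring
      _ ≤ δ * Real.exp (β - d * M) * Real.exp (6 * (l * (d * M))) *
          (1 * Real.exp (β - d * M) * Real.exp (26 * (l * (d * M)))) * Real.exp l := by
          rw [hcard]; gcongr
      _ = δ * Real.exp (β - d * M + 6 * (l * (d * M)) + (β - d * M) + 26 * (l * (d * M)) + l) := by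
          simp only [Real.exp_add]; ring
      _ ≤ δ * Real.exp (34 * (l * β)) := by
          gcongr
          linarith
  have h2δ : 2 * (δ / (4 * H)) = δ / (2 * H) := by field_simp; norm_num
  rw [h2δ] at hmain
  refine (measure_mono fun ω hω => ?_).trans hmain
  obtain ⟨k, hk⟩ := hω
  refine ⟨k, lt_of_le_of_lt ?_ hk⟩
  push_cast
  rw [← hX, Real.log_exp]
  have e1 : K * X⁻¹ ≤ 1 / 100 := by
    rw [← div_eq_mul_inv, div_le_iff₀ hX0]; linarith
  have e2 : √(2 * (d / X ^ 5)) ≤ X⁻¹ := by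
    rw [Real.sqrt_le_left (by positivity), inv_pow, ← mul_div_assoc, div_le_iff₀ (by positivity)]
    calc 2 * (d : ℝ) ≤ X := by linarith
      _ ≤ X ^ 3 := le_self_pow₀ hX1 (by norm_num)
      _ = (X ^ 2)⁻¹ * X ^ 5 := by field_simp
  have e3 : √(4 * d * (X ^ 8)⁻¹) ≤ X⁻¹ := by
    rw [Real.sqrt_le_left (by positivity), inv_pow, ← div_eq_mul_inv, div_le_iff₀ (by positivity)]
    calc 4 * (d : ℝ) ≤ X := by linarith
      _ ≤ X ^ 6 := le_self_pow₀ hX1 (by norm_num)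
      _ = (X ^ 2)⁻¹ * X ^ 8 := by field_simp
  have e4 : K * M * X⁻¹ ≤ 1 / 100 := by
    rw [← div_eq_mul_inv, div_le_iff₀ hX0]; linarith
  have e5 : K * (X⁻¹ + 2 * (M * √(2 * (d / X ^ 5)) + √(4 * d * (X ^ 8)⁻¹))) ≤ 1 := by
    calc _ ≤ K * (X⁻¹ + 2 * (M * X⁻¹ + X⁻¹)) := by gcongr
      _ = K * X⁻¹ + 2 * (K * M * X⁻¹ + K * X⁻¹) := by ring
      _ ≤ 1 := by linarith
  have e6 : Real.log (M / X⁻¹ * (X ^ 5 / d)) ≤ 7 * l := by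
    have hd1 : (1 : ℝ) ≤ d := by exact_mod_cast hd
    have : M / X⁻¹ * (X ^ 5 / d) ≤ X ^ 7 := by
      calc M / X⁻¹ * (X ^ 5 / d) ≤ X / X⁻¹ * (X ^ 5 / 1) := by gcongr; linarith
        _ = X ^ 7 := by field_simp
    refine (Real.log_le_log (by positivity) this).trans_eq ?_
    rw [Real.log_pow, ← hl]
    norm_num
  have e7 : m * Real.log (M / X⁻¹ * (X ^ 5 / d)) ≤ 371 * (l * β) := by
    calc _ ≤ m * (7 * l) := by gcongr
      _ ≤ 53 * β * (7 * l) := by gcongr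
      _ = _ := by ring
  -- In units of `L * β`: `1 + 34 * 5 + (371 * 5 + 50) / 2 < 1300`.
  linarith

end Instantiation

end

end DistRL

namespace DistRL

noncomputable section

/-- The argument yields `H ^ 2` in the lower-order term, weakened here to `H ^ (5 / 2)`; the
optimization error `1 / K` is absorbed there. The constants are `170 * 1300 = 221000 ≤ 500 ^ 2` and
`1 + 4 * 221000 ≤ 10 ^ 6`. -/
theorem second_order_bound_le {H K A d V β L l Λ : ℝ} (hH : 1 ≤ H) (hK : 0 < K) (hA : 1 ≤ A)
    (hd : 1 ≤ d) (hV : 0 ≤ V) (hβ : 1 ≤ β) (hl : 0 ≤ l) (hlL : l ≤ L) (hL : 1 ≤ L)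
    (hΛ : Λ = 170 * (A * (1300 * L * β)) * d * l ^ 2) :
    1 / K + 4 * (H * √(V * Λ / K)) + 4 * (H ^ 2 * Λ / K) ≤
      10 ^ 6 * L ^ 3 * (H * √(V * (A * d * β) / K) + A * d * H ^ (5 / 2 : ℝ) * β / K) := by
  have hΛ1 : Λ ≤ 221000 * L ^ 3 * (A * d * β) := by
    calc Λ = 221000 * (L * l ^ 2) * (A * d * β) := by rw [hΛ]; ring
      _ ≤ 221000 * (L * L ^ 2) * (A * d * β) := by gcongr
      _ = _ := by ring
  have hΛ0 : 0 ≤ Λ := by rw [hΛ]; positivity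
  have hL3 : 1 ≤ L ^ 3 := one_le_pow₀ hL
  have hs : √(V * Λ / K) ≤ 500 * L ^ 3 * √(V * (A * d * β) / K) := by
    calc √(V * Λ / K) ≤ √((500 * L ^ 3) ^ 2 * (V * (A * d * β) / K)) := by
          refine Real.sqrt_le_sqrt ?_
          calc V * Λ / K ≤ V * (221000 * L ^ 3 * (A * d * β)) / K := by gcongr
            _ = 221000 * L ^ 3 * (V * (A * d * β) / K) := by ring
            _ ≤ _ := by
              have : 221000 * L ^ 3 ≤ (500 * L ^ 3) ^ 2 := by nlinarith
              gcongr
      _ = _ := by rw [Real.sqrt_mul (by positivity), Real.sqrt_sq (by positivity)]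
  have hH2 : H ^ 2 ≤ H ^ (5 / 2 : ℝ) := by
    rw [← Real.rpow_natCast]
    exact Real.rpow_le_rpow_of_exponent_le hH (by norm_num)
  have hH1 : 1 ≤ H ^ (5 / 2 : ℝ) := Real.one_le_rpow hH (by norm_num)
  set h := H ^ (5 / 2 : ℝ)
  have h1 : 1 / K ≤ L ^ 3 * (A * d * h * β / K) := by
    rw [← mul_div_assoc]
    gcongr
    have : 1 ≤ A * d * h * β := one_le_mul_of_one_le_of_one_le
      (one_le_mul_of_one_le_of_one_le (one_le_mul_of_one_le_of_one_le hA hd) hH1) hβ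
    exact one_le_mul_of_one_le_of_one_le hL3 this
  have h2 : H ^ 2 * Λ / K ≤ 221000 * L ^ 3 * (A * d * h * β / K) := by
    calc H ^ 2 * Λ / K ≤ h * (221000 * L ^ 3 * (A * d * β)) / K := by gcongr
      _ = _ := by ring
  have h3 : H * √(V * Λ / K) ≤ 500 * L ^ 3 * (H * √(V * (A * d * β) / K)) := by
    calc _ ≤ H * (500 * L ^ 3 * √(V * (A * d * β) / K)) := by gcongr
      _ = _ := by ring
  have h4 : 0 ≤ L ^ 3 * (H * √(V * (A * d * β) / K)) := by positivity
  have h5 : 0 ≤ L ^ 3 * (A * d * h * β / K) := by positivity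
  linarith

end

end DistRL

theorem mainTheorem5 :
    ∃ (c C : ℝ) (p : ℕ), 0 < c ∧ 0 < C ∧
      ∀ {𝒳 𝒜 : Type*} [MeasurableSpace 𝒳] [MeasurableSpace 𝒜] [MeasurableSingletonClass 𝒜]
        [Fintype 𝒜] [LinearOrder 𝒜] [Nonempty 𝒜]
        (H M d K : ℕ) [NeZero H] (hK : 0 < K)
        (mdp : DistRL.MDP 𝒳 𝒜 H M) (hnorm : mdp.Normalized)
        (φs : Fin H → 𝒳 → 𝒜 → EuclideanSpace ℝ (Fin d)) (hrank : mdp.IsLowRank φs)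
        (Φ : Finset (𝒳 → 𝒜 → EuclideanSpace ℝ (Fin d)))
        (hΦ : ∀ φ ∈ Φ, Measurable fun y : 𝒳 × 𝒜 => φ y.1 y.2) (hreal : ∀ h, φs h ∈ Φ)
        (δ β L : ℝ) (hδ : 0 < δ) (hδ' : δ < 1)
        (hβ : β = d * M + Real.log (Φ.card / δ))
        (hL : L = 1 + Real.log (d * M * H * K * Fintype.card 𝒜))
        {Ω : Type*} {mΩ : MeasurableSpace Ω} (P : Measure Ω) [IsProbabilityMeasure P]
        (ℱ : Filtration (Fin K) mΩ)
        (f : Fin K → Ω → Fin H → 𝒳 → 𝒜 → Fin M → ℝ)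
        (D : Fin K → Fin H → Ω → DistRL.Sample 𝒳 𝒜 M)
        (hrun : DistRL.IsODiscoRun mdp (DistRL.linClass Φ M) (c * L * β) P ℱ f D),
        P {ω | ¬ (mdp.mixtureValue (fun k => DistRL.greedyPolicy (f k ω)) - mdp.optValue ≤
            C * L ^ p *
              (H * √(mdp.avgVar (fun k => DistRL.greedyPolicy (f k ω)) *
                  (Fintype.card 𝒜 * d * β) / K) +
                Fintype.card 𝒜 * d * (H : ℝ) ^ (5 / 2 : ℝ) * β / K))} ≤
          ENNReal.ofReal δ := by
  refine ⟨50, 10 ^ 6, 3, by norm_num, by norm_num, ?_⟩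
  intro 𝒳 𝒜 _ _ _ _ _ _ H M d K _ hK mdp hnorm φs hrank Φ hΦ hreal δ β L hδ hδ' hβ hL Ω mΩ P _ ℱ f D
    hrun
  have hM : NeZero M := ⟨mdp.grid_pos.ne'⟩
  have hd : 0 < d := hrank.dim_pos
  have hΦ' : Φ.Nonempty := ⟨_, hreal 0⟩
  have hL1 := (DistRL.log_size_le (𝒜 := 𝒜) (M := M) (H := H) hd hK hL).1
  have hd1 : (1 : ℝ) ≤ d := by exact_mod_cast hd
  have hM1 : (1 : ℝ) ≤ M := by exact_mod_cast NeZero.one_le (n := M)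
  have hH1 : (1 : ℝ) ≤ H := by exact_mod_cast NeZero.one_le (n := H)
  have hK1 : (1 : ℝ) ≤ K := by exact_mod_cast hK
  have hA1 : (1 : ℝ) ≤ Fintype.card 𝒜 := by exact_mod_cast Fintype.card_pos (α := 𝒜)
  have hβ1 : 1 ≤ β := (one_le_mul_of_one_le_of_one_le hd1 hM1).trans
    (DistRL.mul_le_of_eq_add_log hΦ' hδ hδ' hβ)
  have hl : 0 ≤ 1 + Real.log (d * K) := by
    have := Real.log_nonneg (one_le_mul_of_one_le_of_one_le hd1 hK1)
    linarith
  have hlL : 1 + Real.log (d * K) ≤ L := by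
    have : (d * K : ℝ) ≤ d * M * H * K * Fintype.card 𝒜 := by
      calc (d * K : ℝ) = d * 1 * 1 * K * 1 := by ring
        _ ≤ d * M * H * K * Fintype.card 𝒜 := by gcongr
    have := Real.log_le_log (by positivity) this
    linarith
  -- Off the failure of optimism and the failure of concentration at some step, the regret analysis
  -- is deterministic. The events need not be measurable: only monotonicity and subadditivity are
  -- used.
  have hbad : ∀ᵐ ω ∂P, ω ∈ {ω | ¬ (mdp.mixtureValue (fun k => DistRL.greedyPolicy (f k ω)) -
      mdp.optValue ≤ 10 ^ 6 * L ^ 3 *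
        (H * √(mdp.avgVar (fun k => DistRL.greedyPolicy (f k ω)) *
            (Fintype.card 𝒜 * d * β) / K) +
          Fintype.card 𝒜 * d * (H : ℝ) ^ (5 / 2 : ℝ) * β / K))} → ω ∈
      {ω | ∃ k : Fin K, mdp.optCondDist ∉ DistRL.confSet H (DistRL.linClass Φ M) (50 * L * β)
        (Finset.Iio k) (fun i h => D i h ω)} ∪
      ⋃ h, {ω | ∃ k, 1300 * L * β < ∑ i ∈ Finset.Iio k, mdp.exploreErr (f i ω) (f k ω) h} := by
    filter_upwards [hrun.ae_isCondDist hΦ, ae_all_iff.2 hrun.optimistic] with ω hω hopt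
    intro hneg
    by_contra hcon
    simp only [Set.mem_union, Set.mem_iUnion, Set.mem_ofPred_eq, not_or, not_exists, not_not,
      not_lt] at hcon
    obtain ⟨h1, h2⟩ := hcon
    have hV : 0 ≤ mdp.avgVar (fun k => DistRL.greedyPolicy (f k ω)) :=
      mul_nonneg (by positivity) (Finset.sum_nonneg fun k _ => ProbabilityTheory.variance_nonneg _ _)
    refine hneg ((hrank.mixtureValue_sub_le hd (fun h => hΦ _ (hreal h)) hnorm hK hω
      (B := 1300 * L * β) (by nlinarith) h2 (fun k => hopt k _ (h1 k)) rfl).trans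
      (DistRL.second_order_bound_le hH1 (by linarith) hA1 hd1 hV hβ1 hl hlL hL1 rfl))
  have h1 := hrun.measure_optCondDist_notMem_le hrank hreal hΦ
    (pow_pos ((DistRL.mul_le_size (𝒜 := 𝒜) (M := M) (H := H) hd hK (one_dvd _)).trans_lt'
      (by norm_num)) 5 : 0 < DistRL.size 𝒜 d M H K ^ 5)
    (DistRL.optimism_threshold hΦ' hd hK hδ hδ' hβ hL)
  have h2 := fun h => hrun.measure_lt_sum_exploreErr_le hrank hd hK hreal hΦ hδ hδ' hβ hL h
  -- The failure probability is `δ / 2` for optimism and `δ / (2 * H)` for each of the `H` steps.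
  refine (measure_mono_ae hbad).trans ((measure_union_le _ _).trans ((add_le_add h1
    ((measure_iUnion_fintype_le _ _).trans (Finset.sum_le_sum fun h _ => h2 h))).trans_eq ?_))
  rw [← ENNReal.ofReal_sum_of_nonneg fun _ _ => by positivity,
    ← ENNReal.ofReal_add (by positivity) (by positivity)]
  congr 1
  rw [Finset.sum_const, Finset.card_univ, Fintype.card_fin, nsmul_eq_mul]
  field_simp
  norm_num
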